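/- Let $E_0,E_1$ be Banach spaces with $E_1$ continuously and densely embedded in $E_0$, let $\mu\in(0,1)$, and for $\theta\in(0,1)$ let $E_\theta:=(E_0,E_1)^0_{\theta,\infty}$ be the continuous interpolation space: the space of all $x\in E_0$ with $|x|_{E_\theta}:=\sup_{t>0}t^{-\theta}K(t,x)<\infty$ and $t^{-\theta}K(t,x)\to0$ as $t\to0^+$, where $K(t,x)=\inf_{b\in E_1}(|x-b|_{E_0}+t|b|_{E_1})$. For a Banach space $E$, $T>0$ and $J=[0,T]$, $\dot J=(0,T]$, let $BC_{1-\mu}(J,E)$ be the space of all $v\in C(\dot J,E)$ such that $t^{1-\mu}v(t)$ is bounded on $\dot J$ and $|t^{1-\mu}v(t)|_E\to0$ as $t\to0^+$, and let $BC^1_{1-\mu}(J,E)$ be the space of all $v\in C^1(\dot J,E)$ with $v,\dot v\in BC_{1-\mu}(J,E)$. Put $\mathbb E_{0,\mu}(J)=BC_{1-\mu}(J,E_0)$ and $\mathbb E_{1,\mu}(J)=BC^1_{1-\mu}(J,E_0)\cap BC_{1-\mu}(J,E_1)$, with norm $\|v\|_{\mathbb E_{1,\mu}(J)}=\sup_{t\in\dot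 J}t^{1-\mu}(|\dot v(t)|_{E_0}+|v(t)|_{E_1})$; for $v\in\mathbb E_{1,\mu}(J)$, $v(0)$ denotes $\lim_{t\to0^+}v(t)$ in $E_0$. Let $\mathcal M_\mu(E_1,E_0)$ be the set of all bounded linear $B:E_1\to E_0$ such that for some $T>0$ and $J=[0,T]$, for every $(f,x)\in\mathbb E_{0,\mu}(J)\times E_\mu$ there is a unique $u\in\mathbb E_{1,\mu}(J)$ with $\dot u+Bu=f$ on $\dot J$ and $u(0)=x$. Let $V_\mu\subset E_\mu$ be open, and assume: (H1) $(A,F_1):V_\mu\to\mathcal M_\mu(E_1,E_0)\times E_0$ is locally Lipschitz continuous (with respect to the norm of $\mathcal L(E_1,E_0)\times E_0$). (H2) There are $\beta\in(\mu,1)$, $m\in\mathbb N$, $\beta_j\in[\mu,\beta]$ and $\rho_j\ge0$ ($j=1,\dots,m$) with $\frac{\rho_j(\beta-\mu)+(\beta_j-\mu)}{1-\mu}\le1$ for all $j$, such that $F_2:V_\mu\cap E_\beta\to E_0$ and for each $x_0\in V_\mu$ and $R>0$ there is $C_R=C_R(x_0)>0$ with $$|F_2(x_1)-F_2(x_2)|_{E_0}\le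 C_R\sum_{j=1}^m\big(1+|x_1|_{E_\beta}^{\rho_j}+|x_2|_{E_\beta}^{\rho_j}\big)|x_1-x_2|_{E_{\beta_j}}$$ for all $x_1,x_2\in\bar B_{E_\mu}(x_0,R)\cap V_\mu\cap E_\beta$. A solution on $[0,T]$ with initial value $x\in V_\mu$ is a $V_\mu$-valued function $u\in\mathbb E_{1,\mu}([0,T])$ with $\dot u+A(u)u=F_1(u)+F_2(u)$ on $(0,T]$ and $u(0)=x$. Then every $x\in V_\mu$ has a unique maximal solution $u(\cdot,x)$, on an interval $[0,t^+(x))$ with $0<t^+(x)\le\infty$: its restriction to $[0,T]$ is a solution for every $0<T<t^+(x)$, and every solution on an interval $[0,T]$ with initial value $x$ satisfies $T<t^+(x)$ and coincides with $u(\cdot,x)$ on $[0,T]$. Moreover: 1. For every $x_0\in V_\mu$ there are positive constants $\tau,\varepsilon,\sigma,c$, depending on $x_0$, such that $\bar B_{E_\mu}(x_0,\varepsilon)\subset V_\mu$, and for all $x\in\bar B_{E_\mu}(x_0,\varepsilon)$ one has $\tau<t^+(x)$ and $u(\cdot,x)\in C([0,\tau],E_\mu)$, and for all $x_1,x_2\in\bar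 B_{E_\mu}(x_0,\varepsilon)$ $$\|u(\cdot,x_1)-u(\cdot,x_2)\|_{\mathbb E_{1,\mu}([0,\tau])}\le\sigma|x_1-x_2|_{E_\mu},\qquad \|u(\cdot,x_1)-u(\cdot,x_2)\|_{C([0,\tau],E_\mu)}\le c\,|x_1-x_2|_{E_\mu}.$$ 2. The map $(t,x)\mapsto u(t,x)$ is a locally Lipschitz continuous semiflow on $V_\mu$. That is, $\mathcal D:=\bigcup_{x\in V_\mu}[0,t^+(x))\times\{x\}$ is open in $\mathbb R_+\times V_\mu$; $u:\mathcal D\to V_\mu$ is continuous; $u(0,x)=x$; for $(s,x)\in\mathcal D$ and $t\ge0$ one has $t<t^+(u(s,x))$ if and only if $s+t<t^+(x)$, and then $u(s+t,x)=u(t,u(s,x))$; and every $(t_0,x_0)\in\mathcal D$ has a product neighbourhood $U\times W\subset\mathcal D$ in $\mathbb R_+\times V_\mu$ and a constant $c>0$ with $|u(t,x)-u(t,y)|_{E_\mu}\le c|x-y|_{E_\mu}$ for all $(t,x),(t,y)\in U\times W$. -/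

import Mathlib

open Set Filter Topology

noncomputable section

namespace QuasilinearSemiflow

section Interpolation

/-! `E₁` is embedded in `E₀` by a continuous linear map `j`. -/

variable {E₀ E₁ : Type*} [NormedAddCommGroup E₀] [NormedSpace ℝ E₀]
  [NormedAddCommGroup E₁] [NormedSpace ℝ E₁]

/-- Peetre's `K`-functional of the couple `(E₀, E₁)`:
`K(t, x) = inf { |a|_{E₀} + t |b|_{E₁} : x = a + j b }`. -/
def kFunctional (j : E₁ →L[ℝ] E₀) (t : ℝ) (x : E₀) : ℝ :=
  ⨅ b : E₁, (‖x - j b‖ + t * ‖b‖)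

/-- The function `t ↦ t ^ (-θ) * K(t, x)`. -/
def kWeighted (j : E₁ →L[ℝ] E₀) (θ : ℝ) (x : E₀) (t : ℝ) : ℝ :=
  t ^ (-θ) * kFunctional j t x

/-- The norm of the real interpolation space `(E₀, E₁)_{θ,∞}`:
`|x|_{E_θ} = sup_{t > 0} t ^ (-θ) * K(t, x)`. -/
def interpNorm (j : E₁ →L[ℝ] E₀) (θ : ℝ) (x : E₀) : ℝ :=
  ⨆ t : Ioi (0 : ℝ), kWeighted j θ x t

/-- Membership in the continuous interpolation space: the norm of `(E₀, E₁)_{θ,∞}` is finite, and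
`t ^ (-θ) * K(t, x)` tends to zero as `t → 0+`. -/
def InterpMem (j : E₁ →L[ℝ] E₀) (θ : ℝ) (x : E₀) : Prop :=
  BddAbove (range fun t : Ioi (0 : ℝ) => kWeighted j θ x t) ∧
    Tendsto (kWeighted j θ x) (𝓝[>] 0) (𝓝 0)

theorem kTerm_nonneg (j : E₁ →L[ℝ] E₀) {t : ℝ} (ht : 0 ≤ t) (x : E₀) (b : E₁) :
    0 ≤ ‖x - j b‖ + t * ‖b‖ := by positivity

theorem kTerm_bddBelow (j : E₁ →L[ℝ] E₀) {t : ℝ} (ht : 0 ≤ t) (x : E₀) :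
    BddBelow (range fun b : E₁ => ‖x - j b‖ + t * ‖b‖) :=
  ⟨0, by rintro _ ⟨b, rfl⟩; exact kTerm_nonneg j ht x b⟩

theorem kFunctional_nonneg (j : E₁ →L[ℝ] E₀) {t : ℝ} (ht : 0 ≤ t) (x : E₀) :
    0 ≤ kFunctional j t x :=
  Real.iInf_nonneg fun b => kTerm_nonneg j ht x b

theorem kFunctional_le (j : E₁ →L[ℝ] E₀) {t : ℝ} (ht : 0 ≤ t) (x : E₀) (b : E₁) :
    kFunctional j t x ≤ ‖x - j b‖ + t * ‖b‖ :=
  ciInf_le (kTerm_bddBelow j ht x) b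

theorem kFunctional_add_le (j : E₁ →L[ℝ] E₀) {t : ℝ} (ht : 0 ≤ t) (x y : E₀) :
    kFunctional j t (x + y) ≤ kFunctional j t x + kFunctional j t y := by
  refine le_ciInf_add_ciInf fun a b => ?_
  refine (kFunctional_le j ht (x + y) (a + b)).trans ?_
  have h1 : ‖x + y - j (a + b)‖ ≤ ‖x - j a‖ + ‖y - j b‖ := by
    rw [map_add, add_sub_add_comm]; exact norm_add_le _ _
  have h2 : t * ‖a + b‖ ≤ t * ‖a‖ + t * ‖b‖ := by
    rw [← mul_add]; exact mul_le_mul_of_nonneg_left (norm_add_le a b) ht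
  linarith

theorem kFunctional_smul_le (j : E₁ →L[ℝ] E₀) {t : ℝ} (ht : 0 ≤ t) (c : ℝ) (x : E₀) :
    kFunctional j t (c • x) ≤ |c| * kFunctional j t x := by
  unfold kFunctional
  rw [Real.mul_iInf_of_nonneg (abs_nonneg c)]
  refine le_ciInf fun b => (kFunctional_le j ht (c • x) (c • b)).trans (le_of_eq ?_)
  rw [map_smul, ← smul_sub, norm_smul, norm_smul, Real.norm_eq_abs]
  ring

theorem kFunctional_smul (j : E₁ →L[ℝ] E₀) {t : ℝ} (ht : 0 ≤ t) (c : ℝ) (x : E₀) :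
    kFunctional j t (c • x) = |c| * kFunctional j t x := by
  refine le_antisymm (kFunctional_smul_le j ht c x) ?_
  rcases eq_or_ne c 0 with rfl | hc
  · simpa using kFunctional_nonneg j ht (0 : E₀)
  · have h := kFunctional_smul_le j ht c⁻¹ (c • x)
    rw [smul_smul, inv_mul_cancel₀ hc, one_smul, abs_inv] at h
    have hc' : 0 < |c| := abs_pos.mpr hc
    calc |c| * kFunctional j t x ≤ |c| * (|c|⁻¹ * kFunctional j t (c • x)) :=
          mul_le_mul_of_nonneg_left h hc'.le
      _ = kFunctional j t (c • x) := by field_simp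

theorem norm_le_kFunctional_one (j : E₁ →L[ℝ] E₀) (x : E₀) :
    ‖x‖ ≤ (1 + ‖j‖) * kFunctional j 1 x := by
  unfold kFunctional
  rw [Real.mul_iInf_of_nonneg (by positivity)]
  refine le_ciInf fun b => ?_
  have h1 : ‖x‖ ≤ ‖x - j b‖ + ‖j b‖ := by simpa using norm_add_le (x - j b) (j b)
  have h2 := j.le_opNorm b
  nlinarith [norm_nonneg (x - j b), norm_nonneg b, norm_nonneg j,
    mul_nonneg (norm_nonneg j) (norm_nonneg (x - j b))]

theorem kWeighted_nonneg (j : E₁ →L[ℝ] E₀) (θ : ℝ) (x : E₀) {t : ℝ} (ht : 0 < t) :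
    0 ≤ kWeighted j θ x t :=
  mul_nonneg (Real.rpow_nonneg ht.le _) (kFunctional_nonneg j ht.le x)

theorem kWeighted_add_le (j : E₁ →L[ℝ] E₀) (θ : ℝ) (x y : E₀) {t : ℝ} (ht : 0 < t) :
    kWeighted j θ (x + y) t ≤ kWeighted j θ x t + kWeighted j θ y t := by
  unfold kWeighted
  rw [← mul_add]
  exact mul_le_mul_of_nonneg_left (kFunctional_add_le j ht.le x y) (Real.rpow_nonneg ht.le _)

theorem kWeighted_smul (j : E₁ →L[ℝ] E₀) (θ : ℝ) (c : ℝ) (x : E₀) {t : ℝ} (ht : 0 < t) :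
    kWeighted j θ (c • x) t = |c| * kWeighted j θ x t := by
  unfold kWeighted
  rw [kFunctional_smul j ht.le]
  ring

theorem interpMem_add {j : E₁ →L[ℝ] E₀} {θ : ℝ} {x y : E₀}
    (hx : InterpMem j θ x) (hy : InterpMem j θ y) : InterpMem j θ (x + y) := by
  obtain ⟨⟨a, ha⟩, hx'⟩ := hx
  obtain ⟨⟨b, hb⟩, hy'⟩ := hy
  refine ⟨⟨a + b, ?_⟩, ?_⟩
  · rintro _ ⟨t, rfl⟩
    exact (kWeighted_add_le j θ x y t.2).trans (add_le_add (ha ⟨t, rfl⟩) (hb ⟨t, rfl⟩))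
  · refine squeeze_zero' ?_ ?_ (by simpa using hx'.add hy')
    · filter_upwards [self_mem_nhdsWithin] with t ht using kWeighted_nonneg j θ _ ht
    · filter_upwards [self_mem_nhdsWithin] with t ht using kWeighted_add_le j θ x y ht

theorem interpMem_smul {j : E₁ →L[ℝ] E₀} {θ : ℝ} (c : ℝ) {x : E₀}
    (hx : InterpMem j θ x) : InterpMem j θ (c • x) := by
  obtain ⟨⟨a, ha⟩, hx'⟩ := hx
  refine ⟨⟨|c| * a, ?_⟩, ?_⟩
  · rintro _ ⟨t, rfl⟩
    change kWeighted j θ (c • x) t ≤ _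
    rw [kWeighted_smul j θ c x t.2]
    exact mul_le_mul_of_nonneg_left (ha ⟨t, rfl⟩) (abs_nonneg c)
  · have h : Tendsto (fun t => |c| * kWeighted j θ x t) (𝓝[>] 0) (𝓝 0) := by
      simpa using hx'.const_mul |c|
    refine h.congr' ?_
    filter_upwards [self_mem_nhdsWithin] with t ht using (kWeighted_smul j θ c x ht).symm

/-- The vector space underlying the continuous interpolation space
`E_θ = (E₀, E₁)_{θ,∞}^0`, as a subspace of `E₀`. -/
def interpSubmodule (j : E₁ →L[ℝ] E₀) (θ : ℝ) : Submodule ℝ E₀ where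
  carrier := {x | InterpMem j θ x}
  add_mem' := fun hx hy => interpMem_add hx hy
  zero_mem' := by
    have h : ∀ t : ℝ, 0 < t → kWeighted j θ (0 : E₀) t = 0 := fun t ht => by
      simpa using kWeighted_smul j θ 0 (0 : E₀) ht
    refine ⟨⟨0, ?_⟩, ?_⟩
    · rintro _ ⟨t, rfl⟩
      exact (h t t.2).le
    · refine tendsto_const_nhds.congr' ?_
      filter_upwards [self_mem_nhdsWithin] with t ht using (h t ht).symm
  smul_mem' := fun c _ hx => interpMem_smul c hx

/-- The continuous interpolation space `E_θ = (E₀, E₁)_{θ,∞}^0`; it carries its own norm, not the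
norm of `E₀`. -/
def InterpSpace (j : E₁ →L[ℝ] E₀) (θ : ℝ) : Type _ := interpSubmodule j θ

instance (j : E₁ →L[ℝ] E₀) (θ : ℝ) : AddCommGroup (InterpSpace j θ) :=
  inferInstanceAs (AddCommGroup (interpSubmodule j θ))

instance (j : E₁ →L[ℝ] E₀) (θ : ℝ) : Module ℝ (InterpSpace j θ) :=
  inferInstanceAs (Module ℝ (interpSubmodule j θ))

/-- The inclusion of `E_θ` in `E₀`. -/
def InterpSpace.incl {j : E₁ →L[ℝ] E₀} {θ : ℝ} : InterpSpace j θ →ₗ[ℝ] E₀ :=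
  (interpSubmodule j θ).subtype

instance (j : E₁ →L[ℝ] E₀) (θ : ℝ) : Norm (InterpSpace j θ) :=
  ⟨fun x => interpNorm j θ (InterpSpace.incl x)⟩

theorem kWeighted_le_interpNorm {j : E₁ →L[ℝ] E₀} {θ : ℝ} {x : E₀} (hx : InterpMem j θ x)
    {t : ℝ} (ht : 0 < t) : kWeighted j θ x t ≤ interpNorm j θ x :=
  le_ciSup hx.1 (⟨t, ht⟩ : Ioi (0 : ℝ))

theorem interpSpace_core (j : E₁ →L[ℝ] E₀) (θ : ℝ) : NormedSpace.Core ℝ (InterpSpace j θ) where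
  norm_nonneg x := Real.iSup_nonneg fun t => kWeighted_nonneg j θ _ t.2
  norm_smul c x := by
    change interpNorm j θ (InterpSpace.incl (c • x)) = ‖c‖ * interpNorm j θ (InterpSpace.incl x)
    unfold interpNorm
    rw [Real.mul_iSup_of_nonneg (norm_nonneg c), map_smul]
    exact iSup_congr fun t => kWeighted_smul j θ c _ t.2
  norm_triangle x y := by
    change interpNorm j θ (InterpSpace.incl (x + y)) ≤ _
    have : Nonempty (Ioi (0 : ℝ)) := ⟨⟨1, mem_Ioi.mpr one_pos⟩⟩
    refine ciSup_le fun t => ?_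
    rw [map_add]
    exact (kWeighted_add_le j θ _ _ t.2).trans
      (add_le_add (kWeighted_le_interpNorm x.2 t.2) (kWeighted_le_interpNorm y.2 t.2))
  norm_eq_zero_iff x := by
    constructor
    · intro h
      have h1 : kWeighted j θ (InterpSpace.incl x) 1 ≤ 0 :=
        (kWeighted_le_interpNorm x.2 one_pos).trans h.le
      have h2 : kFunctional j 1 (InterpSpace.incl x) ≤ 0 := by simpa [kWeighted] using h1
      have h3 := norm_le_kFunctional_one j (InterpSpace.incl x)
      have h4 : ‖InterpSpace.incl x‖ ≤ 0 :=
        h3.trans (mul_nonpos_of_nonneg_of_nonpos (by positivity) h2)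
      exact Subtype.ext (norm_le_zero_iff.mp h4)
    · rintro rfl
      change interpNorm j θ (InterpSpace.incl 0) = 0
      unfold interpNorm
      have h : ∀ t : Ioi (0 : ℝ), kWeighted j θ (InterpSpace.incl (0 : InterpSpace j θ)) t = 0 :=
        fun t => by simpa using kWeighted_smul j θ 0 (0 : E₀) t.2
      simp only [h]
      exact Real.iSup_const_zero

instance (j : E₁ →L[ℝ] E₀) (θ : ℝ) : NormedAddCommGroup (InterpSpace j θ) :=
  NormedAddCommGroup.ofCore (interpSpace_core j θ)

instance (j : E₁ →L[ℝ] E₀) (θ : ℝ) : NormedSpace ℝ (InterpSpace j θ) :=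
  NormedSpace.ofCore (interpSpace_core j θ)

/-- The element of `E₁` represented by a vector of `E₀` that lies in `E₁` (unique, since the
embedding `j` is injective); the value at a vector outside `E₁` is irrelevant. -/
def toE₁ (j : E₁ →L[ℝ] E₀) : E₀ → E₁ := Function.invFun j

end Interpolation

section WeightedSpaces

/-- `v ∈ BC_{1-μ}([0,T], E)`: `v` is continuous on `(0,T]`, `t ^ (1-μ) v(t)` is bounded there, and
`|t ^ (1-μ) v(t)| → 0` as `t → 0+`. Only the values of `v` on `(0,T]` matter. -/
structure MemBC {E : Type*} [NormedAddCommGroup E] [NormedSpace ℝ E] (μ T : ℝ) (v : ℝ → E) :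
    Prop where
  continuousOn : ContinuousOn v (Ioc 0 T)
  bounded : ∃ C : ℝ, ∀ t ∈ Ioc 0 T, ‖t ^ (1 - μ) • v t‖ ≤ C
  tendsto_zero : Tendsto (fun t => ‖t ^ (1 - μ) • v t‖) (𝓝[>] 0) (𝓝 0)

/-- `v ∈ BC¹_{1-μ}([0,T], E)`: `v` is of class `C¹` on `(0,T]` (one-sided derivative at `T`), and
`v` and its derivative belong to `BC_{1-μ}([0,T], E)`. -/
structure MemBC1 {E : Type*} [NormedAddCommGroup E] [NormedSpace ℝ E] (μ T : ℝ) (v : ℝ → E) :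
    Prop where
  differentiableOn : DifferentiableOn ℝ v (Ioc 0 T)
  memBC : MemBC μ T v
  memBC_deriv : MemBC μ T (derivWithin v (Ioc 0 T))

variable {E₀ E₁ : Type*} [NormedAddCommGroup E₀] [NormedSpace ℝ E₀]
  [NormedAddCommGroup E₁] [NormedSpace ℝ E₁]

/-- `u ∈ 𝔼_{1,μ}([0,T]) = BC¹_{1-μ}([0,T], E₀) ∩ BC_{1-μ}([0,T], E₁)`, where `u 0` is the trace
`lim_{t → 0+} u(t)` in `E₀`. -/
structure MemMaxReg (j : E₁ →L[ℝ] E₀) (μ T : ℝ) (u : ℝ → E₀) : Prop where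
  mem_range : ∀ t ∈ Ioc 0 T, u t ∈ range j
  memBC1 : MemBC1 μ T u
  memBC : MemBC μ T (fun t => toE₁ j (u t))
  trace : Tendsto u (𝓝[>] 0) (𝓝 (u 0))

/-- `B ∈ 𝓜_μ(E₁, E₀)`: for some `T > 0` and `J = [0,T]`, the problem
`u' + B u = f` on `(0,T]`, `u(0) = x`, has for every `(f, x) ∈ 𝔼_{0,μ}(J) × E_μ` exactly one
solution `u ∈ 𝔼_{1,μ}(J)`. -/
def IsMaxRegOperator (j : E₁ →L[ℝ] E₀) (μ : ℝ) (B : E₁ →L[ℝ] E₀) : Prop :=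
  ∃ T : ℝ, 0 < T ∧ ∀ f : ℝ → E₀, MemBC μ T f → ∀ x : InterpSpace j μ,
    (∃ u : ℝ → E₀, MemMaxReg j μ T u ∧ u 0 = InterpSpace.incl x ∧
      ∀ t ∈ Ioc 0 T, derivWithin u (Ioc 0 T) t + B (toE₁ j (u t)) = f t) ∧
    ∀ u₁ u₂ : ℝ → E₀,
      (MemMaxReg j μ T u₁ ∧ u₁ 0 = InterpSpace.incl x ∧
        ∀ t ∈ Ioc 0 T, derivWithin u₁ (Ioc 0 T) t + B (toE₁ j (u₁ t)) = f t) →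
      (MemMaxReg j μ T u₂ ∧ u₂ 0 = InterpSpace.incl x ∧
        ∀ t ∈ Ioc 0 T, derivWithin u₂ (Ioc 0 T) t + B (toE₁ j (u₂ t)) = f t) →
      EqOn u₁ u₂ (Icc 0 T)

/-- `(A, F₁) ∈ C^{1-}(V, 𝓜_μ(E₁, E₀) × E₀)`, where `C^{1-}` means locally Lipschitz. -/
structure LipschitzHypothesis (j : E₁ →L[ℝ] E₀) (μ : ℝ) (V : Set (InterpSpace j μ))
    (A : InterpSpace j μ → E₁ →L[ℝ] E₀) (F₁ : InterpSpace j μ → E₀) : Prop where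
  maxReg : ∀ x ∈ V, IsMaxRegOperator j μ (A x)
  lipschitz : LocallyLipschitzOn V fun x => (A x, F₁ x)

/-- The structural condition on `F₂ : V ∩ E_β → E₀`; only the values of `F₂` on `V ∩ E_β`
matter. -/
def StructuralHypothesis (j : E₁ →L[ℝ] E₀) (μ : ℝ) (V : Set (InterpSpace j μ))
    (F₂ : InterpSpace j μ → E₀) : Prop :=
  ∃ β ∈ Ioo μ 1, ∃ (m : ℕ) (b ρ : Fin m → ℝ),
    (∀ i, b i ∈ Icc μ β ∧ 0 ≤ ρ i ∧ (ρ i * (β - μ) + (b i - μ)) / (1 - μ) ≤ 1) ∧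
    ∀ x₀ ∈ V, ∀ R > 0, ∃ C > 0, ∀ x₁ x₂ : InterpSpace j μ,
      x₁ ∈ Metric.closedBall x₀ R → x₁ ∈ V → InterpSpace.incl x₁ ∈ interpSubmodule j β →
      x₂ ∈ Metric.closedBall x₀ R → x₂ ∈ V → InterpSpace.incl x₂ ∈ interpSubmodule j β →
      ‖F₂ x₁ - F₂ x₂‖ ≤ C * ∑ i,
        (1 + interpNorm j β (InterpSpace.incl x₁) ^ ρ i
          + interpNorm j β (InterpSpace.incl x₂) ^ ρ i) *
        interpNorm j (b i) (InterpSpace.incl x₁ - InterpSpace.incl x₂)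

/-- `u` is a solution of `u' + A(u) u = F₁(u) + F₂(u)`, `u(0) = x`, of class `𝔼_{1,μ}([0,T])` and
with values in `V`. -/
structure IsSolutionOn (j : E₁ →L[ℝ] E₀) (μ : ℝ) (V : Set (InterpSpace j μ))
    (A : InterpSpace j μ → E₁ →L[ℝ] E₀) (F₁ F₂ : InterpSpace j μ → E₀)
    (T : ℝ) (x : InterpSpace j μ) (u : ℝ → InterpSpace j μ) : Prop where
  init : u 0 = x
  mem : ∀ t ∈ Icc 0 T, u t ∈ V
  memMaxReg : MemMaxReg j μ T (fun t => InterpSpace.incl (u t))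
  eqn : ∀ t ∈ Ioc 0 T,
    derivWithin (fun s => InterpSpace.incl (u s)) (Ioc 0 T) t
      + A (u t) (toE₁ j (InterpSpace.incl (u t))) = F₁ (u t) + F₂ (u t)

/-- `[0, tp x)` is the maximal interval of existence of the solution with initial value `x ∈ V`,
and `u · x` is that maximal solution: it solves the problem on each `[0,T]` with `T < tp x`, and
each solution on an interval `[0,T]` has `T < tp x` and coincides with `u · x` on `[0,T]`. These
properties determine `tp` on `V` and `u` on the set of all `(t, x)` with `0 ≤ t < tp x`. -/
def IsMaximalSolutionMap (j : E₁ →L[ℝ] E₀) (μ : ℝ) (V : Set (InterpSpace j μ))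
    (A : InterpSpace j μ → E₁ →L[ℝ] E₀) (F₁ F₂ : InterpSpace j μ → E₀)
    (tp : InterpSpace j μ → EReal) (u : ℝ → InterpSpace j μ → InterpSpace j μ) : Prop :=
  ∀ x ∈ V, 0 < tp x ∧
    (∀ T : ℝ, 0 < T → (T : EReal) < tp x →
      IsSolutionOn j μ V A F₁ F₂ T x (fun t => u t x)) ∧
    ∀ T : ℝ, 0 < T → ∀ w : ℝ → InterpSpace j μ, IsSolutionOn j μ V A F₁ F₂ T x w →
      (T : EReal) < tp x ∧ EqOn w (fun t => u t x) (Icc 0 T)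

end WeightedSpaces

section Semiflows

variable {X : Type*} [NormedAddCommGroup X]

/-- The domain `𝓓 = ⋃_{x ∈ V} [0, tp x) × {x}` of a semiflow on `V`. -/
def flowDomain (V : Set X) (tp : X → EReal) : Set (ℝ × X) :=
  {p | p.2 ∈ V ∧ 0 ≤ p.1 ∧ (p.1 : EReal) < tp p.2}

/-- `φ` is a (local) semiflow on `V` with lifespans `tp`, and it is locally Lipschitz continuous:
`𝓓` is open in `ℝ₊ × V`, `φ` is continuous on `𝓓` with values in `V`, it satisfies the semiflow
identities, and each point of `𝓓` has a product neighbourhood in `ℝ₊ × V`, contained in `𝓓`, on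
which `φ(t, ·)` is Lipschitz with a constant that does not depend on `t`. -/
structure IsLocallyLipschitzSemiflow (V : Set X) (tp : X → EReal) (φ : ℝ → X → X) : Prop where
  lifespan_pos : ∀ x ∈ V, 0 < tp x
  isOpen_domain : ∃ O : Set (ℝ × X), IsOpen O ∧ flowDomain V tp = O ∩ Ici 0 ×ˢ V
  mapsTo : ∀ (t : ℝ) (x : X), (t, x) ∈ flowDomain V tp → φ t x ∈ V
  continuousOn : ContinuousOn (fun p : ℝ × X => φ p.1 p.2) (flowDomain V tp)
  map_zero : ∀ x ∈ V, φ 0 x = x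
  lifespan_shift : ∀ (s t : ℝ) (x : X), (s, x) ∈ flowDomain V tp → 0 ≤ t →
    ((t : EReal) < tp (φ s x) ↔ ((s + t : ℝ) : EReal) < tp x)
  map_add : ∀ (s t : ℝ) (x : X), (s, x) ∈ flowDomain V tp → (t, φ s x) ∈ flowDomain V tp →
    φ (s + t) x = φ t (φ s x)
  lipschitz : ∀ (t₀ : ℝ) (x₀ : X), (t₀, x₀) ∈ flowDomain V tp →
    ∃ U ∈ 𝓝[Ici 0] t₀, ∃ W ∈ 𝓝[V] x₀, U ×ˢ W ⊆ flowDomain V tp ∧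
      ∃ c > 0, ∀ t ∈ U, ∀ x ∈ W, ∀ y ∈ W, ‖φ t x - φ t y‖ ≤ c * ‖x - y‖

end Semiflows

end QuasilinearSemiflow

end

open QuasilinearSemiflow

/-!
Near `x₀` the operator is frozen at `A(x₀)`. Maximal regularity makes the solution operator of
`v' + A(x₀) v = f`, `v(0) = x`, bounded, and by the structural condition the perturbation
`v ↦ (A(x₀) - A(v)) v + F₁(v) + F₂(v)` has an arbitrarily small Lipschitz constant on functions
that are small in the weighted norm and stay near `x₀`, once the time interval is short.
The contraction principle then yields solutions that depend Lipschitz continuously on the initial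
value, with an existence time that is uniform near `x₀`. Gluing gives maximal solutions, and along
a compact piece of an orbit finitely many of these uniform steps compose, which gives the Lipschitz
semiflow.
-/

open scoped Interval

noncomputable section

namespace QuasilinearSemiflow

section Interpolation

variable {E₀ E₁ : Type*} [NormedAddCommGroup E₀] [NormedSpace ℝ E₀]
  [NormedAddCommGroup E₁] [NormedSpace ℝ E₁] {j : E₁ →L[ℝ] E₀} {θ μ : ℝ}

theorem tendsto_rpow_nhdsGT_zero {a : ℝ} (ha : 0 < a) :
    Tendsto (fun t : ℝ => t ^ a) (𝓝[>] 0) (𝓝 0) := by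
  have h := (Real.continuous_rpow_const ha.le).tendsto 0
  rw [Real.zero_rpow ha.ne'] at h
  exact h.mono_left nhdsWithin_le_nhds

theorem kFunctional_apply_le (j : E₁ →L[ℝ] E₀) {t : ℝ} (ht : 0 ≤ t) (b : E₁) :
    kFunctional j t (j b) ≤ t * ‖b‖ := by
  simpa using kFunctional_le j ht (j b) b

theorem kFunctional_le_norm (j : E₁ →L[ℝ] E₀) {t : ℝ} (ht : 0 ≤ t) (x : E₀) :
    kFunctional j t x ≤ ‖x‖ := by
  simpa using kFunctional_le j ht x 0

theorem lipschitzWith_kFunctional (j : E₁ →L[ℝ] E₀) {t : ℝ} (ht : 0 ≤ t) :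
    LipschitzWith 1 (kFunctional j t) :=
  LipschitzWith.of_le_add fun x y => by
    calc kFunctional j t x = kFunctional j t (y + (x - y)) := by rw [add_sub_cancel]
      _ ≤ kFunctional j t y + kFunctional j t (x - y) := kFunctional_add_le j ht _ _
      _ ≤ kFunctional j t y + dist x y := by
        rw [dist_eq_norm]
        gcongr
        exact kFunctional_le_norm j ht _

theorem kWeighted_le_iff {x : E₀} {t C : ℝ} (ht : 0 < t) :
    kWeighted j θ x t ≤ C ↔ kFunctional j t x ≤ t ^ θ * C := by
  rw [kWeighted, Real.rpow_neg ht.le, inv_mul_le_iff₀ (Real.rpow_pos_of_pos ht θ)]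

theorem interpNorm_nonneg (j : E₁ →L[ℝ] E₀) (θ : ℝ) (x : E₀) : 0 ≤ interpNorm j θ x :=
  Real.iSup_nonneg fun t => kWeighted_nonneg j θ x t.2

theorem interpNorm_le {x : E₀} {C : ℝ}
    (h : ∀ s, 0 < s → kFunctional j s x ≤ s ^ θ * C) : interpNorm j θ x ≤ C :=
  have := nonempty_Ioi_subtype (a := (0 : ℝ))
  ciSup_le fun s => (kWeighted_le_iff s.2).2 (h s s.2)

theorem InterpSpace.norm_def (x : InterpSpace j θ) :
    ‖x‖ = interpNorm j θ (InterpSpace.incl x) := rfl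

theorem InterpSpace.incl_injective :
    Function.Injective (InterpSpace.incl : InterpSpace j θ →ₗ[ℝ] E₀) :=
  Subtype.val_injective

theorem InterpSpace.exists_incl_eq {x : E₀} (hx : InterpMem j θ x) :
    ∃ z : InterpSpace j θ, InterpSpace.incl z = x :=
  ⟨(⟨x, hx⟩ : interpSubmodule j θ), rfl⟩

theorem kFunctional_incl_le (x : InterpSpace j θ) {t : ℝ} (ht : 0 < t) :
    kFunctional j t (InterpSpace.incl x) ≤ t ^ θ * ‖x‖ :=
  (kWeighted_le_iff ht).1 (kWeighted_le_interpNorm x.2 ht)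

theorem InterpSpace.norm_incl_le (x : InterpSpace j θ) :
    ‖InterpSpace.incl x‖ ≤ (1 + ‖j‖) * ‖x‖ :=
  (norm_le_kFunctional_one j _).trans <| by
    gcongr
    simpa using kFunctional_incl_le x one_pos

/-- The inclusion of `E_θ` in `E₀` as a continuous linear map. -/
def InterpSpace.inclL (j : E₁ →L[ℝ] E₀) (θ : ℝ) : InterpSpace j θ →L[ℝ] E₀ :=
  LinearMap.mkContinuous InterpSpace.incl (1 + ‖j‖) InterpSpace.norm_incl_le

section Completeness

theorem kWeighted_le_add_of_sub {x y : E₀} {s ε : ℝ} (hs : 0 < s)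
    (h : kFunctional j s (y - x) ≤ s ^ θ * ε) :
    kWeighted j θ y s ≤ kWeighted j θ x s + ε := by
  calc kWeighted j θ y s = kWeighted j θ (x + (y - x)) s := by rw [add_sub_cancel]
    _ ≤ kWeighted j θ x s + kWeighted j θ (y - x) s := kWeighted_add_le j θ _ _ hs
    _ ≤ kWeighted j θ x s + ε := by
      gcongr
      exact (kWeighted_le_iff hs).2 h

theorem interpMem_of_forall_exists_kFunctional_sub_le {y : E₀}
    (h : ∀ ε > 0, ∃ x : InterpSpace j θ, ∀ s, 0 < s →
      kFunctional j s (y - InterpSpace.incl x) ≤ s ^ θ * ε) :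
    InterpMem j θ y := by
  constructor
  · obtain ⟨x, hx⟩ := h 1 one_pos
    refine ⟨‖x‖ + 1, ?_⟩
    rintro _ ⟨⟨s, hs⟩, rfl⟩
    exact (kWeighted_le_add_of_sub hs (hx s hs)).trans
      (add_le_add_left (kWeighted_le_interpNorm x.2 hs) 1)
  · refine Metric.tendsto_nhds.2 fun ε hε => ?_
    obtain ⟨x, hx⟩ := h (ε / 2) (half_pos hε)
    have hx0 : ∀ᶠ s in 𝓝[>] (0 : ℝ), kWeighted j θ (InterpSpace.incl x) s < ε / 2 :=
      x.2.2.eventually (gt_mem_nhds (half_pos hε))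
    filter_upwards [hx0, self_mem_nhdsWithin] with s hx0 hs
    rw [Real.dist_0_eq_abs, abs_of_nonneg (kWeighted_nonneg j θ _ hs)]
    linarith [kWeighted_le_add_of_sub hs (hx s hs)]

instance [CompleteSpace E₀] : CompleteSpace (InterpSpace j θ) := by
  refine Metric.complete_of_cauchySeq_tendsto fun x hx => ?_
  obtain ⟨y, hy⟩ := cauchySeq_tendsto_of_complete
    ((InterpSpace.inclL j θ).uniformContinuous.comp_cauchySeq hx)
  have unif_approx : ∀ ε > 0, ∃ N, ∀ n ≥ N, ∀ s, 0 < s →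
      kFunctional j s (y - InterpSpace.incl (x n)) ≤ s ^ θ * ε := fun ε hε => by
    obtain ⟨N, hN⟩ := Metric.cauchySeq_iff.mp hx ε hε
    refine ⟨N, fun n hn s hs => le_of_tendsto
      (((lipschitzWith_kFunctional j hs.le).continuous.tendsto _).comp
        (hy.sub tendsto_const_nhds)) ?_⟩
    filter_upwards [eventually_ge_atTop N] with m hm
    calc kFunctional j s (InterpSpace.incl (x m) - InterpSpace.incl (x n))
        ≤ s ^ θ * ‖x m - x n‖ := by
          rw [← map_sub]
          exact kFunctional_incl_le _ hs
      _ ≤ s ^ θ * ε := by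
        gcongr
        rw [← dist_eq_norm]
        exact (hN m hm n hn).le
  obtain ⟨z, rfl⟩ := InterpSpace.exists_incl_eq <|
    interpMem_of_forall_exists_kFunctional_sub_le fun ε hε =>
      (unif_approx ε hε).imp' x fun N hN => hN N le_rfl
  refine ⟨z, Metric.tendsto_atTop.mpr fun ε hε => ?_⟩
  obtain ⟨N, hN⟩ := unif_approx (ε / 2) (half_pos hε)
  refine ⟨N, fun n hn => ?_⟩
  rw [dist_eq_norm', InterpSpace.norm_def, map_sub]
  exact (interpNorm_le (hN n hn)).trans_lt (half_lt_self hε)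

end Completeness

section Embedding

theorem kFunctional_apply_le_rpow (hθ : θ ∈ Ioo (0 : ℝ) 1) {s : ℝ} (hs : 0 < s) (b : E₁) :
    kFunctional j s (j b) ≤ s ^ θ * ((1 + ‖j‖) * ‖b‖) := by
  rcases le_total s 1 with h1 | h1
  · calc kFunctional j s (j b) ≤ s * ‖b‖ := kFunctional_apply_le j hs.le b
      _ ≤ s ^ θ * ((1 + ‖j‖) * ‖b‖) := by
        gcongr
        · simpa using Real.rpow_le_rpow_of_exponent_ge hs h1 hθ.2.le
        · exact le_mul_of_one_le_left (norm_nonneg b) (by simp)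
  · calc kFunctional j s (j b) ≤ ‖j b‖ := kFunctional_le_norm j hs.le _
      _ ≤ ‖j‖ * ‖b‖ := j.le_opNorm b
      _ ≤ (1 + ‖j‖) * ‖b‖ := by gcongr; simp
      _ ≤ s ^ θ * ((1 + ‖j‖) * ‖b‖) :=
        le_mul_of_one_le_left (by positivity) (Real.one_le_rpow h1 hθ.1.le)

theorem interpMem_apply (hθ : θ ∈ Ioo (0 : ℝ) 1) (b : E₁) : InterpMem j θ (j b) := by
  constructor
  · refine ⟨(1 + ‖j‖) * ‖b‖, ?_⟩
    rintro _ ⟨s, rfl⟩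
    exact (kWeighted_le_iff s.2).2 (kFunctional_apply_le_rpow hθ s.2 b)
  · have hlim : Tendsto (fun s : ℝ => s ^ (1 - θ) * ‖b‖) (𝓝[>] 0) (𝓝 0) := by
      simpa using (tendsto_rpow_nhdsGT_zero (sub_pos.2 hθ.2)).mul_const ‖b‖
    refine squeeze_zero' ?_ ?_ hlim <;>
      filter_upwards [self_mem_nhdsWithin] with s (hs : 0 < s)
    · exact kWeighted_nonneg j θ _ hs
    · rw [kWeighted_le_iff hs, ← mul_assoc, ← Real.rpow_add hs]
      simpa using kFunctional_apply_le j hs.le b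

/-- The embedding of `E₁` in `E_θ` for `0 < θ < 1`. -/
def embed (j : E₁ →L[ℝ] E₀) (hθ : θ ∈ Ioo (0 : ℝ) 1) : E₁ →L[ℝ] InterpSpace j θ :=
  LinearMap.mkContinuous
    { toFun := fun b => (⟨j b, interpMem_apply hθ b⟩ : interpSubmodule j θ)
      map_add' := fun a b => Subtype.ext (map_add j a b)
      map_smul' := fun c b => Subtype.ext (map_smul j c b) } (1 + ‖j‖)
    fun b => interpNorm_le fun _ hs => kFunctional_apply_le_rpow hθ hs b

@[simp] theorem incl_embed (hθ : θ ∈ Ioo (0 : ℝ) 1) (b : E₁) :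
    InterpSpace.incl (embed j hθ b) = j b := rfl

theorem toE₁_apply (hj : Function.Injective j) (b : E₁) : toE₁ j (j b) = b :=
  Function.leftInverse_invFun hj b

theorem apply_toE₁ {x : E₀} (hx : x ∈ range j) : j (toE₁ j x) = x :=
  Function.invFun_eq hx

theorem interpNorm_apply_le (hμ : μ ∈ Ioo (0 : ℝ) 1) (hθ : θ ∈ Ico μ 1) (a : E₁) {t : ℝ}
    (ht : 0 < t) :
    interpNorm j θ (j a) ≤ t ^ (μ - θ) * (t ^ (1 - μ) * ‖a‖ + ‖embed j hμ a‖) := by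
  refine interpNorm_le fun s hs => ?_
  rcases le_total s t with hst | hst
  · have h1 : s ^ (1 - θ) ≤ t ^ (1 - θ) :=
      Real.rpow_le_rpow hs.le hst (sub_nonneg.2 hθ.2.le)
    calc kFunctional j s (j a) ≤ s * ‖a‖ := kFunctional_apply_le j hs.le a
      _ = s ^ θ * (s ^ (1 - θ) * ‖a‖) := by
        rw [← mul_assoc, ← Real.rpow_add hs, add_sub_cancel, Real.rpow_one]
      _ ≤ s ^ θ * (t ^ (1 - θ) * ‖a‖) := by gcongr
      _ = s ^ θ * (t ^ (μ - θ) * (t ^ (1 - μ) * ‖a‖)) := by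
        rw [← mul_assoc (t ^ (μ - θ)), ← Real.rpow_add ht, add_comm, sub_add_sub_cancel]
      _ ≤ s ^ θ * (t ^ (μ - θ) * (t ^ (1 - μ) * ‖a‖ + ‖embed j hμ a‖)) := by
        gcongr
        exact le_add_of_nonneg_right (norm_nonneg _)
  · have h1 : s ^ (μ - θ) ≤ t ^ (μ - θ) :=
      Real.rpow_le_rpow_of_nonpos ht hst (sub_nonpos.2 hθ.1)
    calc kFunctional j s (j a) ≤ s ^ μ * ‖embed j hμ a‖ :=
          kFunctional_incl_le (embed j hμ a) hs
      _ = s ^ θ * (s ^ (μ - θ) * ‖embed j hμ a‖) := by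
        rw [← mul_assoc, ← Real.rpow_add hs, add_sub_cancel]
      _ ≤ s ^ θ * (t ^ (μ - θ) * ‖embed j hμ a‖) := by gcongr
      _ ≤ s ^ θ * (t ^ (μ - θ) * (t ^ (1 - μ) * ‖a‖ + ‖embed j hμ a‖)) := by
        gcongr
        exact le_add_of_nonneg_left (by positivity)

theorem eventually_rpow_mul_interpNorm_apply_le (hμ : μ ∈ Ioo (0 : ℝ) 1) (hθ : θ ∈ Ioo μ 1)
    (R : ℝ) {κ : ℝ} (hκ : 0 < κ) :
    ∀ᶠ r in 𝓝[>] (0 : ℝ), ∀ t, 0 < t → ∀ a : E₁, ‖embed j hμ a‖ ≤ R → t ^ (1 - μ) * ‖a‖ ≤ r →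
      t ^ (θ - μ) * interpNorm j θ (j a) ≤ κ := by
  -- Evaluate the interpolation inequality at `Λ t`, where `Λ` is large and then `r` small.
  have hlim : Tendsto (fun Λ : ℝ => Λ ^ (-(θ - μ)) * (1 + R)) atTop (𝓝 0) := by
    simpa using (tendsto_rpow_neg_atTop (sub_pos.2 hθ.1)).mul_const (1 + R)
  obtain ⟨Λ, hΛκ, hΛ⟩ := ((hlim.eventually (gt_mem_nhds hκ)).and (eventually_gt_atTop 0)).exists
  have hr : ∀ᶠ r in 𝓝[>] (0 : ℝ), Λ ^ (1 - μ) * r ≤ 1 :=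
    ((Continuous.tendsto' (by fun_prop) 0 0 (mul_zero _)).mono_left
      nhdsWithin_le_nhds).eventually (Iic_mem_nhds one_pos)
  filter_upwards [hr] with r hr t ht a haR har
  have hΛt := interpNorm_apply_le (j := j) hμ ⟨hθ.1.le, hθ.2⟩ a (mul_pos hΛ ht)
  rw [Real.mul_rpow hΛ.le ht.le, Real.mul_rpow hΛ.le ht.le] at hΛt
  have cancel : t ^ (θ - μ) * (Λ ^ (μ - θ) * t ^ (μ - θ)) = Λ ^ (-(θ - μ)) := by
    rw [mul_left_comm, ← Real.rpow_add ht]; simp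
  calc t ^ (θ - μ) * interpNorm j θ (j a)
      ≤ t ^ (θ - μ) * (Λ ^ (μ - θ) * t ^ (μ - θ)
          * (Λ ^ (1 - μ) * t ^ (1 - μ) * ‖a‖ + ‖embed j hμ a‖)) := by gcongr
    _ = Λ ^ (-(θ - μ)) * (Λ ^ (1 - μ) * (t ^ (1 - μ) * ‖a‖) + ‖embed j hμ a‖) := by
      rw [← mul_assoc, cancel, mul_assoc (Λ ^ (1 - μ))]
    _ ≤ Λ ^ (-(θ - μ)) * (1 + R) := by
      gcongr
      exact (mul_le_mul_of_nonneg_left har (by positivity)).trans hr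
    _ ≤ κ := hΛκ.le

end Embedding

end Interpolation

section Integration

open MeasureTheory

variable {E : Type*} [NormedAddCommGroup E] [NormedSpace ℝ E] {a b t : ℝ}

theorem eventually_forall_mem_Ioc {p : ℝ → Prop} (h : ∀ᶠ t in 𝓝[>] a, p t) :
    ∀ᶠ t in 𝓝[>] a, ∀ s ∈ Ioc a t, p s := by
  obtain ⟨δ, hδ, hp⟩ := mem_nhdsGT_iff_exists_Ioc_subset.1 h
  filter_upwards [Ioc_mem_nhdsGT hδ] with t ht s hs using hp ⟨hs.1, hs.2.trans ht.2⟩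

theorem integral_congr_Ioc {f g : ℝ → E} (hab : a ≤ b) (h : EqOn f g (Ioc a b)) :
    ∫ s in a..b, f s = ∫ s in a..b, g s :=
  intervalIntegral.integral_congr_Ioo_of_le hab (h.mono Ioo_subset_Ioc_self)

variable [CompleteSpace E]

theorem hasDerivWithinAt_integral_Ioc {f : ℝ → E} (hf : ContinuousOn f (Ioc a b))
    (hint : IntervalIntegrable f volume a b) (ht : t ∈ Ioc a b) :
    HasDerivWithinAt (fun t => ∫ s in a..t, f s) (f t) (Ioc a b) t := by
  have hmem : Ioc a b ∈ 𝓝[Icc a b] t := by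
    filter_upwards [self_mem_nhdsWithin, mem_nhdsWithin_of_mem_nhds (Ioi_mem_nhds ht.1)]
      with s hs has using ⟨has, hs.2⟩
  have : Fact (t ∈ Icc a b) := ⟨Ioc_subset_Icc_self ht⟩
  have hint' : IntervalIntegrable f volume a t :=
    hint.mono_set (uIcc_subset_uIcc_left (Icc_subset_uIcc this.out))
  have hmeas : StronglyMeasurableAtFilter f (𝓝[Icc a b] t) :=
    ⟨Ioc a b, hmem, hf.aestronglyMeasurable measurableSet_Ioc⟩
  exact (intervalIntegral.integral_hasDerivWithinAt_right hint' hmeas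
    ((hf t ht).mono_of_mem_nhdsWithin hmem)).mono Ioc_subset_Icc_self

theorem eq_add_integral_of_hasDerivWithinAt {u g : ℝ → E} {c : E}
    (hg : IntervalIntegrable g volume a b)
    (hu : ∀ t ∈ Ioc a b, HasDerivWithinAt u (g t) (Ioc a b) t)
    (hc : Tendsto u (𝓝[>] a) (𝓝 c)) (ht : t ∈ Ioc a b) :
    u t = c + ∫ s in a..t, g s := by
  have hmem : ∀ s ∈ Ioo a t, s ∈ Ioc a b := fun s hs => ⟨hs.1, hs.2.le.trans ht.2⟩
  have hut : Tendsto u (𝓝[<] t) (𝓝 (u t)) := by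
    have h := (hu t ht).continuousWithinAt.mono hmem
    rwa [ContinuousWithinAt, nhdsWithin_Ioo_eq_nhdsLT ht.1] at h
  have hderiv : ∀ s ∈ Ioo a t, HasDerivAt u (g s) s := fun s hs =>
    (hu s (hmem s hs)).hasDerivAt (mem_of_superset (Ioo_mem_nhds hs.1 hs.2) hmem)
  rw [intervalIntegral.integral_eq_sub_of_hasDerivAt_of_tendsto ht.1 hderiv
    (hg.mono_set (uIcc_subset_uIcc_left (Icc_subset_uIcc (Ioc_subset_Icc_self ht)))) hc hut,
    add_sub_cancel]

end Integration

section WeightedSpaces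

open MeasureTheory

variable {E F : Type*} [NormedAddCommGroup E] [NormedSpace ℝ E]
  [NormedAddCommGroup F] [NormedSpace ℝ F] {μ T : ℝ} {f g : ℝ → E}

theorem rpow_weight_mul_inv {t : ℝ} (ht : 0 < t) : t ^ (1 - μ) * t ^ (μ - 1) = 1 := by
  rw [← Real.rpow_add ht]; simp

theorem inv_weight_smul_weight_smul {t : ℝ} (ht : 0 < t) (x : E) :
    t ^ (μ - 1) • t ^ (1 - μ) • x = x := by
  rw [smul_smul, mul_comm, rpow_weight_mul_inv ht, one_smul]

theorem zero_rpow_weight (hμ : μ < 1) : (0 : ℝ) ^ (1 - μ) = 0 :=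
  Real.zero_rpow (sub_pos.2 hμ).ne'

theorem continuous_weight (hμ : μ < 1) : Continuous fun t : ℝ => t ^ (1 - μ) :=
  Real.continuous_rpow_const (sub_pos.2 hμ).le

theorem norm_weight_smul {t : ℝ} (ht : 0 ≤ t) (x : E) :
    ‖t ^ (1 - μ) • x‖ = t ^ (1 - μ) * ‖x‖ := by
  rw [norm_smul, Real.norm_of_nonneg (Real.rpow_nonneg ht _)]

theorem norm_le_of_weighted {E : Type*} [NormedAddCommGroup E] {t C : ℝ} (ht : 0 < t) {x : E}
    (h : t ^ (1 - μ) * ‖x‖ ≤ C) :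
    ‖x‖ ≤ C * t ^ (μ - 1) := by
  calc ‖x‖ = t ^ (1 - μ) * ‖x‖ * t ^ (μ - 1) := by
        rw [mul_right_comm, rpow_weight_mul_inv ht, one_mul]
    _ ≤ C * t ^ (μ - 1) := by gcongr

theorem continuousOn_weight_smul (hμ : μ < 1) (hf : ContinuousOn f (Ioc 0 T))
    (h0 : Tendsto (fun t => t ^ (1 - μ) * ‖f t‖) (𝓝[>] 0) (𝓝 0)) :
    ContinuousOn (fun t => t ^ (1 - μ) • f t) (Icc 0 T) := by
  have hlim : Tendsto (fun t => t ^ (1 - μ) • f t) (𝓝[>] 0) (𝓝 0) := by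
    refine tendsto_zero_iff_norm_tendsto_zero.2 (h0.congr' ?_)
    filter_upwards [self_mem_nhdsWithin] with t ht using (norm_weight_smul (le_of_lt ht) _).symm
  intro t ht
  rcases ht.1.eq_or_lt with rfl | htpos
  · have h : ContinuousWithinAt (fun t => t ^ (1 - μ) • f t) (Ioi 0) 0 := by
      simpa [ContinuousWithinAt, zero_rpow_weight hμ] using hlim
    exact (continuousWithinAt_insert_self.2 h).mono fun s hs => hs.1.eq_or_lt.imp Eq.symm id
  · have h : ContinuousWithinAt (fun t => t ^ (1 - μ) • f t) (Ioc 0 T) t :=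
      (continuous_weight hμ).continuousWithinAt.smul (hf t ⟨htpos, ht.2⟩)
    refine h.mono_of_mem_nhdsWithin ?_
    filter_upwards [self_mem_nhdsWithin, mem_nhdsWithin_of_mem_nhds (Ioi_mem_nhds htpos)]
      with s hs hspos using ⟨hspos, hs.2⟩

theorem MemBC.tendsto_weight_mul_norm (hf : MemBC μ T f) :
    Tendsto (fun t => t ^ (1 - μ) * ‖f t‖) (𝓝[>] 0) (𝓝 0) := by
  refine hf.tendsto_zero.congr' ?_
  filter_upwards [self_mem_nhdsWithin] with t ht using norm_weight_smul (le_of_lt ht) _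

theorem memBC_iff (hμ : μ < 1) (hT : 0 < T) :
    MemBC μ T f ↔ ContinuousOn (fun t => t ^ (1 - μ) • f t) (Icc 0 T) := by
  refine ⟨fun h => continuousOn_weight_smul hμ h.continuousOn h.tendsto_weight_mul_norm,
    fun h => ⟨?_, ?_, ?_⟩⟩
  · have h1 : ContinuousOn (fun t : ℝ => t ^ (μ - 1) • t ^ (1 - μ) • f t) (Ioc 0 T) :=
      (continuousOn_id.rpow_const fun t ht => Or.inl ht.1.ne').smul (h.mono Ioc_subset_Icc_self)
    exact h1.congr fun t ht => (inv_weight_smul_weight_smul ht.1 _).symm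
  · obtain ⟨C, hC⟩ := isCompact_Icc.exists_bound_of_continuousOn h
    exact ⟨C, fun t ht => hC t (Ioc_subset_Icc_self ht)⟩
  · have h0 : ContinuousWithinAt (fun t => t ^ (1 - μ) • f t) (Ioc 0 T) 0 :=
      (h 0 (left_mem_Icc.2 hT.le)).mono Ioc_subset_Icc_self
    rw [ContinuousWithinAt, nhdsWithin_Ioc_eq_nhdsGT hT, zero_rpow_weight hμ, zero_smul] at h0
    exact tendsto_zero_iff_norm_tendsto_zero.1 h0

theorem memBC_of_tendsto (hμ : μ < 1) (hT : 0 < T) (hf : ContinuousOn f (Ioc 0 T))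
    (h0 : Tendsto (fun t => t ^ (1 - μ) * ‖f t‖) (𝓝[>] 0) (𝓝 0)) : MemBC μ T f :=
  (memBC_iff hμ hT).2 (continuousOn_weight_smul hμ hf h0)

theorem memBC_of_continuousOn (hμ : μ < 1) (hT : 0 < T) (hf : ContinuousOn f (Icc 0 T)) :
    MemBC μ T f :=
  (memBC_iff hμ hT).2 ((continuous_weight hμ).continuousOn.smul hf)

theorem memBC_zero : MemBC μ T fun _ : ℝ => (0 : E) :=
  ⟨continuousOn_const, ⟨0, by simp⟩, by simp⟩

theorem MemBC.add (hμ : μ < 1) (hT : 0 < T) (hf : MemBC μ T f) (hg : MemBC μ T g) :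
    MemBC μ T fun t => f t + g t := by
  rw [memBC_iff hμ hT] at *
  simpa only [smul_add] using hf.fun_add hg

theorem MemBC.sub (hμ : μ < 1) (hT : 0 < T) (hf : MemBC μ T f) (hg : MemBC μ T g) :
    MemBC μ T fun t => f t - g t := by
  rw [memBC_iff hμ hT] at *
  simpa only [smul_sub] using hf.fun_sub hg

theorem MemBC.clm (hμ : μ < 1) (hT : 0 < T) (B : E →L[ℝ] F) (hf : MemBC μ T f) :
    MemBC μ T fun t => B (f t) := by
  rw [memBC_iff hμ hT] at *
  exact (B.continuous.comp_continuousOn hf).congr fun _ _ => (map_smul B _ _).symm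

theorem MemBC.mono {S : ℝ} (hST : S ≤ T) (hf : MemBC μ T f) : MemBC μ S f :=
  ⟨hf.continuousOn.mono (Ioc_subset_Ioc_right hST),
    hf.bounded.imp fun _ h t ht => h t (Ioc_subset_Ioc_right hST ht), hf.tendsto_zero⟩

theorem MemBC.congr (hμ : μ < 1) (hT : 0 < T) (hf : MemBC μ T f) (h : EqOn g f (Ioc 0 T)) :
    MemBC μ T g := by
  rw [memBC_iff hμ hT] at *
  refine hf.congr fun t ht => ?_
  rcases ht.1.eq_or_lt with rfl | htpos
  · simp only [zero_rpow_weight hμ, zero_smul]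
  · simp only [h ⟨htpos, ht.2⟩]

theorem MemBC.shift (hμ : μ < 1) {a : ℝ} (ha : a ∈ Ioo 0 T) (hf : MemBC μ T f) :
    MemBC μ (T - a) fun t => f (a + t) :=
  memBC_of_continuousOn hμ (sub_pos.2 ha.2) <|
    hf.continuousOn.comp (continuous_const.add continuous_id).continuousOn fun _ ht =>
      ⟨add_pos_of_pos_of_nonneg ha.1 ht.1, le_sub_iff_add_le'.1 ht.2⟩

theorem MemBC.exists_bound (hf : MemBC μ T f) :
    ∃ C, ∀ t ∈ Ioc 0 T, t ^ (1 - μ) * ‖f t‖ ≤ C :=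
  hf.bounded.imp fun _ h t ht => (norm_weight_smul ht.1.le (f t)).symm.trans_le (h t ht)

theorem MemBC.eventually_forall_le (hf : MemBC μ T f) {ε : ℝ} (hε : 0 < ε) :
    ∀ᶠ t in 𝓝[>] (0 : ℝ), ∀ s ∈ Ioc 0 t, s ^ (1 - μ) * ‖f s‖ ≤ ε :=
  eventually_forall_mem_Ioc (hf.tendsto_weight_mul_norm.eventually (Iic_mem_nhds hε))

theorem intervalIntegrable_const_mul_rpow (hμ : 0 < μ) (C a b : ℝ) :
    IntervalIntegrable (fun t : ℝ => C * t ^ (μ - 1)) volume a b :=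
  (intervalIntegral.intervalIntegrable_rpow' (by linarith)).const_mul C

theorem MemBC.intervalIntegrable (hμ : 0 < μ) (hf : MemBC μ T f) {a b : ℝ}
    (ha : a ∈ Icc 0 T) (hb : b ∈ Icc 0 T) : IntervalIntegrable f volume a b := by
  obtain ⟨C, hC⟩ := hf.exists_bound
  have hsub : Ι a b ⊆ Ioc 0 T := Ioc_subset_Ioc (le_min ha.1 hb.1) (max_le ha.2 hb.2)
  refine (intervalIntegrable_const_mul_rpow hμ C a b).mono_fun'
    ((hf.continuousOn.mono hsub).aestronglyMeasurable measurableSet_uIoc) ?_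
  filter_upwards [ae_restrict_mem measurableSet_uIoc] with t ht
    using norm_le_of_weighted (hsub ht).1 (hC t (hsub ht))

theorem MemBC.intervalIntegrable_zero (hμ : 0 < μ) (hf : MemBC μ T f) {t : ℝ}
    (ht : t ∈ Icc 0 T) : IntervalIntegrable f volume 0 t :=
  hf.intervalIntegrable hμ (left_mem_Icc.2 (ht.1.trans ht.2)) ht

theorem norm_integral_le_of_weighted (hμ : 0 < μ) {t C : ℝ} (ht : 0 ≤ t)
    (hC : ∀ s ∈ Ioc 0 t, s ^ (1 - μ) * ‖f s‖ ≤ C) : ‖∫ s in (0 : ℝ)..t, f s‖ ≤ t ^ μ * (C / μ) :=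
  calc ‖∫ s in (0 : ℝ)..t, f s‖ ≤ ∫ s in (0 : ℝ)..t, C * s ^ (μ - 1) :=
        intervalIntegral.norm_integral_le_of_norm_le ht
          (Eventually.of_forall fun s hs => norm_le_of_weighted hs.1 (hC s hs))
          (intervalIntegrable_const_mul_rpow hμ C 0 t)
    _ = t ^ μ * (C / μ) := by
        rw [intervalIntegral.integral_const_mul, integral_rpow (Or.inl (by linarith)),
          sub_add_cancel, Real.zero_rpow hμ.ne', sub_zero]
        ring

theorem MemBC.tendsto_integral_zero (hμ : 0 < μ) (hT : 0 < T) (hf : MemBC μ T f) :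
    Tendsto (fun t => ∫ s in (0 : ℝ)..t, f s) (𝓝[>] 0) (𝓝 0) := by
  obtain ⟨C, hC⟩ := hf.exists_bound
  have h : Tendsto (fun t : ℝ => t ^ μ * (C / μ)) (𝓝[>] 0) (𝓝 0) := by
    simpa using (tendsto_rpow_nhdsGT_zero hμ).mul_const (C / μ)
  refine squeeze_zero_norm' ?_ h
  filter_upwards [Ioc_mem_nhdsGT hT] with t ht
  exact norm_integral_le_of_weighted hμ ht.1.le fun s hs => hC s ⟨hs.1, hs.2.trans ht.2⟩

end WeightedSpaces

section WeightedModel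

open MeasureTheory

variable {E : Type*} [NormedAddCommGroup E] [NormedSpace ℝ E] {μ T : ℝ} {hT : 0 ≤ T}

/-- The Banach space of all continuous functions on `[0,T]` that vanish at `0`. It is isometric to
`BC_{1-μ}([0,T], E)`: the functions of the latter are those of the form `t ^ (μ-1) φ(t)`. -/
abbrev vanishingAtZero (E : Type*) [NormedAddCommGroup E] [NormedSpace ℝ E] {T : ℝ}
    (hT : 0 ≤ T) : Submodule ℝ C(Icc 0 T, E) :=
  (ContinuousMap.evalCLM ℝ (⟨0, left_mem_Icc.2 hT⟩ : Icc 0 T)).ker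

instance [CompleteSpace E] : CompleteSpace (vanishingAtZero E hT) :=
  inferInstanceAs (CompleteSpace
    (ContinuousMap.evalCLM ℝ (⟨0, left_mem_Icc.2 hT⟩ : Icc 0 T) : C(Icc 0 T, E) →L[ℝ] E).ker)

/-- The map `φ ↦ t ^ (μ-1) φ(t)`, where `φ` is extended to the right of `T` by `φ(T)`. -/
def unweight (μ : ℝ) (hT : 0 ≤ T) (t : ℝ) : vanishingAtZero E hT →L[ℝ] E :=
  t ^ (μ - 1) • (ContinuousMap.evalCLM ℝ (projIcc 0 T hT t)).comp (Submodule.subtypeL _)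

theorem unweight_apply (φ : vanishingAtZero E hT) (t : ℝ) :
    unweight μ hT t φ = t ^ (μ - 1) • (φ : C(Icc 0 T, E)) (projIcc 0 T hT t) := rfl

theorem weight_smul_unweight (φ : vanishingAtZero E hT) {t : ℝ} (ht : 0 < t) :
    t ^ (1 - μ) • unweight μ hT t φ = (φ : C(Icc 0 T, E)) (projIcc 0 T hT t) := by
  rw [unweight_apply, smul_smul, rpow_weight_mul_inv ht, one_smul]

theorem weight_mul_norm_unweight_le (φ : vanishingAtZero E hT) {t : ℝ} (ht : 0 < t) :
    t ^ (1 - μ) * ‖unweight μ hT t φ‖ ≤ ‖φ‖ := by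
  rw [← norm_weight_smul ht.le, weight_smul_unweight φ ht]
  exact ContinuousMap.norm_coe_le_norm _ _

theorem memBC_unweight (hμ : μ < 1) {S : ℝ} (hS : 0 < S) (φ : vanishingAtZero E hT) :
    MemBC μ S fun t => unweight μ hT t φ := by
  rw [memBC_iff hμ hS]
  have hφ : Continuous fun t => (φ : C(Icc 0 T, E)) (projIcc 0 T hT t) := by fun_prop
  refine hφ.continuousOn.congr fun t ht => ?_
  rcases ht.1.eq_or_lt with rfl | htpos
  · simp only [zero_rpow_weight hμ, zero_smul, projIcc_left]
    exact φ.2.symm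
  · exact weight_smul_unweight φ htpos

theorem MemBC.exists_unweight_eqOn {T : ℝ} (hμ : μ < 1) (hT : 0 < T) {f : ℝ → E}
    (hf : MemBC μ T f) :
    ∃ φ : vanishingAtZero E hT.le, EqOn (fun t => unweight μ hT.le t φ) f (Ioc 0 T) := by
  have hc : Continuous fun t : Icc 0 T => (t : ℝ) ^ (1 - μ) • f t :=
    ((memBC_iff hμ hT).1 hf).comp_continuous continuous_subtype_val fun t => t.2
  have h0 : (0 : ℝ) ^ (1 - μ) • f 0 = 0 := by rw [zero_rpow_weight hμ, zero_smul]
  refine ⟨⟨⟨_, hc⟩, h0⟩, fun t ht => ?_⟩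
  simp only [unweight_apply, projIcc_of_mem hT.le (Ioc_subset_Icc_self ht), ContinuousMap.coe_mk]
  exact inv_weight_smul_weight_smul ht.1 _

theorem norm_le_of_weight_mul_norm_unweight_le {φ : vanishingAtZero E hT} {C : ℝ} (hC : 0 ≤ C)
    (h : ∀ t ∈ Ioc 0 T, t ^ (1 - μ) * ‖unweight μ hT t φ‖ ≤ C) : ‖φ‖ ≤ C := by
  refine (ContinuousMap.norm_le (φ : C(Icc 0 T, E)) hC).2 fun ⟨t, ht⟩ => ?_
  rcases ht.1.eq_or_lt with rfl | htpos
  · have h0 : (φ : C(Icc 0 T, E)) ⟨0, ht⟩ = 0 := φ.2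
    rwa [h0, norm_zero]
  · have h1 := h t ⟨htpos, ht.2⟩
    rwa [← norm_weight_smul htpos.le, weight_smul_unweight φ htpos, projIcc_of_mem hT ht] at h1

theorem MemBC.exists_unweight_norm_le {T τ F : ℝ} (hμ : μ < 1) (hT : 0 < T) (hτ : 0 < τ)
    {f : ℝ → E} (hf : MemBC μ τ f) (hF : 0 ≤ F)
    (h : ∀ t ∈ Ioc 0 τ, t ^ (1 - μ) * ‖f t‖ ≤ F) :
    ∃ φ : vanishingAtZero E hT.le, ‖φ‖ ≤ F ∧
      EqOn (fun t => unweight μ hT.le t φ) f (Ioc 0 (min τ T)) := by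
  obtain ⟨ψ, hψ⟩ := hf.exists_unweight_eqOn hμ hτ
  obtain ⟨φ, hφ⟩ := (memBC_unweight hμ hT ψ).exists_unweight_eqOn hμ hT
  have hψF : ‖ψ‖ ≤ F := norm_le_of_weight_mul_norm_unweight_le hF fun t ht =>
    (congrArg (t ^ (1 - μ) * ‖·‖) (hψ ht)).trans_le (h t ht)
  refine ⟨φ, norm_le_of_weight_mul_norm_unweight_le hF fun t ht =>
    (congrArg (t ^ (1 - μ) * ‖·‖) (hφ ht)).trans_le
      ((weight_mul_norm_unweight_le ψ ht.1).trans hψF), fun t ht => ?_⟩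
  exact (hφ ⟨ht.1, ht.2.trans (min_le_right _ _)⟩).trans
    (hψ ⟨ht.1, ht.2.trans (min_le_left _ _)⟩)

/-- The bounded linear map `φ ↦ ∫₀ᵗ s ^ (μ-1) φ(s) ds`. -/
def integralUnweight (hμ : μ ∈ Ioo (0 : ℝ) 1) (hT : 0 ≤ T) {t : ℝ} (ht : 0 < t) :
    vanishingAtZero E hT →L[ℝ] E :=
  LinearMap.mkContinuous
    { toFun φ := ∫ s in (0 : ℝ)..t, unweight μ hT s φ
      map_add' φ ψ := by
        simp only [map_add]
        have hint (φ : vanishingAtZero E hT) :=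
          (memBC_unweight hμ.2 ht φ).intervalIntegrable_zero hμ.1 (right_mem_Icc.2 ht.le)
        exact intervalIntegral.integral_add (hint φ) (hint ψ)
      map_smul' c φ := by
        simp only [map_smul]
        exact intervalIntegral.integral_smul c _ } (t ^ μ / μ) fun φ => by
    refine (norm_integral_le_of_weighted hμ.1 ht.le fun s hs =>
      weight_mul_norm_unweight_le φ hs.1).trans_eq ?_
    exact (mul_div_assoc _ _ _).symm.trans (mul_div_right_comm _ _ _)

end WeightedModel

section Trace

variable {E₀ E₁ : Type*} [NormedAddCommGroup E₀] [NormedSpace ℝ E₀]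
  [NormedAddCommGroup E₁] [NormedSpace ℝ E₁] {j : E₁ →L[ℝ] E₀} {μ : ℝ}
  {v : ℝ → E₁} {g : ℝ → E₀} {x : InterpSpace j μ}

theorem norm_sub_le_of_weighted {E : Type*} [NormedAddCommGroup E] {v : ℝ → E} (hμ : μ < 1)
    {s t d : ℝ} (hs : 0 < s) (hst : s ≤ t)
    (hv : ∀ r ∈ Ioc 0 t, r ^ (1 - μ) * ‖v r‖ ≤ d) : ‖v t - v s‖ ≤ 2 * d * s ^ (μ - 1) := by
  have ht := hs.trans_le hst
  have hd : 0 ≤ d := le_trans (by positivity) (hv t (right_mem_Ioc.2 ht))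
  have hpow : t ^ (μ - 1) ≤ s ^ (μ - 1) :=
    Real.rpow_le_rpow_of_nonpos hs hst (sub_nonpos.2 hμ.le)
  calc ‖v t - v s‖ ≤ ‖v t‖ + ‖v s‖ := norm_sub_le _ _
    _ ≤ d * t ^ (μ - 1) + d * s ^ (μ - 1) :=
      add_le_add (norm_le_of_weighted ht (hv t (right_mem_Ioc.2 ht)))
        (norm_le_of_weighted hs (hv s ⟨hs, hst⟩))
    _ ≤ d * s ^ (μ - 1) + d * s ^ (μ - 1) := by gcongr
    _ = 2 * d * s ^ (μ - 1) := by ring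

theorem norm_embed_sub_le (hμ : μ ∈ Ioo (0 : ℝ) 1) {t d₁ d₂ : ℝ} (ht : 0 < t)
    (heq : ∀ s ∈ Ioc 0 t, j (v s) = InterpSpace.incl x + ∫ r in (0 : ℝ)..s, g r)
    (hv : ∀ s ∈ Ioc 0 t, s ^ (1 - μ) * ‖v s‖ ≤ d₁)
    (hg : ∀ s ∈ Ioc 0 t, s ^ (1 - μ) * ‖g s‖ ≤ d₂) :
    ‖embed j hμ (v t) - x‖ ≤ 2 * d₁ + d₂ / μ := by
  have hd₁ : 0 ≤ d₁ := le_trans (by positivity) (hv t (right_mem_Ioc.2 ht))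
  have hd₂ : 0 ≤ d₂ / μ := div_nonneg (le_trans (by positivity) (hg t (right_mem_Ioc.2 ht))) hμ.1.le
  have hx : ∀ s ∈ Ioc 0 t, ‖j (v s) - InterpSpace.incl x‖ ≤ s ^ μ * (d₂ / μ) := fun s hs => by
    rw [heq s hs, add_sub_cancel_left]
    exact norm_integral_le_of_weighted hμ.1 hs.1.le fun r hr => hg r ⟨hr.1, hr.2.trans hs.2⟩
  rw [InterpSpace.norm_def, map_sub, incl_embed]
  refine interpNorm_le fun s hs => ?_
  -- For `s ≤ t`, decompose `v(t) - x` at time `s` as `(v(s) - x) + (v(t) - v(s))`.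
  rcases le_total s t with hst | hst
  · have hpow : s * s ^ (μ - 1) = s ^ μ := by
      rw [← Real.rpow_one_add' hs.le (by linarith [hμ.1]), add_sub_cancel]
    calc kFunctional j s (j (v t) - InterpSpace.incl x)
        ≤ ‖j (v s) - InterpSpace.incl x‖ + s * ‖v t - v s‖ := by
          have h := kFunctional_le j hs.le (j (v t) - InterpSpace.incl x) (v t - v s)
          rwa [map_sub, sub_sub_sub_cancel_left] at h
      _ ≤ s ^ μ * (d₂ / μ) + s * (2 * d₁ * s ^ (μ - 1)) := by
          gcongr
          exacts [hx s ⟨hs, hst⟩, norm_sub_le_of_weighted hμ.2 hs hst hv]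
      _ = s ^ μ * (2 * d₁ + d₂ / μ) := by rw [← hpow]; ring
  · calc kFunctional j s (j (v t) - InterpSpace.incl x)
        ≤ ‖j (v t) - InterpSpace.incl x‖ := kFunctional_le_norm j hs.le _
      _ ≤ t ^ μ * (d₂ / μ) := hx t (right_mem_Ioc.2 ht)
      _ ≤ s ^ μ * (2 * d₁ + d₂ / μ) := by
        gcongr
        exacts [hμ.1.le, le_add_of_nonneg_left (by positivity)]

theorem tendsto_embed (hμ : μ ∈ Ioo (0 : ℝ) 1) {T : ℝ} (hT : 0 < T) (hv : MemBC μ T v)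
    (hg : MemBC μ T g)
    (heq : ∀ s ∈ Ioc 0 T, j (v s) = InterpSpace.incl x + ∫ r in (0 : ℝ)..s, g r) :
    Tendsto (fun t => embed j hμ (v t)) (𝓝[>] 0) (𝓝 x) := by
  rw [Metric.nhds_basis_closedBall.tendsto_right_iff]
  intro ε hε
  have hμ0 := hμ.1
  have hd : 0 < ε / (2 + 1 / μ) := by positivity
  filter_upwards [Ioc_mem_nhdsGT hT, hv.eventually_forall_le hd, hg.eventually_forall_le hd]
    with t ht hvt hgt
  rw [mem_closedBall_iff_norm]
  refine (norm_embed_sub_le hμ ht.1 (fun s hs => heq s ⟨hs.1, hs.2.trans ht.2⟩)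
    hvt hgt).trans_eq ?_
  field_simp

end Trace

section Concatenation

open MeasureTheory

variable {E : Type*} {τ t : ℝ} {z v : ℝ → E}

/-- The function that equals `z` up to time `τ` and then follows `v` from its time `0` on. -/
def concat (τ : ℝ) (z v : ℝ → E) (t : ℝ) : E := if t ≤ τ then z t else v (t - τ)

theorem concat_of_le (h : t ≤ τ) : concat τ z v t = z t := if_pos h

theorem concat_of_lt (h : τ < t) : concat τ z v t = v (t - τ) := if_neg h.not_ge

theorem apply_concat {F : Type*} (φ : E → F) :
    φ (concat τ z v t) = concat τ (fun s => φ (z s)) (fun s => φ (v s)) t :=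
  apply_ite φ _ _ _

variable [NormedAddCommGroup E]

theorem intervalIntegrable_concat_left (hτ : 0 ≤ τ) (hz : IntervalIntegrable z volume 0 τ) :
    IntervalIntegrable (concat τ z v) volume 0 τ :=
  hz.congr fun s hs => by
    rw [uIoc_of_le hτ] at hs
    exact (concat_of_le hs.2).symm

theorem intervalIntegrable_concat_right (ht : τ ≤ t)
    (hv : IntervalIntegrable v volume 0 (t - τ)) :
    IntervalIntegrable (concat τ z v) volume τ t := by
  have h := hv.comp_sub_right τ
  rw [zero_add, sub_add_cancel] at h
  refine h.congr fun s hs => ?_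
  rw [uIoc_of_le ht] at hs
  exact (concat_of_lt hs.1).symm

variable [NormedSpace ℝ E]

theorem integral_concat_of_le (ht₀ : 0 ≤ t) (ht : t ≤ τ) :
    ∫ s in (0 : ℝ)..t, concat τ z v s = ∫ s in (0 : ℝ)..t, z s :=
  integral_congr_Ioc ht₀ fun _ hs => concat_of_le (hs.2.trans ht)

theorem integral_concat (hτ : 0 ≤ τ) (ht : τ ≤ t) (hz : IntervalIntegrable z volume 0 τ)
    (hv : IntervalIntegrable v volume 0 (t - τ)) :
    ∫ s in (0 : ℝ)..t, concat τ z v s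
      = (∫ s in (0 : ℝ)..τ, z s) + ∫ s in (0 : ℝ)..(t - τ), v s := by
  have hright : ∫ s in τ..t, concat τ z v s = ∫ s in (0 : ℝ)..(t - τ), v s := by
    rw [integral_congr_Ioc ht fun s hs => concat_of_lt hs.1,
      intervalIntegral.integral_comp_sub_right, sub_self]
  rw [← intervalIntegral.integral_add_adjacent_intervals (intervalIntegrable_concat_left hτ hz)
    (intervalIntegrable_concat_right ht hv), integral_concat_of_le hτ le_rfl, hright]

theorem MemBC.concat {μ b d : ℝ} (hμ : μ < 1) (hτ : 0 < τ) (hb : τ < b) (hd : b ≤ τ + d)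
    (hz : MemBC μ b z) (hv : MemBC μ d v) (hzv : ∀ t ∈ Ioc 0 (b - τ), v t = z (τ + t)) :
    MemBC μ (τ + d) (concat τ z v) := by
  have hb₀ := hτ.trans hb
  rw [memBC_iff hμ (hb₀.trans_le hd), ← Icc_union_Icc_eq_Icc hb₀.le hd]
  refine ContinuousOn.union_of_isClosed ?_ ?_ isClosed_Icc isClosed_Icc
  · refine ((memBC_iff hμ hb₀).1 hz).congr fun t ht => ?_
    rcases le_or_gt t τ with h | h
    · simp only [concat_of_le h]
    · simp only [concat_of_lt h, hzv (t - τ) ⟨sub_pos.2 h, by linarith [ht.2]⟩,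
        add_sub_cancel]
  · have hshift : ContinuousOn (fun t => v (t - τ)) (Icc b (τ + d)) :=
      hv.continuousOn.comp (by fun_prop) fun t ht =>
        ⟨by linarith [ht.1], by linarith [ht.2]⟩
    exact ((continuous_weight hμ).continuousOn.fun_smul hshift).congr fun t ht => by
      simp only [concat_of_lt (hb.trans_le ht.1)]

end Concatenation

section LinearProblem

open MeasureTheory

variable {E₀ E₁ : Type*} [NormedAddCommGroup E₀] [NormedSpace ℝ E₀]
  [NormedAddCommGroup E₁] [NormedSpace ℝ E₁] {j : E₁ →L[ℝ] E₀} {μ T : ℝ}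
  {B : E₁ →L[ℝ] E₀} {f g : ℝ → E₀} {x y : InterpSpace j μ} {v w : ℝ → E₁}

/-- The function `v ∈ BC_{1-μ}([0,T], E₁)` solves the integrated problem
`v(t) = x + ∫₀ᵗ (f(s) - B v(s)) ds` on `(0,T]`. -/
structure IsLinearSolution (j : E₁ →L[ℝ] E₀) (μ : ℝ) (B : E₁ →L[ℝ] E₀) (T : ℝ) (f : ℝ → E₀)
    (x : InterpSpace j μ) (v : ℝ → E₁) : Prop where
  memBC : MemBC μ T v
  eqn : ∀ t ∈ Ioc 0 T, j (v t) = InterpSpace.incl x + ∫ s in (0 : ℝ)..t, (f s - B (v s))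

theorem IsLinearSolution.mono {S : ℝ} (h : IsLinearSolution j μ B T f x v) (hS : S ≤ T) :
    IsLinearSolution j μ B S f x v :=
  ⟨h.memBC.mono hS, fun t ht => h.eqn t (Ioc_subset_Ioc_right hS ht)⟩

theorem IsLinearSolution.congr (hμ : μ < 1) (hT : 0 < T) (h : IsLinearSolution j μ B T f x v)
    (hfg : EqOn f g (Ioc 0 T)) (hvw : EqOn v w (Ioc 0 T)) : IsLinearSolution j μ B T g x w := by
  refine ⟨h.memBC.congr hμ hT hvw.symm, fun t ht => ?_⟩
  rw [← hvw ht, h.eqn t ht, integral_congr_Ioc ht.1.le fun s hs => ?_]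
  have hs' : s ∈ Ioc 0 T := ⟨hs.1, hs.2.trans ht.2⟩
  simp only [hfg hs', hvw hs']

theorem IsLinearSolution.memBC_sub_apply (hμ : μ < 1) (hT : 0 < T)
    (hv : IsLinearSolution j μ B T f x v) (hf : MemBC μ T f) :
    MemBC μ T fun t => f t - B (v t) :=
  hf.sub hμ hT (hv.memBC.clm hμ hT B)

theorem IsLinearSolution.sub (hμ : μ ∈ Ioo (0 : ℝ) 1) (hT : 0 < T) (hf : MemBC μ T f)
    (hg : MemBC μ T g) (hv : IsLinearSolution j μ B T f x v)
    (hw : IsLinearSolution j μ B T g y w) :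
    IsLinearSolution j μ B T (fun t => f t - g t) (x - y) (fun t => v t - w t) := by
  refine ⟨hv.memBC.sub hμ.2 hT hw.memBC, fun t ht => ?_⟩
  have ht' := Ioc_subset_Icc_self ht
  rw [map_sub, hv.eqn t ht, hw.eqn t ht, map_sub, add_sub_add_comm,
    ← intervalIntegral.integral_sub
      ((hv.memBC_sub_apply hμ.2 hT hf).intervalIntegrable_zero hμ.1 ht')
      ((hw.memBC_sub_apply hμ.2 hT hg).intervalIntegrable_zero hμ.1 ht')]
  simp only [map_sub, sub_sub_sub_comm]

variable [CompleteSpace E₀]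

theorem memMaxReg_of_eq_add_integral (hj : Function.Injective j)
    (hμ : μ ∈ Ioo (0 : ℝ) 1) (hT : 0 < T) {u : ℝ → E₀} (hv : MemBC μ T v) (hg : MemBC μ T g)
    (huv : ∀ t ∈ Ioc 0 T, u t = j (v t))
    (hu : ∀ t ∈ Ioc 0 T, u t = u 0 + ∫ s in (0 : ℝ)..t, g s) :
    MemMaxReg j μ T u ∧ EqOn (derivWithin u (Ioc 0 T)) g (Ioc 0 T) := by
  have hd : ∀ t ∈ Ioc 0 T, HasDerivWithinAt u (g t) (Ioc 0 T) t := fun t ht =>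
    ((hasDerivWithinAt_integral_Ioc hg.continuousOn
      (hg.intervalIntegrable_zero hμ.1 (right_mem_Icc.2 hT.le)) ht).const_add (u 0)).congr
        hu (hu t ht)
  have hd' : EqOn (derivWithin u (Ioc 0 T)) g (Ioc 0 T) := fun t ht =>
    (hd t ht).derivWithin (uniqueDiffOn_Ioc 0 T t ht)
  refine ⟨⟨fun t ht => ⟨v t, (huv t ht).symm⟩, ⟨fun t ht => (hd t ht).differentiableWithinAt,
    (hv.clm hμ.2 hT j).congr hμ.2 hT huv, hg.congr hμ.2 hT hd'⟩,
    hv.congr hμ.2 hT fun t ht => by rw [huv t ht, toE₁_apply hj], ?_⟩, hd'⟩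
  have h := (hg.tendsto_integral_zero hμ.1 hT).const_add (u 0)
  rw [add_zero] at h
  exact h.congr' (by filter_upwards [Ioc_mem_nhdsGT hT] with t ht using (hu t ht).symm)

theorem MemMaxReg.eq_add_integral (hμ : 0 < μ) {u : ℝ → E₀}
    (hu : MemMaxReg j μ T u) {t : ℝ} (ht : t ∈ Ioc 0 T) :
    u t = u 0 + ∫ s in (0 : ℝ)..t, derivWithin u (Ioc 0 T) s :=
  eq_add_integral_of_hasDerivWithinAt
    (hu.memBC1.memBC_deriv.intervalIntegrable_zero hμ (right_mem_Icc.2 (ht.1.le.trans ht.2)))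
    (fun s hs => (hu.memBC1.differentiableOn s hs).hasDerivWithinAt) hu.trace ht

theorem isLinearSolution_of_memMaxReg (hμ : 0 < μ) {u : ℝ → E₀}
    (hu : MemMaxReg j μ T u) (h0 : u 0 = InterpSpace.incl x)
    (heq : ∀ t ∈ Ioc 0 T, derivWithin u (Ioc 0 T) t + B (toE₁ j (u t)) = f t) :
    IsLinearSolution j μ B T f x fun t => toE₁ j (u t) := by
  refine ⟨hu.memBC, fun t ht => ?_⟩
  rw [apply_toE₁ (hu.mem_range t ht), hu.eq_add_integral hμ ht, h0,
    integral_congr_Ioc ht.1.le fun s hs => ?_]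
  simp only [← heq s ⟨hs.1, hs.2.trans ht.2⟩, add_sub_cancel_right]

theorem IsLinearSolution.exists_memMaxReg (hj : Function.Injective j)
    (hμ : μ ∈ Ioo (0 : ℝ) 1) (hT : 0 < T) (hf : MemBC μ T f)
    (hv : IsLinearSolution j μ B T f x v) :
    ∃ u : ℝ → E₀, (MemMaxReg j μ T u ∧ u 0 = InterpSpace.incl x ∧
      ∀ t ∈ Ioc 0 T, derivWithin u (Ioc 0 T) t + B (toE₁ j (u t)) = f t) ∧
      ∀ t ∈ Ioc 0 T, u t = j (v t) := by
  set u : ℝ → E₀ := fun t => if t ≤ 0 then InterpSpace.incl x else j (v t)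
  have huv : ∀ t ∈ Ioc 0 T, u t = j (v t) := fun t ht => if_neg ht.1.not_ge
  have hu0 : u 0 = InterpSpace.incl x := if_pos le_rfl
  obtain ⟨hmem, hderiv⟩ := memMaxReg_of_eq_add_integral hj hμ hT hv.memBC
    (hv.memBC_sub_apply hμ.2 hT hf) huv fun t ht => by rw [hu0, huv t ht, hv.eqn t ht]
  refine ⟨u, ⟨hmem, hu0, fun t ht => ?_⟩, huv⟩
  rw [hderiv ht, huv t ht, toE₁_apply hj, sub_add_cancel]

theorem IsMaxRegOperator.exists_unique_solution (hj : Function.Injective j)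
    (hμ : μ ∈ Ioo (0 : ℝ) 1) (hB : IsMaxRegOperator j μ B) :
    ∃ T > 0, (∀ f : ℝ → E₀, MemBC μ T f → ∀ x, ∃ v, IsLinearSolution j μ B T f x v) ∧
      ∀ v, IsLinearSolution j μ B T (fun _ => 0) 0 v → EqOn v 0 (Ioc 0 T) := by
  obtain ⟨T, hT, h⟩ := hB
  refine ⟨T, hT, fun f hf x => ?_, fun v hv t ht => hj ?_⟩
  · obtain ⟨u, hu, h0, heq⟩ := (h f hf x).1
    exact ⟨_, isLinearSolution_of_memMaxReg hμ.1 hu h0 heq⟩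
  · have hzero : IsLinearSolution j μ B T (fun _ => 0) 0 (fun _ => 0) := ⟨memBC_zero, by simp⟩
    obtain ⟨u, hu, huv⟩ := hv.exists_memMaxReg hj hμ hT memBC_zero
    obtain ⟨u₀, hu₀, hu₀v⟩ := hzero.exists_memMaxReg hj hμ hT memBC_zero
    rw [← huv t ht, (h _ memBC_zero 0).2 u u₀ hu hu₀ (Ioc_subset_Icc_self ht), hu₀v t ht]
    rfl

section Homogeneous

variable [CompleteSpace E₁]

theorem IsLinearSolution.apply_eq_sub_apply_integral (hμ : 0 < μ)
    (hv : IsLinearSolution j μ B T (fun _ => 0) x v) {t : ℝ} (ht : t ∈ Ioc 0 T) :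
    j (v t) = InterpSpace.incl x - B (∫ s in (0 : ℝ)..t, v s) := by
  rw [hv.eqn t ht, ← B.intervalIntegral_comp_comm
    (hv.memBC.intervalIntegrable_zero hμ (Ioc_subset_Icc_self ht))]
  simp only [zero_sub]
  rw [intervalIntegral.integral_neg, sub_eq_add_neg]

theorem isLinearSolution_integral (hμ : μ < 1) (hT : 0 < T)
    (hint : IntervalIntegrable w volume 0 T)
    (hw : ∀ t ∈ Ioc 0 T, j (w t) = -B (∫ s in (0 : ℝ)..t, w s)) :
    IsLinearSolution j μ B T (fun _ => 0) 0 fun t => ∫ s in (0 : ℝ)..t, w s := by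
  have hcont := intervalIntegral.continuousOn_primitive_interval' hint left_mem_uIcc
  rw [uIcc_of_le hT.le] at hcont
  refine ⟨memBC_of_continuousOn hμ hT hcont, fun t ht => ?_⟩
  rw [← j.intervalIntegral_comp_comm (hint.mono_set
    (uIcc_subset_uIcc_left (Icc_subset_uIcc (Ioc_subset_Icc_self ht)))), map_zero, zero_add]
  refine integral_congr_Ioc ht.1.le fun s hs => ?_
  simp only [hw s ⟨hs.1, hs.2.trans ht.2⟩, zero_sub]

-- A solution `z` on `[0,τ]` with zero data is continued by a solution `v` that starts at `z(τ)`.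
-- The result may jump in `E₁` at `τ`, but its integral is continuous in `E₁` and solves the
-- homogeneous problem on `[0,T]`, so that the uniqueness on `[0,T]` applies to it.
theorem IsLinearSolution.eqOn_zero_of_le (hj : Function.Injective j) (hμ : μ ∈ Ioo (0 : ℝ) 1)
    (hex : ∀ x, ∃ v, IsLinearSolution j μ B T (fun _ => 0) x v)
    (huniq : ∀ v, IsLinearSolution j μ B T (fun _ => 0) 0 v → EqOn v 0 (Ioc 0 T))
    {τ : ℝ} (hτ : τ ∈ Ioc 0 T) {z : ℝ → E₁}
    (hz : IsLinearSolution j μ B τ (fun _ => 0) 0 z) : EqOn z 0 (Ioc 0 τ) := by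
  have hT : 0 < T := hτ.1.trans_le hτ.2
  obtain ⟨v, hv⟩ := hex (embed j hμ (z τ))
  have hzint := hz.memBC.intervalIntegrable_zero hμ.1 (right_mem_Icc.2 hτ.1.le)
  have hvint : ∀ t ∈ Icc τ T, IntervalIntegrable v volume 0 (t - τ) := fun t ht =>
    hv.memBC.intervalIntegrable_zero hμ.1 ⟨sub_nonneg.2 ht.1, by linarith [ht.2, hτ.1]⟩
  have hint : IntervalIntegrable (concat τ z v) volume 0 T :=
    (intervalIntegrable_concat_left hτ.1.le hzint).trans
      (intervalIntegrable_concat_right hτ.2 (hvint T (right_mem_Icc.2 hτ.2)))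
  have hz_apply : ∀ t ∈ Ioc 0 τ, j (z t) = -B (∫ s in (0 : ℝ)..t, z s) := fun t ht => by
    rw [hz.apply_eq_sub_apply_integral hμ.1 ht, map_zero, zero_sub]
  have hsol : ∀ t ∈ Ioc 0 T,
      j (concat τ z v t) = -B (∫ s in (0 : ℝ)..t, concat τ z v s) := fun t ht => by
    rcases le_or_gt t τ with htτ | hτt
    · rw [concat_of_le htτ, integral_concat_of_le ht.1.le htτ, hz_apply t ⟨ht.1, htτ⟩]
    · rw [concat_of_lt hτt, integral_concat hτ.1.le hτt.le hzint (hvint t ⟨hτt.le, ht.2⟩),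
        hv.apply_eq_sub_apply_integral hμ.1 ⟨sub_pos.2 hτt, by linarith [ht.2, hτ.1]⟩,
        incl_embed, hz_apply τ (right_mem_Ioc.2 hτ.1), map_add, neg_add']
  intro t ht
  have htT : t ∈ Ioc 0 T := ⟨ht.1, ht.2.trans hτ.2⟩
  have hzero : ∫ s in (0 : ℝ)..t, concat τ z v s = 0 :=
    huniq _ (isLinearSolution_integral hμ.2 hT hint hsol) htT
  apply hj
  rw [← concat_of_le (z := z) (v := v) ht.2, hsol t htT, hzero]
  simp only [Pi.zero_apply, map_zero, neg_zero]

end Homogeneous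

section ClosedGraph

variable (j B) in
/-- The residual at time `t` of the integrated linear problem, as a function of the right-hand
side, the initial value and the candidate for the solution; the first and the last of these are
given by the continuous functions `s ^ (1-μ) f(s)` and `s ^ (1-μ) v(s)`. -/
def linearResidual (hμ : μ ∈ Ioo (0 : ℝ) 1) (hT : 0 ≤ T) (t : Ioc 0 T) :
    vanishingAtZero E₀ hT × InterpSpace j μ × vanishingAtZero E₁ hT →L[ℝ] E₀ :=
  let pφ := ContinuousLinearMap.fst ℝ (vanishingAtZero E₀ hT)
    (InterpSpace j μ × vanishingAtZero E₁ hT)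
  let p := ContinuousLinearMap.snd ℝ (vanishingAtZero E₀ hT)
    (InterpSpace j μ × vanishingAtZero E₁ hT)
  let px := (ContinuousLinearMap.fst ℝ (InterpSpace j μ) (vanishingAtZero E₁ hT)).comp p
  let pψ := (ContinuousLinearMap.snd ℝ (InterpSpace j μ) (vanishingAtZero E₁ hT)).comp p
  (j.comp (unweight μ hT t)).comp pψ - ((InterpSpace.inclL j μ).comp px
    + ((integralUnweight hμ hT t.2.1).comp pφ
      - (B.comp (integralUnweight hμ hT t.2.1)).comp pψ))

theorem linearResidual_apply [CompleteSpace E₁] (hμ : μ ∈ Ioo (0 : ℝ) 1) (hT : 0 ≤ T)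
    (t : Ioc 0 T) (φ : vanishingAtZero E₀ hT) (x : InterpSpace j μ)
    (ψ : vanishingAtZero E₁ hT) :
    linearResidual j B hμ hT t (φ, x, ψ) = j (unweight μ hT t ψ) -
      (InterpSpace.incl x + ∫ s in (0 : ℝ)..t, (unweight μ hT s φ - B (unweight μ hT s ψ))) := by
  have hψ := (memBC_unweight hμ.2 t.2.1 ψ).intervalIntegrable_zero hμ.1 (right_mem_Icc.2 t.2.1.le)
  have hφ := (memBC_unweight hμ.2 t.2.1 φ).intervalIntegrable_zero hμ.1 (right_mem_Icc.2 t.2.1.le)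
  have hBψ := ((memBC_unweight hμ.2 t.2.1 ψ).clm hμ.2 t.2.1 B).intervalIntegrable_zero hμ.1
    (right_mem_Icc.2 t.2.1.le)
  rw [intervalIntegral.integral_sub hφ hBψ, B.intervalIntegral_comp_comm hψ]
  rfl

variable (j B) in
/-- The set of all `(φ, x, ψ)` such that `t ^ (μ-1) ψ(t)` solves the integrated linear problem
with right-hand side `t ^ (μ-1) φ(t)` and initial value `x`, as a closed subspace. -/
def solutionGraph (hμ : μ ∈ Ioo (0 : ℝ) 1) (hT : 0 ≤ T) :
    Submodule ℝ (vanishingAtZero E₀ hT × InterpSpace j μ × vanishingAtZero E₁ hT) :=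
  (ContinuousLinearMap.pi (linearResidual j B hμ hT)).ker

variable [CompleteSpace E₁]

instance (hμ : μ ∈ Ioo (0 : ℝ) 1) (hT : 0 ≤ T) : CompleteSpace (solutionGraph j B hμ hT) :=
  inferInstanceAs (CompleteSpace (ContinuousLinearMap.pi (linearResidual j B hμ hT)).ker)

theorem mem_solutionGraph_iff (hμ : μ ∈ Ioo (0 : ℝ) 1) (hT : 0 < T)
    {φ : vanishingAtZero E₀ hT.le} {x : InterpSpace j μ} {ψ : vanishingAtZero E₁ hT.le} :
    (φ, x, ψ) ∈ solutionGraph j B hμ hT.le ↔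
      IsLinearSolution j μ B T (fun t => unweight μ hT.le t φ) x
        fun t => unweight μ hT.le t ψ := by
  have hmem : (φ, x, ψ) ∈ solutionGraph j B hμ hT.le ↔
      ∀ t : Ioc 0 T, linearResidual j B hμ hT.le t (φ, x, ψ) = 0 := funext_iff
  simp only [hmem, linearResidual_apply, sub_eq_zero, Subtype.forall]
  exact ⟨fun h => ⟨memBC_unweight hμ.2 hT ψ, h⟩, IsLinearSolution.eqn⟩

theorem exists_mem_norm_le {X Y Z : Type*} [NormedAddCommGroup X] [NormedSpace ℝ X]
    [CompleteSpace X] [NormedAddCommGroup Y] [NormedSpace ℝ Y] [CompleteSpace Y]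
    [NormedAddCommGroup Z] [NormedSpace ℝ Z] (Γ : Submodule ℝ (X × Y × Z)) [CompleteSpace Γ]
    (h : ∀ x y, ∃ z, (x, y, z) ∈ Γ) :
    ∃ C > 0, ∀ x y, ∃ z, (x, y, z) ∈ Γ ∧ ‖z‖ ≤ C * (‖x‖ + ‖y‖) := by
  let π : Γ →L[ℝ] X × Y :=
    ((ContinuousLinearMap.fst ℝ X (Y × Z)).prod
      ((ContinuousLinearMap.fst ℝ Y Z).comp (ContinuousLinearMap.snd ℝ X (Y × Z)))).comp Γ.subtypeL
  have hsurj : Function.Surjective π := fun ⟨x, y⟩ =>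
    let ⟨z, hz⟩ := h x y
    ⟨⟨(x, y, z), hz⟩, rfl⟩
  obtain ⟨C, hC, hpre⟩ := π.exists_preimage_norm_le hsurj
  refine ⟨C, hC, fun x y => ?_⟩
  obtain ⟨⟨⟨x', y', z⟩, hmem⟩, hπ, hn⟩ := hpre (x, y)
  obtain ⟨rfl, rfl⟩ : x' = x ∧ y' = y := Prod.ext_iff.mp hπ
  refine ⟨z, hmem, ?_⟩
  calc ‖z‖ ≤ ‖((x', y', z) : X × Y × Z)‖ := (norm_snd_le (y', z)).trans (norm_snd_le (x', y', z))
    _ ≤ C * ‖(x', y')‖ := hn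
    _ ≤ C * (‖x'‖ + ‖y'‖) := by
      gcongr
      exact norm_prod_le_iff.mpr ⟨le_add_of_nonneg_right (norm_nonneg _),
        le_add_of_nonneg_left (norm_nonneg _)⟩

theorem exists_solution_le (hμ : μ ∈ Ioo (0 : ℝ) 1) (hT : 0 < T)
    (hex : ∀ f : ℝ → E₀, MemBC μ T f → ∀ x, ∃ v, IsLinearSolution j μ B T f x v) :
    ∃ C > 0, ∀ (φ : vanishingAtZero E₀ hT.le) (x : InterpSpace j μ), ∃ v,
      IsLinearSolution j μ B T (fun t => unweight μ hT.le t φ) x v ∧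
        ∀ t ∈ Ioc 0 T, t ^ (1 - μ) * ‖v t‖ ≤ C * (‖φ‖ + ‖x‖) := by
  have honto (φ : vanishingAtZero E₀ hT.le) (x : InterpSpace j μ) :
      ∃ ψ, (φ, x, ψ) ∈ solutionGraph j B hμ hT.le := by
    obtain ⟨v, hv⟩ := hex (fun t => unweight μ hT.le t φ) (memBC_unweight hμ.2 hT φ) x
    obtain ⟨ψ, hψ⟩ := hv.memBC.exists_unweight_eqOn hμ.2 hT
    exact ⟨ψ, (mem_solutionGraph_iff hμ hT).2 (hv.congr hμ.2 hT (fun _ _ => rfl) hψ.symm)⟩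
  obtain ⟨C, hC, h⟩ := exists_mem_norm_le (X := vanishingAtZero E₀ hT.le) (Y := InterpSpace j μ)
    (Z := vanishingAtZero E₁ hT.le) (solutionGraph j B hμ hT.le) honto
  refine ⟨C, hC, fun φ x => ?_⟩
  obtain ⟨ψ, hmem, hn⟩ := h φ x
  exact ⟨_, (mem_solutionGraph_iff hμ hT).1 hmem, fun t ht =>
    (weight_mul_norm_unweight_le ψ ht.1).trans hn⟩

end ClosedGraph

/-- Maximal regularity of `B` on `[0,T]` with an a priori bound by the constant `M`: the integrated
linear problem is solvable on `[0,T]`, and its solutions are controlled in `𝔼_{1,μ}([0,T])` and in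
`E_μ` by a weighted bound `F` of the right-hand side and by the norm of the initial value. -/
structure HasMaxRegEstimate (j : E₁ →L[ℝ] E₀) (hμ : μ ∈ Ioo (0 : ℝ) 1) (B : E₁ →L[ℝ] E₀)
    (M T : ℝ) : Prop where
  exists_solution : ∀ f : ℝ → E₀, MemBC μ T f → ∀ x, ∃ v, IsLinearSolution j μ B T f x v
  estimate : ∀ (f : ℝ → E₀) (x : InterpSpace j μ) (v : ℝ → E₁) (F : ℝ), MemBC μ T f →
    IsLinearSolution j μ B T f x v → (∀ t ∈ Ioc 0 T, t ^ (1 - μ) * ‖f t‖ ≤ F) →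
    ∀ t ∈ Ioc 0 T,
      t ^ (1 - μ) * ‖v t‖ + t ^ (1 - μ) * ‖f t - B (v t)‖ + ‖embed j hμ (v t)‖ ≤ M * (F + ‖x‖)

omit [CompleteSpace E₀] in
theorem IsLinearSolution.estimate_of_weighted_le (hμ : μ ∈ Ioo (0 : ℝ) 1)
    (hv : IsLinearSolution j μ B T f x v) {C F : ℝ}
    (hf : ∀ t ∈ Ioc 0 T, t ^ (1 - μ) * ‖f t‖ ≤ F)
    (hvC : ∀ t ∈ Ioc 0 T, t ^ (1 - μ) * ‖v t‖ ≤ C * (F + ‖x‖)) {t : ℝ} (ht : t ∈ Ioc 0 T) :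
    t ^ (1 - μ) * ‖v t‖ + t ^ (1 - μ) * ‖f t - B (v t)‖ + ‖embed j hμ (v t)‖
      ≤ (C + (1 + ‖B‖ * C) + (1 + 2 * C + (1 + ‖B‖ * C) / μ)) * (F + ‖x‖) := by
  have hF : 0 ≤ F := le_trans (by have := ht.1; positivity) (hf t ht)
  have hderiv : ∀ s ∈ Ioc 0 T,
      s ^ (1 - μ) * ‖f s - B (v s)‖ ≤ (1 + ‖B‖ * C) * (F + ‖x‖) := fun s hs => by
    have hs0 : 0 ≤ s ^ (1 - μ) := Real.rpow_nonneg hs.1.le _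
    calc s ^ (1 - μ) * ‖f s - B (v s)‖ ≤ s ^ (1 - μ) * (‖f s‖ + ‖B‖ * ‖v s‖) := by
          gcongr
          exact (norm_sub_le _ _).trans (by gcongr; exact B.le_opNorm _)
      _ = s ^ (1 - μ) * ‖f s‖ + ‖B‖ * (s ^ (1 - μ) * ‖v s‖) := by ring
      _ ≤ (F + ‖x‖) + ‖B‖ * (C * (F + ‖x‖)) := by
        exact add_le_add ((hf s hs).trans (le_add_of_nonneg_right (norm_nonneg x)))
          (mul_le_mul_of_nonneg_left (hvC s hs) (norm_nonneg B))
      _ = (1 + ‖B‖ * C) * (F + ‖x‖) := by ring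
  have hmem : ∀ s ∈ Ioc 0 t, s ∈ Ioc 0 T := fun s hs => ⟨hs.1, hs.2.trans ht.2⟩
  have htrace : ‖embed j hμ (v t) - x‖
      ≤ 2 * (C * (F + ‖x‖)) + (1 + ‖B‖ * C) * (F + ‖x‖) / μ :=
    norm_embed_sub_le hμ ht.1 (fun s hs => hv.eqn s (hmem s hs)) (fun s hs => hvC s (hmem s hs))
      fun s hs => hderiv s (hmem s hs)
  calc _ ≤ C * (F + ‖x‖) + (1 + ‖B‖ * C) * (F + ‖x‖)
        + ((F + ‖x‖) + (2 * (C * (F + ‖x‖)) + (1 + ‖B‖ * C) * (F + ‖x‖) / μ)) := by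
        exact add_le_add (add_le_add (hvC t ht) (hderiv t ht))
          ((norm_le_norm_add_norm_sub' _ x).trans (add_le_add (le_add_of_nonneg_left hF) htrace))
    _ = _ := by ring

variable [CompleteSpace E₁]

theorem IsMaxRegOperator.exists_hasMaxRegEstimate (hj : Function.Injective j)
    (hμ : μ ∈ Ioo (0 : ℝ) 1) (hB : IsMaxRegOperator j μ B) :
    ∃ T > 0, ∃ M ≥ 1, ∀ τ ∈ Ioc 0 T, HasMaxRegEstimate j hμ B M τ := by
  obtain ⟨T, hT, hex, huniq⟩ := hB.exists_unique_solution hj hμ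
  obtain ⟨C, hC, hsol⟩ := exists_solution_le hμ hT hex
  have hμ0 := hμ.1
  refine ⟨T, hT, C + (1 + ‖B‖ * C) + (1 + 2 * C + (1 + ‖B‖ * C) / μ), ?_, fun τ hτ => ?_⟩
  · have : 0 ≤ C + ‖B‖ * C + (1 + 2 * C + (1 + ‖B‖ * C) / μ) := by positivity
    linarith
  -- A right-hand side on `[0,τ]` extends to `[0,T]` without increase of its weighted norm, and
  -- uniqueness on `[0,τ]` identifies the solutions.
  refine ⟨fun f hf x => ?_, fun f x v F hf hv hF t ht =>
    hv.estimate_of_weighted_le hμ hF (fun t ht => ?_) ht⟩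
  · obtain ⟨φ, hφ⟩ := hf.exists_unweight_eqOn hμ.2 hτ.1
    obtain ⟨v, hv⟩ := hex (fun t => unweight μ hτ.1.le t φ) (memBC_unweight hμ.2 hT φ) x
    exact ⟨v, (hv.mono hτ.2).congr hμ.2 hτ.1 hφ fun _ _ => rfl⟩
  · have hF₀ : 0 ≤ F := le_trans (by have := ht.1; positivity) (hF t ht)
    obtain ⟨φ, hφF, hφ⟩ := hf.exists_unweight_norm_le hμ.2 hT hτ.1 hF₀ hF
    rw [min_eq_left hτ.2] at hφ
    obtain ⟨w, hw, hwφ⟩ := hsol φ x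
    have hdiff := (((hw.mono hτ.2).congr hμ.2 hτ.1 hφ fun _ _ => rfl).sub hμ hτ.1 hf hf hv)
    simp only [sub_self] at hdiff
    have hwv : w t - v t = 0 := hdiff.eqOn_zero_of_le hj hμ (hex _ memBC_zero) huniq hτ ht
    rw [← sub_eq_zero.1 hwv]
    exact (hwφ t ⟨ht.1, ht.2.trans hτ.2⟩).trans (by gcongr)

end LinearProblem

section Nonlinearity

variable {E₀ E₁ : Type*} [NormedAddCommGroup E₀] [NormedSpace ℝ E₀]
  [NormedAddCommGroup E₁] [NormedSpace ℝ E₁] {j : E₁ →L[ℝ] E₀} {μ T : ℝ}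
  {V : Set (InterpSpace j μ)} {A : InterpSpace j μ → E₁ →L[ℝ] E₀}
  {F₁ F₂ : InterpSpace j μ → E₀}

theorem eventually_closedBall_subset {X : Type*} [PseudoMetricSpace X] {x : X} {s : Set X}
    (hs : s ∈ 𝓝 x) : ∀ᶠ r in 𝓝[>] (0 : ℝ), Metric.closedBall x r ⊆ s := by
  obtain ⟨ε, hε, h⟩ := Metric.nhds_basis_closedBall.mem_iff.mp hs
  filter_upwards [Ioc_mem_nhdsGT hε] with r hr
  exact (Metric.closedBall_subset_closedBall hr.2).trans h

/-- The norm of `E₁` that measures the value at time `t` of a function in `BC_{1-μ}(J, E₁)` with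
values in `E_μ`: `t ^ (1-μ) |a|_{E₁} + |a|_{E_μ}`. -/
def weightedNorm (hμ : μ ∈ Ioo (0 : ℝ) 1) (j : E₁ →L[ℝ] E₀) (t : ℝ) (a : E₁) : ℝ :=
  t ^ (1 - μ) * ‖a‖ + ‖embed j hμ a‖

/-- The values admitted at time `t` for a function near `x₀` in `E_μ` and small in
`BC_{1-μ}(J, E₁)`, both with radius `r`. -/
def weightedBall (hμ : μ ∈ Ioo (0 : ℝ) 1) (x₀ : InterpSpace j μ) (t r : ℝ) : Set E₁ :=
  {a | embed j hμ a ∈ Metric.closedBall x₀ r ∧ t ^ (1 - μ) * ‖a‖ ≤ r}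

/-- `G : E₁ → E₀` is Lipschitz continuous near `x₀` on short time intervals with constant `η`, if
the weight `t ^ (1-μ)` is put on the values of `G` and differences of arguments are measured by
`weightedNorm`. -/
def IsWeightedLipschitzAt (hμ : μ ∈ Ioo (0 : ℝ) 1) (x₀ : InterpSpace j μ) (η : ℝ)
    (G : E₁ → E₀) : Prop :=
  ∀ᶠ r in 𝓝[>] (0 : ℝ), ∀ t ∈ Ioc 0 r, ∀ a₁ ∈ weightedBall hμ x₀ t r,
    ∀ a₂ ∈ weightedBall hμ x₀ t r, t ^ (1 - μ) * ‖G a₁ - G a₂‖ ≤ η * weightedNorm hμ j t (a₁ - a₂)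

theorem weightedNorm_nonneg (hμ : μ ∈ Ioo (0 : ℝ) 1) {t : ℝ} (ht : 0 ≤ t) (a : E₁) :
    0 ≤ weightedNorm hμ j t a := by
  unfold weightedNorm
  positivity

theorem weightedNorm_sub_le_of_mem_weightedBall {hμ : μ ∈ Ioo (0 : ℝ) 1} {x₀ : InterpSpace j μ}
    {t r : ℝ} (ht : 0 ≤ t) {a₁ a₂ : E₁} (h₁ : a₁ ∈ weightedBall hμ x₀ t r)
    (h₂ : a₂ ∈ weightedBall hμ x₀ t r) : weightedNorm hμ j t (a₁ - a₂) ≤ 4 * r := by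
  have hE₁ : t ^ (1 - μ) * ‖a₁ - a₂‖ ≤ t ^ (1 - μ) * ‖a₁‖ + t ^ (1 - μ) * ‖a₂‖ := by
    rw [← mul_add]
    gcongr
    exact norm_sub_le a₁ a₂
  have hEμ : ‖embed j hμ (a₁ - a₂)‖ ≤ dist (embed j hμ a₁) x₀ + dist (embed j hμ a₂) x₀ := by
    rw [map_sub, ← dist_eq_norm]
    exact dist_triangle_right _ _ _
  have hd₁ := Metric.mem_closedBall.1 h₁.1
  have hd₂ := Metric.mem_closedBall.1 h₂.1
  unfold weightedNorm
  linarith [h₁.2, h₂.2]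

theorem mem_weightedBall_of_le {hμ : μ ∈ Ioo (0 : ℝ) 1} {x₀ : InterpSpace j μ} {s t r : ℝ}
    (hs : 0 ≤ s) (hst : s ≤ t) {a : E₁} (ha : a ∈ weightedBall hμ x₀ t r) :
    a ∈ weightedBall hμ x₀ s r :=
  ⟨ha.1, (mul_le_mul_of_nonneg_right (Real.rpow_le_rpow hs hst (sub_nonneg.2 hμ.2.le))
    (norm_nonneg a)).trans ha.2⟩

theorem IsWeightedLipschitzAt.add {hμ : μ ∈ Ioo (0 : ℝ) 1} {x₀ : InterpSpace j μ} {η₁ η₂ : ℝ}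
    {G₁ G₂ : E₁ → E₀} (h₁ : IsWeightedLipschitzAt hμ x₀ η₁ G₁)
    (h₂ : IsWeightedLipschitzAt hμ x₀ η₂ G₂) :
    IsWeightedLipschitzAt hμ x₀ (η₁ + η₂) fun a => G₁ a + G₂ a := by
  filter_upwards [h₁, h₂] with r hr₁ hr₂ t ht a₁ ha₁ a₂ ha₂
  have ht0 := ht.1
  calc t ^ (1 - μ) * ‖G₁ a₁ + G₂ a₁ - (G₁ a₂ + G₂ a₂)‖
      ≤ t ^ (1 - μ) * (‖G₁ a₁ - G₁ a₂‖ + ‖G₂ a₁ - G₂ a₂‖) := by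
        gcongr
        rw [add_sub_add_comm]
        exact norm_add_le _ _
    _ ≤ (η₁ + η₂) * weightedNorm hμ j t (a₁ - a₂) := by
        rw [mul_add, add_mul]
        exact add_le_add (hr₁ t ht a₁ ha₁ a₂ ha₂) (hr₂ t ht a₁ ha₁ a₂ ha₂)

theorem IsWeightedLipschitzAt.continuousAt {hμ : μ ∈ Ioo (0 : ℝ) 1} {a₀ : E₁} {η : ℝ}
    {G : E₁ → E₀} (h : IsWeightedLipschitzAt hμ (embed j hμ a₀) η G) : ContinuousAt G a₀ := by
  obtain ⟨r, hr, hr0 : 0 < r⟩ := (h.and self_mem_nhdsWithin).exists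
  obtain ⟨t, htr, ht⟩ : ∃ t : ℝ, t ^ (1 - μ) * (‖a₀‖ + 1) < r ∧ t ∈ Ioc 0 r := by
    have hlim := (tendsto_rpow_nhdsGT_zero (sub_pos.2 hμ.2)).mul_const (‖a₀‖ + 1)
    rw [zero_mul] at hlim
    exact ((hlim.eventually (gt_mem_nhds hr0)).and (Ioc_mem_nhdsGT hr0)).exists
  have ht0 := ht.1
  have hmem : ∀ a : E₁, ‖a‖ ≤ ‖a₀‖ + 1 → t ^ (1 - μ) * ‖a‖ ≤ r := fun a ha =>
    (mul_le_mul_of_nonneg_left ha (by positivity)).trans htr.le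
  have ha₀ : a₀ ∈ weightedBall hμ (embed j hμ a₀) t r :=
    ⟨Metric.mem_closedBall_self hr0.le, hmem a₀ (by linarith)⟩
  have hbound : Tendsto (fun a => t ^ (μ - 1) * (η * weightedNorm hμ j t (a - a₀))) (𝓝 a₀)
      (𝓝 0) := by
    have hcont : Continuous fun a =>
        t ^ (μ - 1) * (η * (t ^ (1 - μ) * ‖a - a₀‖ + ‖embed j hμ (a - a₀)‖)) := by fun_prop
    simpa [weightedNorm] using hcont.tendsto a₀
  have hball : ∀ᶠ a in 𝓝 a₀, embed j hμ a ∈ Metric.closedBall (embed j hμ a₀) r :=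
    (embed j hμ).continuous.continuousAt.eventually (Metric.closedBall_mem_nhds _ hr0)
  rw [ContinuousAt, tendsto_iff_norm_sub_tendsto_zero]
  refine squeeze_zero' (Eventually.of_forall fun _ => norm_nonneg _) ?_ hbound
  filter_upwards [hball, Metric.closedBall_mem_nhds a₀ one_pos] with a ha ha'
  have hnorm : ‖a‖ ≤ ‖a₀‖ + 1 :=
    (norm_le_norm_add_norm_sub' a a₀).trans (by gcongr; exact mem_closedBall_iff_norm.1 ha')
  rw [mul_comm]
  exact norm_le_of_weighted ht0 (hr t ht a ⟨ha, hmem a hnorm⟩ a₀ ha₀)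

theorem IsWeightedLipschitzAt.tendsto_weight_mul_norm {hμ : μ ∈ Ioo (0 : ℝ) 1}
    {x : InterpSpace j μ} {η : ℝ} {G : E₁ → E₀} (h : IsWeightedLipschitzAt hμ x η G)
    (hη : 0 ≤ η) {v : ℝ → E₁} (hv : MemBC μ T v)
    (hvx : Tendsto (fun t => embed j hμ (v t)) (𝓝[>] 0) (𝓝 x)) :
    Tendsto (fun t => t ^ (1 - μ) * ‖G (v t)‖) (𝓝[>] 0) (𝓝 0) := by
  rw [Metric.tendsto_nhds]
  intro ε hε
  have hsmall : ∀ᶠ r in 𝓝[>] (0 : ℝ), η * (4 * r) < ε / 2 :=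
    ((Continuous.tendsto' (by fun_prop) 0 0 (by simp)).mono_left nhdsWithin_le_nhds).eventually
      (gt_mem_nhds (half_pos hε))
  obtain ⟨r, hr, hrε, hr0 : 0 < r⟩ := (h.and (hsmall.and self_mem_nhdsWithin)).exists
  have hball : ∀ᶠ t in 𝓝[>] (0 : ℝ), v t ∈ weightedBall hμ x t r ∧ t ∈ Ioc 0 r :=
    ((hvx.eventually (Metric.closedBall_mem_nhds x hr0)).and
      (hv.tendsto_weight_mul_norm.eventually (Iic_mem_nhds hr0))).and (Ioc_mem_nhdsGT hr0)
  obtain ⟨b, hvb, hb⟩ := hball.exists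
  have hGb : ∀ᶠ t in 𝓝[>] (0 : ℝ), t ^ (1 - μ) * ‖G (v b)‖ < ε / 2 := by
    have hlim := (tendsto_rpow_nhdsGT_zero (sub_pos.2 hμ.2)).mul_const ‖G (v b)‖
    rw [zero_mul] at hlim
    exact hlim.eventually (gt_mem_nhds (half_pos hε))
  filter_upwards [hball, hGb, Ioc_mem_nhdsGT hb.1] with t ⟨hvt, ht⟩ hGbt htb
  have ht0 := ht.1
  have hvb' := mem_weightedBall_of_le ht0.le htb.2 hvb
  rw [Real.dist_eq, sub_zero, abs_of_nonneg (by positivity)]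
  calc t ^ (1 - μ) * ‖G (v t)‖
      ≤ t ^ (1 - μ) * ‖G (v b)‖ + t ^ (1 - μ) * ‖G (v t) - G (v b)‖ := by
        rw [← mul_add]
        gcongr
        exact norm_le_norm_add_norm_sub' _ _
    _ ≤ t ^ (1 - μ) * ‖G (v b)‖ + η * (4 * r) :=
        add_le_add_right ((hr t ht _ hvt _ hvb').trans (mul_le_mul_of_nonneg_left
          (weightedNorm_sub_le_of_mem_weightedBall ht0.le hvt hvb') hη)) _
    _ < ε := by linarith

theorem eventually_rpow_mul_interpNorm_rpow_le (hμ : μ ∈ Ioo (0 : ℝ) 1) {β : ℝ}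
    (hβ : β ∈ Ioo μ 1) {b ρ : ℝ} (hb : b < 1) (hρ : 0 ≤ ρ) (hcrit : ρ * (β - μ) ≤ 1 - b) (R : ℝ)
    {η : ℝ} (hη : 0 < η) :
    ∀ᶠ r in 𝓝[>] (0 : ℝ), ∀ t ∈ Ioc 0 r, ∀ a : E₁, ‖embed j hμ a‖ ≤ R →
      t ^ (1 - μ) * ‖a‖ ≤ r → t ^ (1 - b) * interpNorm j β (j a) ^ ρ ≤ η := by
  rcases hρ.eq_or_lt with rfl | hρ
  · have hsmall : ∀ᶠ t in 𝓝[>] (0 : ℝ), t ^ (1 - b) ≤ η :=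
      (tendsto_rpow_nhdsGT_zero (sub_pos.2 hb)).eventually (Iic_mem_nhds hη)
    filter_upwards [eventually_forall_mem_Ioc hsmall] with r hr t ht a _ _
    rw [Real.rpow_zero, mul_one]
    exact hr t ht
  · filter_upwards [eventually_rpow_mul_interpNorm_apply_le (j := j) hμ hβ R
      (Real.rpow_pos_of_pos hη ρ⁻¹), Ioc_mem_nhdsGT one_pos] with r hr hr1 t ht a haR har
    have ht0 := ht.1
    have hN := interpNorm_nonneg j β (j a)
    have hexp : t ^ (1 - b) ≤ (t ^ (β - μ)) ^ ρ := by
      rw [← Real.rpow_mul ht0.le]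
      exact Real.rpow_le_rpow_of_exponent_ge ht0 (ht.2.trans hr1.2) (by linarith)
    calc t ^ (1 - b) * interpNorm j β (j a) ^ ρ
        ≤ (t ^ (β - μ)) ^ ρ * interpNorm j β (j a) ^ ρ := by gcongr
      _ = (t ^ (β - μ) * interpNorm j β (j a)) ^ ρ :=
        (Real.mul_rpow (by positivity) hN).symm
      _ ≤ (η ^ ρ⁻¹) ^ ρ := by
        gcongr
        exact hr t ht0 a haR har
      _ = η := Real.rpow_inv_rpow hη.le hρ.ne'

theorem eventually_rpow_mul_growth_le (hμ : μ ∈ Ioo (0 : ℝ) 1) {β : ℝ} (hβ : β ∈ Ioo μ 1)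
    {b ρ : ℝ} (hb : b < 1) (hρ : 0 ≤ ρ) (hcrit : ρ * (β - μ) ≤ 1 - b) (R : ℝ) {η : ℝ}
    (hη : 0 < η) :
    ∀ᶠ r in 𝓝[>] (0 : ℝ), ∀ t ∈ Ioc 0 r, ∀ a₁ a₂ : E₁,
      ‖embed j hμ a₁‖ ≤ R → ‖embed j hμ a₂‖ ≤ R →
      t ^ (1 - μ) * ‖a₁‖ ≤ r → t ^ (1 - μ) * ‖a₂‖ ≤ r →
      t ^ (1 - b) * (1 + interpNorm j β (j a₁) ^ ρ + interpNorm j β (j a₂) ^ ρ) ≤ η := by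
  have hη3 : 0 < η / 3 := by positivity
  have hsmall : ∀ᶠ t in 𝓝[>] (0 : ℝ), t ^ (1 - b) ≤ η / 3 :=
    (tendsto_rpow_nhdsGT_zero (sub_pos.2 hb)).eventually (Iic_mem_nhds hη3)
  filter_upwards [eventually_forall_mem_Ioc hsmall,
    eventually_rpow_mul_interpNorm_rpow_le (j := j) hμ hβ hb hρ hcrit R hη3]
    with r hr hgrowth t ht a₁ a₂ h₁R h₂R h₁r h₂r
  linarith [hr t ht, hgrowth t ht a₁ h₁R h₁r, hgrowth t ht a₂ h₂R h₂r]

theorem weight_mul_growth_mul_interpNorm_le (hμ : μ ∈ Ioo (0 : ℝ) 1) {b : ℝ} (hb : b ∈ Ico μ 1)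
    {t : ℝ} (ht : 0 < t) {L η : ℝ} (hL : 0 ≤ L) (hLη : t ^ (1 - b) * L ≤ η) (a : E₁) :
    t ^ (1 - μ) * (L * interpNorm j b (j a)) ≤ η * weightedNorm hμ j t a := by
  have hsplit : t ^ (1 - μ) * t ^ (μ - b) = t ^ (1 - b) := by
    rw [← Real.rpow_add ht, sub_add_sub_cancel]
  calc t ^ (1 - μ) * (L * interpNorm j b (j a))
      ≤ t ^ (1 - μ) * (L * (t ^ (μ - b) * weightedNorm hμ j t a)) := by
        gcongr
        exact interpNorm_apply_le hμ hb a ht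
    _ = t ^ (1 - b) * L * weightedNorm hμ j t a := by rw [← hsplit]; ring
    _ ≤ η * weightedNorm hμ j t a :=
        mul_le_mul_of_nonneg_right hLη (weightedNorm_nonneg hμ ht.le a)

theorem sum_const_div_mul_le {m : ℕ} {C η D : ℝ} (hC : 0 < C) (hη : 0 ≤ η) (hD : 0 ≤ D) :
    C * ∑ _i : Fin m, η / (C * (m + 1)) * D ≤ η * D := by
  rw [Finset.sum_const, Finset.card_univ, Fintype.card_fin, nsmul_eq_mul]
  have hm : (m : ℝ) / (m + 1) ≤ 1 := by
    rw [div_le_one (by positivity)]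
    linarith
  calc C * (m * (η / (C * (m + 1)) * D)) = η * D * (m / (m + 1)) := by field_simp
    _ ≤ η * D := mul_le_of_le_one_right (by positivity) hm

theorem StructuralHypothesis.isWeightedLipschitzAt (hμ : μ ∈ Ioo (0 : ℝ) 1) (hV : IsOpen V)
    (h₂ : StructuralHypothesis j μ V F₂) {x₀ : InterpSpace j μ} (hx₀ : x₀ ∈ V) {η : ℝ}
    (hη : 0 < η) : IsWeightedLipschitzAt hμ x₀ η fun a => F₂ (embed j hμ a) := by
  obtain ⟨β, hβ, m, b, ρ, hbρ, h⟩ := h₂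
  obtain ⟨C, hC, hF⟩ := h x₀ hx₀ 1 one_pos
  have hb : ∀ i, b i ∈ Ico μ 1 := fun i => ⟨(hbρ i).1.1, (hbρ i).1.2.trans_lt hβ.2⟩
  have hcrit : ∀ i, ρ i * (β - μ) ≤ 1 - b i := fun i => by
    have := (div_le_one (sub_pos.2 hμ.2)).1 (hbρ i).2.2
    linarith
  have hη' : 0 < η / (C * (m + 1)) := by positivity
  have hmem : ∀ a : E₁, InterpSpace.incl (embed j hμ a) ∈ interpSubmodule j β := fun a => by
    rw [incl_embed]
    exact interpMem_apply ⟨hμ.1.trans hβ.1, hβ.2⟩ a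
  filter_upwards [eventually_all.2 fun i => eventually_rpow_mul_growth_le (j := j) hμ hβ (hb i).2
      (hbρ i).2.1 (hcrit i) (‖x₀‖ + 1) hη', Ioc_mem_nhdsGT one_pos,
    eventually_closedBall_subset (hV.mem_nhds hx₀)] with r hgrowth hr1 hball t ht a₁ h₁ a₂ h₂
  have ht0 := ht.1
  have hnorm : ∀ a ∈ weightedBall hμ x₀ t r, ‖embed j hμ a‖ ≤ ‖x₀‖ + 1 := fun a ha =>
    (norm_le_norm_add_norm_sub' _ x₀).trans
      (by gcongr; exact (mem_closedBall_iff_norm.1 ha.1).trans hr1.2)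
  have hsub := Metric.closedBall_subset_closedBall (x := x₀) hr1.2
  have hF₁₂ := hF _ _ (hsub h₁.1) (hball h₁.1) (hmem a₁) (hsub h₂.1) (hball h₂.1) (hmem a₂)
  simp only [incl_embed, ← map_sub] at hF₁₂
  calc t ^ (1 - μ) * ‖F₂ (embed j hμ a₁) - F₂ (embed j hμ a₂)‖
      ≤ t ^ (1 - μ) * (C * ∑ i, (1 + interpNorm j β (j a₁) ^ ρ i + interpNorm j β (j a₂) ^ ρ i)
          * interpNorm j (b i) (j (a₁ - a₂))) := by gcongr
    _ = C * ∑ i, t ^ (1 - μ) * ((1 + interpNorm j β (j a₁) ^ ρ i + interpNorm j β (j a₂) ^ ρ i)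
          * interpNorm j (b i) (j (a₁ - a₂))) := by rw [mul_left_comm, Finset.mul_sum]
    _ ≤ C * ∑ _i : Fin m, η / (C * (m + 1)) * weightedNorm hμ j t (a₁ - a₂) := by
      refine mul_le_mul_of_nonneg_left (Finset.sum_le_sum fun i _ => ?_) hC.le
      have hN₁ := interpNorm_nonneg j β (j a₁)
      have hN₂ := interpNorm_nonneg j β (j a₂)
      exact weight_mul_growth_mul_interpNorm_le hμ (hb i) ht0 (by positivity)
        (hgrowth i t ht a₁ a₂ (hnorm a₁ h₁) (hnorm a₂ h₂) h₁.2 h₂.2) _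
    _ ≤ η * weightedNorm hμ j t (a₁ - a₂) :=
      sum_const_div_mul_le hC hη.le (weightedNorm_nonneg hμ ht0.le _)

theorem isWeightedLipschitzAt_comp_embed (hμ : μ ∈ Ioo (0 : ℝ) 1) {x₀ : InterpSpace j μ}
    {F : InterpSpace j μ → E₀} {K : NNReal} {s : Set (InterpSpace j μ)} (hs : s ∈ 𝓝 x₀)
    (hF : LipschitzOnWith K F s) {η : ℝ} (hη : 0 < η) :
    IsWeightedLipschitzAt hμ x₀ η fun a => F (embed j hμ a) := by
  have hsmall : ∀ᶠ t in 𝓝[>] (0 : ℝ), t ^ (1 - μ) * K ≤ η := by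
    have hlim := (tendsto_rpow_nhdsGT_zero (sub_pos.2 hμ.2)).mul_const (K : ℝ)
    rw [zero_mul] at hlim
    exact hlim.eventually (Iic_mem_nhds hη)
  filter_upwards [eventually_forall_mem_Ioc hsmall, eventually_closedBall_subset hs]
    with r hr hball t ht a₁ h₁ a₂ h₂
  have ht0 := ht.1
  calc t ^ (1 - μ) * ‖F (embed j hμ a₁) - F (embed j hμ a₂)‖
      ≤ t ^ (1 - μ) * (K * ‖embed j hμ (a₁ - a₂)‖) := by
        gcongr
        rw [map_sub]
        exact hF.norm_sub_le (hball h₁.1) (hball h₂.1)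
    _ = t ^ (1 - μ) * K * ‖embed j hμ (a₁ - a₂)‖ := by ring
    _ ≤ η * weightedNorm hμ j t (a₁ - a₂) :=
        mul_le_mul (hr t ht) (le_add_of_nonneg_left (by positivity)) (norm_nonneg _) hη.le

-- Split the difference of the values as
-- `(A(x₀) - A(a₁)) (a₁ - a₂) + (A(a₂) - A(a₁)) a₂`: the first summand is small because `a₁` is
-- near `x₀` in `E_μ`, the second one because `t ^ (1-μ) a₂` is small in `E₁`.
theorem isWeightedLipschitzAt_sub_apply (hμ : μ ∈ Ioo (0 : ℝ) 1) {x₀ : InterpSpace j μ}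
    {K : NNReal} {s : Set (InterpSpace j μ)} (hs : s ∈ 𝓝 x₀) (hA : LipschitzOnWith K A s) {η : ℝ}
    (hη : 0 < η) : IsWeightedLipschitzAt hμ x₀ η fun a => (A x₀ - A (embed j hμ a)) a := by
  have hsmall : ∀ᶠ r in 𝓝[>] (0 : ℝ), K * r ≤ η :=
    ((Continuous.tendsto' (by fun_prop) 0 0 (mul_zero _)).mono_left
      nhdsWithin_le_nhds).eventually (Iic_mem_nhds hη)
  filter_upwards [hsmall, eventually_closedBall_subset hs] with r hr hball t ht a₁ h₁ a₂ h₂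
  have ht0 := ht.1
  have hx₀ : x₀ ∈ s := hball (Metric.mem_closedBall_self (ht.1.le.trans ht.2))
  have hfirst : t ^ (1 - μ) * ‖(A x₀ - A (embed j hμ a₁)) (a₁ - a₂)‖
      ≤ K * r * (t ^ (1 - μ) * ‖a₁ - a₂‖) :=
    calc _ ≤ t ^ (1 - μ) * (K * r * ‖a₁ - a₂‖) := by
          refine mul_le_mul_of_nonneg_left (ContinuousLinearMap.le_of_opNorm_le _ ?_ _)
            (by positivity)
          refine (hA.norm_sub_le hx₀ (hball h₁.1)).trans (mul_le_mul_of_nonneg_left ?_ K.2)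
          rw [norm_sub_rev]
          exact mem_closedBall_iff_norm.1 h₁.1
      _ = _ := by ring
  have hsecond : t ^ (1 - μ) * ‖(A (embed j hμ a₂) - A (embed j hμ a₁)) a₂‖
      ≤ K * r * ‖embed j hμ (a₁ - a₂)‖ :=
    calc _ ≤ t ^ (1 - μ) * (K * ‖embed j hμ (a₁ - a₂)‖ * ‖a₂‖) := by
          refine mul_le_mul_of_nonneg_left (ContinuousLinearMap.le_of_opNorm_le _ ?_ _)
            (by positivity)
          rw [map_sub, norm_sub_rev (embed j hμ a₁)]
          exact hA.norm_sub_le (hball h₂.1) (hball h₁.1)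
      _ = K * ‖embed j hμ (a₁ - a₂)‖ * (t ^ (1 - μ) * ‖a₂‖) := by ring
      _ ≤ K * ‖embed j hμ (a₁ - a₂)‖ * r := by gcongr; exact h₂.2
      _ = _ := by ring
  have hsplit : (A x₀ - A (embed j hμ a₁)) a₁ - (A x₀ - A (embed j hμ a₂)) a₂
      = (A x₀ - A (embed j hμ a₁)) (a₁ - a₂) + (A (embed j hμ a₂) - A (embed j hμ a₁)) a₂ := by
    simp only [sub_apply, map_sub]
    abel
  calc t ^ (1 - μ) * ‖(A x₀ - A (embed j hμ a₁)) a₁ - (A x₀ - A (embed j hμ a₂)) a₂‖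
      ≤ t ^ (1 - μ) * ‖(A x₀ - A (embed j hμ a₁)) (a₁ - a₂)‖
          + t ^ (1 - μ) * ‖(A (embed j hμ a₂) - A (embed j hμ a₁)) a₂‖ := by
        rw [hsplit, ← mul_add]
        gcongr
        exact norm_add_le _ _
    _ ≤ K * r * weightedNorm hμ j t (a₁ - a₂) := by
        rw [weightedNorm, mul_add]
        exact add_le_add hfirst hsecond
    _ ≤ η * weightedNorm hμ j t (a₁ - a₂) :=
        mul_le_mul_of_nonneg_right hr (weightedNorm_nonneg hμ ht0.le _)

/-- The vector field `a ↦ F₁(a) + F₂(a) - A(a) a` of the quasilinear problem on `E₁`. -/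
def vectorField (hμ : μ ∈ Ioo (0 : ℝ) 1) (A : InterpSpace j μ → E₁ →L[ℝ] E₀)
    (F₁ F₂ : InterpSpace j μ → E₀) (a : E₁) : E₀ :=
  F₁ (embed j hμ a) + F₂ (embed j hμ a) - A (embed j hμ a) a

theorem isWeightedLipschitzAt_apply_add_vectorField (hμ : μ ∈ Ioo (0 : ℝ) 1) (hV : IsOpen V)
    (h₁ : LipschitzHypothesis j μ V A F₁) (h₂ : StructuralHypothesis j μ V F₂)
    {x₀ : InterpSpace j μ} (hx₀ : x₀ ∈ V) {η : ℝ} (hη : 0 < η) :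
    IsWeightedLipschitzAt hμ x₀ η fun a => A x₀ a + vectorField hμ A F₁ F₂ a := by
  obtain ⟨K, s, hs, hK⟩ := h₁.lipschitz hx₀
  rw [hV.nhdsWithin_eq hx₀] at hs
  have hη3 : 0 < η / 3 := by positivity
  have h := ((isWeightedLipschitzAt_sub_apply hμ hs
      (LipschitzWith.prod_fst.comp_lipschitzOnWith hK) hη3).add
    (isWeightedLipschitzAt_comp_embed hμ hs
      (LipschitzWith.prod_snd.comp_lipschitzOnWith hK) hη3)).add
    (h₂.isWeightedLipschitzAt hμ hV hx₀ hη3)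
  convert h using 1
  · ring
  · funext a
    simp only [vectorField, Function.comp_apply, sub_apply]
    abel

theorem continuousAt_vectorField (hμ : μ ∈ Ioo (0 : ℝ) 1) (hV : IsOpen V)
    (h₁ : LipschitzHypothesis j μ V A F₁) (h₂ : StructuralHypothesis j μ V F₂) {a : E₁}
    (ha : embed j hμ a ∈ V) : ContinuousAt (vectorField hμ A F₁ F₂) a := by
  have h := (isWeightedLipschitzAt_apply_add_vectorField hμ hV h₁ h₂ ha one_pos).continuousAt.sub
    ((A (embed j hμ a)).continuous.continuousAt (x := a))
  exact h.congr (Eventually.of_forall fun a => add_sub_cancel_left _ _)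

theorem memBC_vectorField (hμ : μ ∈ Ioo (0 : ℝ) 1) (hV : IsOpen V)
    (h₁ : LipschitzHypothesis j μ V A F₁) (h₂ : StructuralHypothesis j μ V F₂) (hT : 0 < T)
    {x : InterpSpace j μ} (hx : x ∈ V) {v : ℝ → E₁} (hv : MemBC μ T v)
    (hvV : ∀ t ∈ Ioc 0 T, embed j hμ (v t) ∈ V)
    (hvx : Tendsto (fun t => embed j hμ (v t)) (𝓝[>] 0) (𝓝 x)) :
    MemBC μ T fun t => vectorField hμ A F₁ F₂ (v t) := by
  have hcont : ContinuousOn (fun t => A x (v t) + vectorField hμ A F₁ F₂ (v t)) (Ioc 0 T) :=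
    fun t ht => ((A x).continuous.continuousAt.add
      (continuousAt_vectorField hμ hV h₁ h₂ (hvV t ht))).comp_continuousWithinAt
        (hv.continuousOn t ht)
  have hG := memBC_of_tendsto hμ.2 hT hcont
    ((isWeightedLipschitzAt_apply_add_vectorField hμ hV h₁ h₂ hx one_pos).tendsto_weight_mul_norm
      zero_le_one hv hvx)
  exact (hG.sub hμ.2 hT (hv.clm hμ.2 hT (A x))).congr hμ.2 hT fun t _ =>
    (add_sub_cancel_left _ _).symm

end Nonlinearity

section LocalTheory

variable {E₀ E₁ : Type*} [NormedAddCommGroup E₀] [NormedSpace ℝ E₀]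
  [NormedAddCommGroup E₁] [NormedSpace ℝ E₁] {j : E₁ →L[ℝ] E₀} {μ T : ℝ}
  {V : Set (InterpSpace j μ)} {A : InterpSpace j μ → E₁ →L[ℝ] E₀}
  {F₁ F₂ : InterpSpace j μ → E₀} {hμ : μ ∈ Ioo (0 : ℝ) 1}

/-- The integrated form of the quasilinear problem on `[0,T]` with initial value `x`, for the
`E₁`-valued representative `v` of its solution. -/
structure IsMildSolution (hμ : μ ∈ Ioo (0 : ℝ) 1) (V : Set (InterpSpace j μ))
    (A : InterpSpace j μ → E₁ →L[ℝ] E₀) (F₁ F₂ : InterpSpace j μ → E₀) (T : ℝ)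
    (x : InterpSpace j μ) (v : ℝ → E₁) : Prop where
  memBC : MemBC μ T v
  memBC_vectorField : MemBC μ T fun t => vectorField hμ A F₁ F₂ (v t)
  mem : ∀ t ∈ Ioc 0 T, embed j hμ (v t) ∈ V
  eqn : ∀ t ∈ Ioc 0 T,
    j (v t) = InterpSpace.incl x + ∫ s in (0 : ℝ)..t, vectorField hμ A F₁ F₂ (v s)

namespace IsMildSolution

variable {x : InterpSpace j μ} {v w : ℝ → E₁}

theorem mono {S : ℝ} (h : IsMildSolution hμ V A F₁ F₂ T x v) (hS : S ≤ T) :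
    IsMildSolution hμ V A F₁ F₂ S x v :=
  ⟨h.memBC.mono hS, h.memBC_vectorField.mono hS,
    fun t ht => h.mem t (Ioc_subset_Ioc_right hS ht),
    fun t ht => h.eqn t (Ioc_subset_Ioc_right hS ht)⟩

theorem tendsto_embed (hT : 0 < T) (h : IsMildSolution hμ V A F₁ F₂ T x v) :
    Tendsto (fun t => embed j hμ (v t)) (𝓝[>] 0) (𝓝 x) :=
  QuasilinearSemiflow.tendsto_embed hμ hT h.memBC h.memBC_vectorField h.eqn

theorem eventually_mem_weightedBall (hT : 0 < T) (h : IsMildSolution hμ V A F₁ F₂ T x v) {r : ℝ}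
    (hr : 0 < r) : ∀ᶠ t in 𝓝[>] 0, v t ∈ weightedBall hμ x t r :=
  ((h.tendsto_embed hT).eventually (Metric.closedBall_mem_nhds x hr)).and
    (h.memBC.tendsto_weight_mul_norm.eventually (Iic_mem_nhds hr))

theorem isLinearSolution (B : E₁ →L[ℝ] E₀) (h : IsMildSolution hμ V A F₁ F₂ T x v) :
    IsLinearSolution j μ B T (fun t => B (v t) + vectorField hμ A F₁ F₂ (v t)) x v :=
  ⟨h.memBC, fun t ht => by simpa only [add_sub_cancel_left] using h.eqn t ht⟩

theorem memBC_apply_add_vectorField (B : E₁ →L[ℝ] E₀) (hT : 0 < T)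
    (h : IsMildSolution hμ V A F₁ F₂ T x v) :
    MemBC μ T fun t => B (v t) + vectorField hμ A F₁ F₂ (v t) :=
  (h.memBC.clm hμ.2 hT B).add hμ.2 hT h.memBC_vectorField

theorem shift {a : ℝ} (ha : a ∈ Ioo 0 T) (h : IsMildSolution hμ V A F₁ F₂ T x v) :
    IsMildSolution hμ V A F₁ F₂ (T - a) (embed j hμ (v a)) fun t => v (a + t) := by
  have hmem : ∀ t ∈ Ioc 0 (T - a), a + t ∈ Ioc 0 T := fun t ht =>
    ⟨by linarith [ht.1, ha.1], by linarith [ht.2]⟩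
  have haT : a ∈ Icc 0 T := Ioo_subset_Icc_self ha
  refine ⟨h.memBC.shift hμ.2 ha, h.memBC_vectorField.shift hμ.2 ha,
    fun t ht => h.mem _ (hmem t ht), fun t ht => ?_⟩
  rw [h.eqn _ (hmem t ht), incl_embed, h.eqn a (Ioo_subset_Ioc_self ha), add_assoc,
    intervalIntegral.integral_comp_add_left (fun s => vectorField hμ A F₁ F₂ (v s)), add_zero,
    intervalIntegral.integral_add_adjacent_intervals
      (h.memBC_vectorField.intervalIntegrable_zero hμ.1 haT)
      (h.memBC_vectorField.intervalIntegrable hμ.1 haT (Ioc_subset_Icc_self (hmem t ht)))]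

theorem concat {a b d : ℝ} (ha : 0 < a) (hab : a < b) (hbd : b ≤ a + d)
    (hv : IsMildSolution hμ V A F₁ F₂ b x v)
    (hw : IsMildSolution hμ V A F₁ F₂ d (embed j hμ (v a)) w)
    (hvw : ∀ t ∈ Ioc 0 (b - a), w t = v (a + t)) :
    IsMildSolution hμ V A F₁ F₂ (a + d) x (concat a v w) := by
  have hsub : ∀ t ∈ Ioc 0 (a + d), a < t → t - a ∈ Ioc 0 d := fun t ht hat =>
    ⟨sub_pos.2 hat, by linarith [ht.2]⟩
  have hleft : ∀ t ∈ Ioc 0 (a + d), t ≤ a → t ∈ Ioc 0 b := fun t ht hta =>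
    ⟨ht.1, hta.trans hab.le⟩
  have hvectorField := hv.memBC_vectorField.concat hμ.2 ha hab hbd hw.memBC_vectorField
    fun t ht => congrArg (vectorField hμ A F₁ F₂) (hvw t ht)
  refine ⟨hv.memBC.concat hμ.2 ha hab hbd hw.memBC hvw, ?_, fun t ht => ?_, fun t ht => ?_⟩
  · simpa only [apply_concat (vectorField hμ A F₁ F₂)] using hvectorField
  · rcases le_or_gt t a with hta | hat
    · exact concat_of_le (z := v) hta ▸ hv.mem t (hleft t ht hta)
    · exact concat_of_lt (v := w) hat ▸ hw.mem _ (hsub t ht hat)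
  · simp only [apply_concat (vectorField hμ A F₁ F₂)]
    rcases le_or_gt t a with hta | hat
    · rw [concat_of_le hta, integral_concat_of_le ht.1.le hta, hv.eqn t (hleft t ht hta)]
    · rw [concat_of_lt hat, integral_concat ha.le hat.le
        (hv.memBC_vectorField.intervalIntegrable_zero hμ.1 ⟨ha.le, hab.le⟩)
        (hw.memBC_vectorField.intervalIntegrable_zero hμ.1 (Ioc_subset_Icc_self (hsub t ht hat))),
        hw.eqn _ (hsub t ht hat), incl_embed, hv.eqn a ⟨ha, hab.le⟩, add_assoc]

end IsMildSolution

namespace HasMaxRegEstimate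

variable {B : E₁ →L[ℝ] E₀} {M : ℝ} {f g : ℝ → E₀} {x y : InterpSpace j μ} {v w : ℝ → E₁}

theorem sub_le (hB : HasMaxRegEstimate j hμ B M T) (hT : 0 < T) (hf : MemBC μ T f)
    (hg : MemBC μ T g) (hv : IsLinearSolution j μ B T f x v) (hw : IsLinearSolution j μ B T g y w)
    {F : ℝ} (hF : ∀ t ∈ Ioc 0 T, t ^ (1 - μ) * ‖f t - g t‖ ≤ F) {t : ℝ} (ht : t ∈ Ioc 0 T) :
    weightedNorm hμ j t (v t - w t) + t ^ (1 - μ) * ‖f t - g t - B (v t - w t)‖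
      ≤ M * (F + ‖x - y‖) := by
  refine Eq.trans_le ?_ (hB.estimate _ _ _ F (hf.sub hμ.2 hT hg) (hv.sub hμ hT hf hg hw) hF t ht)
  exact add_right_comm _ _ _

theorem weightedNorm_sub_le (hB : HasMaxRegEstimate j hμ B M T) (hT : 0 < T) (hf : MemBC μ T f)
    (hg : MemBC μ T g) (hv : IsLinearSolution j μ B T f x v) (hw : IsLinearSolution j μ B T g y w)
    {F : ℝ} (hF : ∀ t ∈ Ioc 0 T, t ^ (1 - μ) * ‖f t - g t‖ ≤ F) {t : ℝ} (ht : t ∈ Ioc 0 T) :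
    weightedNorm hμ j t (v t - w t) ≤ M * (F + ‖x - y‖) :=
  (le_add_of_nonneg_right (by have := ht.1; positivity)).trans (hB.sub_le hT hf hg hv hw hF ht)

theorem eqOn_of_weighted_sub_le (hB : HasMaxRegEstimate j hμ B M T) (hT : 0 < T)
    (hf : MemBC μ T f) (hg : MemBC μ T g) (hv : IsLinearSolution j μ B T f x v)
    (hw : IsLinearSolution j μ B T g x w) {η : ℝ} (hη : 0 ≤ η) (hηM : η * M < 1)
    (hfg : ∀ t ∈ Ioc 0 T, t ^ (1 - μ) * ‖f t - g t‖ ≤ η * weightedNorm hμ j t (v t - w t)) :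
    EqOn v w (Ioc 0 T) := by
  obtain ⟨φ, hφ : ∀ t ∈ Ioc 0 T, unweight μ hT.le t φ = f t - g t⟩ :=
    (hf.sub hμ.2 hT hg).exists_unweight_eqOn hμ.2 hT
  have hφfg : ∀ t ∈ Ioc 0 T, t ^ (1 - μ) * ‖f t - g t‖ ≤ ‖φ‖ := fun t ht => by
    rw [← hφ t ht]
    exact weight_mul_norm_unweight_le φ ht.1
  have hvw : ∀ t ∈ Ioc 0 T, weightedNorm hμ j t (v t - w t) ≤ M * ‖φ‖ := fun t ht => by
    simpa using hB.weightedNorm_sub_le hT hf hg hv hw hφfg ht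
  have hM : 0 ≤ M * ‖φ‖ :=
    (weightedNorm_nonneg hμ hT.le _).trans (hvw T (right_mem_Ioc.2 hT))
  have hφη : ‖φ‖ ≤ η * (M * ‖φ‖) :=
    norm_le_of_weight_mul_norm_unweight_le (μ := μ) (by positivity) fun t ht => by
      rw [hφ t ht]
      exact (hfg t ht).trans (mul_le_mul_of_nonneg_left (hvw t ht) hη)
  have hφ₀ : ‖φ‖ = 0 := by nlinarith [norm_nonneg φ]
  intro t ht
  have hE₁ : t ^ (1 - μ) * ‖v t - w t‖ ≤ 0 :=
    (le_add_of_nonneg_right (norm_nonneg _)).trans ((hvw t ht).trans (by rw [hφ₀, mul_zero]))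
  have hle := norm_le_of_weighted ht.1 hE₁
  rw [zero_mul] at hle
  exact sub_eq_zero.1 (norm_le_zero_iff.1 hle)

end HasMaxRegEstimate

theorem IsLinearSolution.isMildSolution {B : E₁ →L[ℝ] E₀} {x : InterpSpace j μ} {v : ℝ → E₁}
    (hT : 0 < T)
    (hv : IsLinearSolution j μ B T (fun t => B (v t) + vectorField hμ A F₁ F₂ (v t)) x v)
    (hf : MemBC μ T fun t => B (v t) + vectorField hμ A F₁ F₂ (v t))
    (hvV : ∀ t ∈ Ioc 0 T, embed j hμ (v t) ∈ V) : IsMildSolution hμ V A F₁ F₂ T x v where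
  memBC := hv.memBC
  memBC_vectorField := by
    simpa only [add_sub_cancel_left] using hv.memBC_sub_apply hμ.2 hT hf
  mem := hvV
  eqn t ht := by simpa only [add_sub_cancel_left] using hv.eqn t ht

variable [CompleteSpace E₀] [CompleteSpace E₁]

theorem IsMildSolution.exists_eqOn (hj : Function.Injective j) (hV : IsOpen V)
    (h₁ : LipschitzHypothesis j μ V A F₁) (h₂ : StructuralHypothesis j μ V F₂)
    {x : InterpSpace j μ} (hx : x ∈ V) (hT : 0 < T) {v w : ℝ → E₁}
    (hv : IsMildSolution hμ V A F₁ F₂ T x v) (hw : IsMildSolution hμ V A F₁ F₂ T x w) :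
    ∃ δ ∈ Ioc 0 T, EqOn v w (Ioc 0 δ) := by
  obtain ⟨T₀, hT₀, M, hM, hB⟩ := (h₁.maxReg x hx).exists_hasMaxRegEstimate hj hμ
  have : 0 < M := one_pos.trans_le hM
  have hη : 0 < 1 / (2 * M) := by positivity
  have hηM : 1 / (2 * M) * M < 1 := by
    rw [one_div_mul_eq_div, div_lt_one (by positivity)]
    linarith
  obtain ⟨r, hr, hr₀ : 0 < r⟩ :=
    ((isWeightedLipschitzAt_apply_add_vectorField hμ hV h₁ h₂ hx hη).and self_mem_nhdsWithin).exists
  obtain ⟨δ, hδ, ⟨hδT₀, hδT⟩, hδr⟩ := ((eventually_forall_mem_Ioc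
    ((hv.eventually_mem_weightedBall hT hr₀).and (hw.eventually_mem_weightedBall hT hr₀))).and
    (inter_mem (inter_mem (Ioc_mem_nhdsGT hT₀) (Ioc_mem_nhdsGT hT)) (Ioc_mem_nhdsGT hr₀))).exists
  have hvδ := hv.mono hδT.2
  have hwδ := hw.mono hδT.2
  exact ⟨δ, hδT, (hB δ hδT₀).eqOn_of_weighted_sub_le hδT.1
    (hvδ.memBC_apply_add_vectorField (A x) hδT.1) (hwδ.memBC_apply_add_vectorField (A x) hδT.1)
    (hvδ.isLinearSolution (A x)) (hwδ.isLinearSolution (A x)) hη.le hηM fun t ht =>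
      hr t ⟨ht.1, ht.2.trans hδr.2⟩ _ (hδ t ht).1 _ (hδ t ht).2⟩

end LocalTheory

section LocalExistence

theorem exists_fixedPoint_dist_le {P X : Type*} [PseudoMetricSpace P] [MetricSpace X] {K : NNReal}
    (hK : K < 1) {s : Set P} {S : Set X} (hS : IsComplete S) (hne : S.Nonempty) {Φ : P → X → X}
    (hΦ : ∀ p ∈ s, MapsTo (Φ p) S S)
    (hlip : ∀ p ∈ s, ∀ q ∈ s, ∀ a ∈ S, ∀ b ∈ S,
      dist (Φ p a) (Φ q b) ≤ K * (dist a b + dist p q)) :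
    ∃ Ψ : P → X, (∀ p ∈ s, Ψ p ∈ S ∧ Φ p (Ψ p) = Ψ p) ∧
      ∀ p ∈ s, ∀ q ∈ s, dist (Ψ p) (Ψ q) ≤ K / (1 - K) * dist p q := by
  obtain ⟨a₀, ha₀⟩ := hne
  have hfix : ∀ p ∈ s, ∃ a, a ∈ S ∧ Φ p a = a := fun p hp => by
    have hcontr : ContractingWith K ((hΦ p hp).restrict (Φ p) S S) :=
      ⟨hK, LipschitzWith.of_dist_le_mul fun a b =>
        (hlip p hp p hp a a.2 b b.2).trans_eq (by rw [dist_self, add_zero]; rfl)⟩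
    obtain ⟨a, ha, hfix, -⟩ := hcontr.exists_fixedPoint' hS (hΦ p hp) ha₀ (edist_ne_top _ _)
    exact ⟨a, ha, hfix⟩
  have : Nonempty X := ⟨a₀⟩
  choose! Ψ hΨ using hfix
  refine ⟨Ψ, hΨ, fun p hp q hq => ?_⟩
  have h := hlip p hp q hq _ (hΨ p hp).1 _ (hΨ q hq).1
  rw [(hΨ p hp).2, (hΨ q hq).2] at h
  rw [div_mul_eq_mul_div, le_div_iff₀ (sub_pos.2 (NNReal.coe_lt_one.2 hK))]
  linarith

theorem exists_unweight_fixedPoint {P E : Type*} [PseudoMetricSpace P] [NormedAddCommGroup E]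
    [NormedSpace ℝ E] [CompleteSpace E] {μ T ρ : ℝ} (hμ : μ < 1) (hT : 0 < T) (hρ : 0 ≤ ρ)
    {K : NNReal} (hK : K < 1) {s : Set P} {H : P → vanishingAtZero E hT.le → ℝ → E}
    (hBC : ∀ p ∈ s, ∀ φ ∈ Metric.closedBall 0 ρ, MemBC μ T (H p φ))
    (hnorm : ∀ p ∈ s, ∀ φ ∈ Metric.closedBall 0 ρ, ∀ t ∈ Ioc 0 T, t ^ (1 - μ) * ‖H p φ t‖ ≤ ρ)
    (hlip : ∀ p ∈ s, ∀ q ∈ s, ∀ φ ∈ Metric.closedBall 0 ρ, ∀ ψ ∈ Metric.closedBall 0 ρ,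
      ∀ t ∈ Ioc 0 T, t ^ (1 - μ) * ‖H p φ t - H q ψ t‖ ≤ K * (dist φ ψ + dist p q)) :
    ∃ Ψ : P → vanishingAtZero E hT.le,
      (∀ p ∈ s, Ψ p ∈ Metric.closedBall 0 ρ ∧
        ∀ t ∈ Ioc 0 T, unweight μ hT.le t (Ψ p) = H p (Ψ p) t) ∧
      ∀ p ∈ s, ∀ q ∈ s, dist (Ψ p) (Ψ q) ≤ K / (1 - K) * dist p q := by
  have hex : ∀ p φ, ∃ ξ : vanishingAtZero E hT.le, p ∈ s → φ ∈ Metric.closedBall 0 ρ →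
      ∀ t ∈ Ioc 0 T, unweight μ hT.le t ξ = H p φ t := fun p φ => by
    by_cases h : p ∈ s ∧ φ ∈ Metric.closedBall 0 ρ
    · exact ((hBC p h.1 φ h.2).exists_unweight_eqOn hμ hT).imp fun ξ hξ _ _ => hξ
    · exact ⟨0, fun hp hφ => absurd ⟨hp, hφ⟩ h⟩
  choose Φ hΦ using hex
  obtain ⟨Ψ, hΨ, hΨlip⟩ := exists_fixedPoint_dist_le hK (Φ := Φ) (s := s)
    (Metric.isClosed_closedBall (x := (0 : vanishingAtZero E hT.le)) (ε := ρ)).isComplete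
    (Metric.nonempty_closedBall.2 hρ)
    (fun p hp φ hφ => mem_closedBall_zero_iff.2 <|
      norm_le_of_weight_mul_norm_unweight_le (μ := μ) hρ fun t ht => by
        rw [hΦ p φ hp hφ t ht]
        exact hnorm p hp φ hφ t ht)
    (fun p hp q hq φ hφ ψ hψ => by
      rw [dist_eq_norm (Φ p φ)]
      refine norm_le_of_weight_mul_norm_unweight_le (μ := μ) (by positivity) fun t ht => ?_
      rw [map_sub, hΦ p φ hp hφ t ht, hΦ q ψ hq hψ t ht]
      exact hlip p hp q hq φ hφ ψ hψ t ht)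
  refine ⟨Ψ, fun p hp => ⟨(hΨ p hp).1, fun t ht => ?_⟩, hΨlip⟩
  rw [← hΦ p (Ψ p) hp (hΨ p hp).1 t ht, (hΨ p hp).2]

variable {E₀ E₁ : Type*} [NormedAddCommGroup E₀] [NormedSpace ℝ E₀]
  [NormedAddCommGroup E₁] [NormedSpace ℝ E₁] {j : E₁ →L[ℝ] E₀} {μ T : ℝ}
  {V : Set (InterpSpace j μ)} {A : InterpSpace j μ → E₁ →L[ℝ] E₀}
  {F₁ F₂ : InterpSpace j μ → E₀} {hμ : μ ∈ Ioo (0 : ℝ) 1}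

theorem weightedBall_mono {x₀ : InterpSpace j μ} {t r R : ℝ} (hr : r ≤ R) :
    weightedBall hμ x₀ t r ⊆ weightedBall hμ x₀ t R := fun _ ha =>
  ⟨Metric.closedBall_subset_closedBall hr ha.1, ha.2.trans hr⟩

theorem mem_weightedBall_of_weightedNorm_sub_le {x₀ : InterpSpace j μ} {t r s : ℝ} (ht : 0 ≤ t)
    {a b : E₁} (ha : a ∈ weightedBall hμ x₀ t r) (hab : weightedNorm hμ j t (b - a) ≤ s) :
    b ∈ weightedBall hμ x₀ t (r + s) := by
  have hE₁ : 0 ≤ t ^ (1 - μ) * ‖b - a‖ := by positivity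
  have hEμ := norm_nonneg (embed j hμ (b - a))
  unfold weightedNorm at hab
  refine ⟨?_, ?_⟩
  · have hdist := ha.1
    rw [mem_closedBall_iff_norm] at hdist ⊢
    calc ‖embed j hμ b - x₀‖ = ‖embed j hμ a - x₀ + embed j hμ (b - a)‖ := by
          rw [map_sub, add_comm, sub_add_sub_cancel]
      _ ≤ r + s := (norm_add_le _ _).trans (add_le_add hdist (by linarith))
  · calc t ^ (1 - μ) * ‖b‖ ≤ t ^ (1 - μ) * ‖a‖ + t ^ (1 - μ) * ‖b - a‖ := by
          rw [← mul_add]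
          gcongr
          exact norm_le_norm_add_norm_sub' b a
      _ ≤ r + s := add_le_add ha.2 (by linarith)

theorem IsLinearSolution.tendsto_embed (hμ : μ ∈ Ioo (0 : ℝ) 1) {B : E₁ →L[ℝ] E₀} {f : ℝ → E₀}
    {x : InterpSpace j μ} {v : ℝ → E₁} (hT : 0 < T) (hf : MemBC μ T f)
    (hv : IsLinearSolution j μ B T f x v) :
    Tendsto (fun t => embed j hμ (v t)) (𝓝[>] 0) (𝓝 x) :=
  QuasilinearSemiflow.tendsto_embed hμ hT hv.memBC (hv.memBC_sub_apply hμ.2 hT hf) hv.eqn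

namespace HasMaxRegEstimate

variable {B : E₁ →L[ℝ] E₀} {M r ρ : ℝ} {G : E₁ → E₀} {x₀ x y : InterpSpace j μ} {u v w : ℝ → E₁}

theorem weightedNorm_sub_le_of_unweight (hB : HasMaxRegEstimate j hμ B M T) (hT : 0 < T)
    {φ ψ : vanishingAtZero E₀ hT.le}
    (hv : IsLinearSolution j μ B T (fun t => unweight μ hT.le t φ) x v)
    (hw : IsLinearSolution j μ B T (fun t => unweight μ hT.le t ψ) y w) {t : ℝ}
    (ht : t ∈ Ioc 0 T) :
    weightedNorm hμ j t (v t - w t) ≤ M * (‖φ - ψ‖ + ‖x - y‖) :=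
  hB.weightedNorm_sub_le hT (memBC_unweight hμ.2 hT φ) (memBC_unweight hμ.2 hT ψ) hv hw
    (fun s hs => by
      rw [← map_sub]
      exact weight_mul_norm_unweight_le (φ - ψ) hs.1) ht

theorem mem_weightedBall_and_weight_mul_norm_le (hB : HasMaxRegEstimate j hμ B M T) (hT : 0 < T)
    (hM : 0 < M) (hr : 0 ≤ r) (hρr : M * (ρ + ρ) ≤ r / 2)
    (hu : IsLinearSolution j μ B T (fun _ => 0) x₀ u)
    (hur : ∀ t ∈ Ioc 0 T, u t ∈ weightedBall hμ x₀ t (r / 2))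
    (hGu : ∀ t ∈ Ioc 0 T, t ^ (1 - μ) * ‖G (u t)‖ ≤ ρ / 2)
    (hG : ∀ t ∈ Ioc 0 T, ∀ a₁ ∈ weightedBall hμ x₀ t r, ∀ a₂ ∈ weightedBall hμ x₀ t r,
      t ^ (1 - μ) * ‖G a₁ - G a₂‖ ≤ 1 / (4 * M) * weightedNorm hμ j t (a₁ - a₂))
    (hx : x ∈ Metric.closedBall x₀ ρ) {φ : vanishingAtZero E₀ hT.le}
    (hφ : φ ∈ Metric.closedBall 0 ρ)
    (hv : IsLinearSolution j μ B T (fun t => unweight μ hT.le t φ) x v) {t : ℝ}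
    (ht : t ∈ Ioc 0 T) :
    v t ∈ weightedBall hμ x₀ t r ∧ t ^ (1 - μ) * ‖G (v t)‖ ≤ ρ := by
  have ht₀ := ht.1
  have hu' : IsLinearSolution j μ B T (fun t => unweight μ hT.le t 0) x₀ u := by
    simpa only [map_zero] using hu
  have hvu : weightedNorm hμ j t (v t - u t) ≤ M * (ρ + ρ) :=
    (hB.weightedNorm_sub_le_of_unweight hT hv hu' ht).trans <| mul_le_mul_of_nonneg_left
      (add_le_add (mem_closedBall_iff_norm.1 hφ) (mem_closedBall_iff_norm.1 hx)) hM.le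
  have hvr : v t ∈ weightedBall hμ x₀ t r := by
    rw [← add_halves r]
    exact mem_weightedBall_of_weightedNorm_sub_le ht₀.le (hur t ht) (hvu.trans hρr)
  have hur' : u t ∈ weightedBall hμ x₀ t r := weightedBall_mono (half_le_self hr) (hur t ht)
  refine ⟨hvr, ?_⟩
  calc t ^ (1 - μ) * ‖G (v t)‖
      ≤ t ^ (1 - μ) * ‖G (u t)‖ + t ^ (1 - μ) * ‖G (v t) - G (u t)‖ := by
        rw [← mul_add]
        gcongr
        exact norm_le_norm_add_norm_sub' _ _
    _ ≤ ρ / 2 + 1 / (4 * M) * (M * (ρ + ρ)) :=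
        add_le_add (hGu t ht) ((hG t ht _ hvr _ hur').trans
          (mul_le_mul_of_nonneg_left hvu (by positivity)))
    _ = ρ := by
        field_simp
        ring

-- The fixed point argument takes place for the right-hand side `φ ∈ BC_{1-μ}([0,T], E₀)`: the
-- linear problem turns `φ` into `v`, and `φ` is replaced by `G(v)`.
theorem exists_semilinear_solution [CompleteSpace E₀] (hB : HasMaxRegEstimate j hμ B M T)
    (hT : 0 < T) (hM : 0 < M) (hρ : 0 ≤ ρ) (hρr : M * (ρ + ρ) ≤ r / 2)
    (hu : IsLinearSolution j μ B T (fun _ => 0) x₀ u)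
    (hur : ∀ t ∈ Ioc 0 T, u t ∈ weightedBall hμ x₀ t (r / 2))
    (hGu : ∀ t ∈ Ioc 0 T, t ^ (1 - μ) * ‖G (u t)‖ ≤ ρ / 2)
    (hG : ∀ t ∈ Ioc 0 T, ∀ a₁ ∈ weightedBall hμ x₀ t r, ∀ a₂ ∈ weightedBall hμ x₀ t r,
      t ^ (1 - μ) * ‖G a₁ - G a₂‖ ≤ 1 / (4 * M) * weightedNorm hμ j t (a₁ - a₂))
    (hGBC : ∀ x ∈ Metric.closedBall x₀ ρ, ∀ f v, MemBC μ T f → IsLinearSolution j μ B T f x v →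
      (∀ t ∈ Ioc 0 T, v t ∈ weightedBall hμ x₀ t r) → MemBC μ T fun t => G (v t)) :
    ∃ S : InterpSpace j μ → ℝ → E₁,
      (∀ x ∈ Metric.closedBall x₀ ρ, MemBC μ T (fun t => G (S x t)) ∧
        IsLinearSolution j μ B T (fun t => G (S x t)) x (S x) ∧
        ∀ t ∈ Ioc 0 T, S x t ∈ weightedBall hμ x₀ t r) ∧
      ∀ x ∈ Metric.closedBall x₀ ρ, ∀ y ∈ Metric.closedBall x₀ ρ, ∀ t ∈ Ioc 0 T,
        t ^ (1 - μ) * ‖G (S x t) - G (S y t)‖ ≤ ‖x - y‖ := by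
  choose v hv using fun (φ : vanishingAtZero E₀ hT.le) x =>
    hB.exists_solution _ (memBC_unweight hμ.2 hT φ) x
  have hr : 0 ≤ r := by nlinarith
  have hvr : ∀ x ∈ Metric.closedBall x₀ ρ, ∀ φ ∈ Metric.closedBall 0 ρ, ∀ t ∈ Ioc 0 T,
      v φ x t ∈ weightedBall hμ x₀ t r ∧ t ^ (1 - μ) * ‖G (v φ x t)‖ ≤ ρ := fun x hx φ hφ _ ht =>
    hB.mem_weightedBall_and_weight_mul_norm_le hT hM hr hρr hu hur hGu hG hx hφ (hv φ x) ht
  have hGBC' : ∀ x ∈ Metric.closedBall x₀ ρ, ∀ φ ∈ Metric.closedBall 0 ρ,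
      MemBC μ T fun t => G (v φ x t) := fun x hx φ hφ =>
    hGBC x hx _ _ (memBC_unweight hμ.2 hT φ) (hv φ x) fun t ht => (hvr x hx φ hφ t ht).1
  have hGlip : ∀ x ∈ Metric.closedBall x₀ ρ, ∀ y ∈ Metric.closedBall x₀ ρ,
      ∀ φ ∈ Metric.closedBall 0 ρ, ∀ ψ ∈ Metric.closedBall 0 ρ, ∀ t ∈ Ioc 0 T,
      t ^ (1 - μ) * ‖G (v φ x t) - G (v ψ y t)‖ ≤ (2⁻¹ : NNReal) * (dist φ ψ + dist x y) := by
    intro x hx y hy φ hφ ψ hψ t ht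
    calc t ^ (1 - μ) * ‖G (v φ x t) - G (v ψ y t)‖
        ≤ 1 / (4 * M) * (M * (‖φ - ψ‖ + ‖x - y‖)) :=
          (hG t ht _ (hvr x hx φ hφ t ht).1 _ (hvr y hy ψ hψ t ht).1).trans <|
            mul_le_mul_of_nonneg_left
              (hB.weightedNorm_sub_le_of_unweight hT (hv φ x) (hv ψ y) ht) (by positivity)
      _ = 4⁻¹ * (dist φ ψ + dist x y) := by
          rw [dist_eq_norm φ, dist_eq_norm x]
          field_simp
      _ ≤ (2⁻¹ : NNReal) * (dist φ ψ + dist x y) := by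
          gcongr
          norm_num
  obtain ⟨Ψ, hΨ, hΨlip⟩ := exists_unweight_fixedPoint hμ.2 hT hρ (by norm_num) hGBC'
    (fun x hx φ hφ t ht => (hvr x hx φ hφ t ht).2) hGlip
  refine ⟨fun x => v (Ψ x) x, fun x hx => ⟨hGBC' x hx _ (hΨ x hx).1,
    (hv _ x).congr hμ.2 hT (hΨ x hx).2 fun _ _ => rfl, fun t ht =>
    (hvr x hx _ (hΨ x hx).1 t ht).1⟩, fun x hx y hy t ht => ?_⟩
  have hΨdist : ‖Ψ x - Ψ y‖ ≤ ‖x - y‖ := by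
    refine (dist_eq_norm (Ψ x) (Ψ y)).symm.trans_le ((hΨlip x hx y hy).trans_eq ?_)
    norm_num [dist_eq_norm x]
  rw [← (hΨ x hx).2 t ht, ← (hΨ y hy).2 t ht, ← map_sub]
  exact (weight_mul_norm_unweight_le (Ψ x - Ψ y) ht.1).trans hΨdist

end HasMaxRegEstimate

variable [CompleteSpace E₀] [CompleteSpace E₁]

theorem exists_local_solution (hj : Function.Injective j) (hV : IsOpen V)
    (h₁ : LipschitzHypothesis j μ V A F₁) (h₂ : StructuralHypothesis j μ V F₂)
    {x₀ : InterpSpace j μ} (hx₀ : x₀ ∈ V) :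
    ∃ τ > 0, ∃ ε > 0, ∃ K > 0, Metric.closedBall x₀ ε ⊆ V ∧ ∃ S : InterpSpace j μ → ℝ → E₁,
      (∀ x ∈ Metric.closedBall x₀ ε, IsMildSolution hμ V A F₁ F₂ τ x (S x)) ∧
      ∀ x ∈ Metric.closedBall x₀ ε, ∀ y ∈ Metric.closedBall x₀ ε, ∀ t ∈ Ioc 0 τ,
        weightedNorm hμ j t (S x t - S y t) + t ^ (1 - μ) *
          ‖vectorField hμ A F₁ F₂ (S x t) - vectorField hμ A F₁ F₂ (S y t)‖ ≤ K * ‖x - y‖ := by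
  obtain ⟨T, hT, M, hM1, hB⟩ := (h₁.maxReg x₀ hx₀).exists_hasMaxRegEstimate hj hμ
  have hM : 0 < M := one_pos.trans_le hM1
  have hη : 0 < 1 / (4 * M) := by positivity
  set G : E₁ → E₀ := fun a => A x₀ a + vectorField hμ A F₁ F₂ a
  have hGlip := isWeightedLipschitzAt_apply_add_vectorField hμ hV h₁ h₂ hx₀ hη
  obtain ⟨r, ⟨hGr, hrV⟩, hr : 0 < r⟩ :=
    ((hGlip.and (eventually_closedBall_subset (hV.mem_nhds hx₀))).and self_mem_nhdsWithin).exists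
  have hρ : 0 < r / (4 * M) := by positivity
  have hρr : r / (4 * M) ≤ r := div_le_self hr.le (by linarith)
  obtain ⟨u, hu⟩ := (hB T ⟨hT, le_rfl⟩).exists_solution _ memBC_zero x₀
  have hux := hu.tendsto_embed hμ hT memBC_zero
  obtain ⟨τ, hτ, ⟨hτT, hτr⟩⟩ := ((eventually_forall_mem_Ioc
    (((hux.eventually (Metric.closedBall_mem_nhds x₀ (half_pos hr))).and
      (hu.memBC.tendsto_weight_mul_norm.eventually (Iic_mem_nhds (half_pos hr)))).and
      ((hGlip.tendsto_weight_mul_norm hη.le hu.memBC hux).eventually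
        (Iic_mem_nhds (half_pos hρ))))).and
    (inter_mem (Ioc_mem_nhdsGT hT) (Ioc_mem_nhdsGT hr))).exists
  have hGBC : ∀ x ∈ Metric.closedBall x₀ (r / (4 * M)), ∀ f v, MemBC μ τ f →
      IsLinearSolution j μ (A x₀) τ f x v → (∀ t ∈ Ioc 0 τ, v t ∈ weightedBall hμ x₀ t r) →
      MemBC μ τ fun t => G (v t) := fun x hx f v hf hv hvr =>
    (hv.memBC.clm hμ.2 hτT.1 (A x₀)).add hμ.2 hτT.1 <|
      memBC_vectorField hμ hV h₁ h₂ hτT.1 (hrV (Metric.closedBall_subset_closedBall hρr hx))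
        hv.memBC (fun t ht => hrV (hvr t ht).1) (hv.tendsto_embed hμ hτT.1 hf)
  obtain ⟨S, hS, hSlip⟩ := (hB τ hτT).exists_semilinear_solution (G := G) hτT.1 hM hρ.le
    (le_of_eq (by field_simp; ring)) (hu.mono hτT.2) (fun t ht => (hτ t ht).1)
    (fun t ht => (hτ t ht).2) (fun t ht => hGr t ⟨ht.1, ht.2.trans hτr.2⟩) hGBC
  refine ⟨τ, hτT.1, r / (4 * M), hρ, 2 * M, by positivity,
    (Metric.closedBall_subset_closedBall hρr).trans hrV, S, fun x hx =>
    (hS x hx).2.1.isMildSolution hτT.1 (hS x hx).1 fun t ht => hrV ((hS x hx).2.2 t ht).1,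
    fun x hx y hy t ht => ?_⟩
  have h := (hB τ hτT).sub_le hτT.1 (hS x hx).1 (hS y hy).1 (hS x hx).2.1 (hS y hy).2.1
    (hSlip x hx y hy) ht
  rw [map_sub, add_sub_add_comm, add_sub_cancel_left] at h
  exact h.trans_eq (by ring)

end LocalExistence

section Semiflow

open scoped NNReal

variable {X : Type*} {V : Set X} {tp : X → EReal} {φ : ℝ → X → X}

theorem mem_flowDomain_of_le {s t : ℝ} {x : X} (hs : 0 ≤ s) (hst : s ≤ t)
    (h : (t, x) ∈ flowDomain V tp) : (s, x) ∈ flowDomain V tp :=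
  ⟨h.1, hs, (EReal.coe_le_coe_iff.mpr hst).trans_lt h.2.2⟩

variable [PseudoEMetricSpace X]

/-- A local semiflow on `V` with lifespans `tp` whose orbits are continuous; nothing is required of
its dependence on the initial value. -/
structure IsOrbitSemiflow (V : Set X) (tp : X → EReal) (φ : ℝ → X → X) : Prop where
  lifespan_pos : ∀ x ∈ V, 0 < tp x
  mapsTo : ∀ t x, (t, x) ∈ flowDomain V tp → φ t x ∈ V
  map_zero : ∀ x ∈ V, φ 0 x = x
  lifespan_shift : ∀ (s t : ℝ) (x : X), (s, x) ∈ flowDomain V tp → 0 ≤ t →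
    ((t : EReal) < tp (φ s x) ↔ ((s + t : ℝ) : EReal) < tp x)
  map_add : ∀ s t x, (s, x) ∈ flowDomain V tp → (t, φ s x) ∈ flowDomain V tp →
    φ (s + t) x = φ t (φ s x)
  continuousOn_orbit : ∀ t x, (t, x) ∈ flowDomain V tp →
    ContinuousOn (fun s => φ s x) (Icc 0 t)

/-- Near `x₀` the maps `φ s`, `0 ≤ s ≤ t`, are defined and Lipschitz with a common constant. -/
def IsFlowLipschitzNear (V : Set X) (tp : X → EReal) (φ : ℝ → X → X) (t : ℝ) (x₀ : X) : Prop :=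
  ∃ W ∈ 𝓝 x₀, ∃ c : ℝ≥0, (∀ x ∈ W, (t, x) ∈ flowDomain V tp) ∧
    ∀ s ∈ Icc 0 t, LipschitzOnWith c (φ s) W

namespace IsFlowLipschitzNear

theorem mono {s t : ℝ} {x₀ : X} (hs : 0 ≤ s) (hst : s ≤ t)
    (h : IsFlowLipschitzNear V tp φ t x₀) : IsFlowLipschitzNear V tp φ s x₀ := by
  obtain ⟨W, hW, c, hWt, hc⟩ := h
  exact ⟨W, hW, c, fun x hx => mem_flowDomain_of_le hs hst (hWt x hx),
    fun r hr => hc r (Icc_subset_Icc_right hst hr)⟩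

theorem eventually {t : ℝ} {x₀ : X} (h : IsFlowLipschitzNear V tp φ t x₀) :
    ∀ᶠ x in 𝓝 x₀, IsFlowLipschitzNear V tp φ t x := by
  obtain ⟨W, hW, c, hWt⟩ := h
  filter_upwards [eventually_mem_nhds_iff.mpr hW] with x hx using ⟨W, hx, c, hWt⟩

end IsFlowLipschitzNear

theorem exists_isFlowLipschitzNear_of_isCompact
    (hloc : ∀ x ∈ V, ∃ τ > 0, IsFlowLipschitzNear V tp φ τ x) {K : Set X} (hK : IsCompact K)
    (hKV : K ⊆ V) : ∃ τ > 0, ∀ x ∈ K, IsFlowLipschitzNear V tp φ τ x := by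
  refine hK.induction_on ⟨1, one_pos, fun x hx => absurd hx (notMem_empty x)⟩
    (fun s t hst ⟨τ, hτ, h⟩ => ⟨τ, hτ, fun x hx => h x (hst hx)⟩) ?_ fun x hx => ?_
  · rintro s t ⟨τ, hτ, hs⟩ ⟨τ', hτ', ht⟩
    have hmin : 0 < min τ τ' := lt_min hτ hτ'
    refine ⟨min τ τ', hmin, fun x hx => hx.elim (fun h => ?_) fun h => ?_⟩
    · exact (hs x h).mono hmin.le (min_le_left _ _)
    · exact (ht x h).mono hmin.le (min_le_right _ _)
  · obtain ⟨τ, hτ, h⟩ := hloc x (hKV hx)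
    exact ⟨_, mem_nhdsWithin_of_mem_nhds h.eventually, τ, hτ, fun _ hy => hy⟩

namespace IsOrbitSemiflow

theorem isFlowLipschitzNear_add (hφ : IsOrbitSemiflow V tp φ) {s t : ℝ} {x₀ : X}
    (hs : IsFlowLipschitzNear V tp φ s x₀) (ht : IsFlowLipschitzNear V tp φ t (φ s x₀)) :
    IsFlowLipschitzNear V tp φ (s + t) x₀ := by
  obtain ⟨W, hW, c, hWs, hc⟩ := hs
  obtain ⟨W', hW', c', hWt, hc'⟩ := ht
  have hs₀ : 0 ≤ s := (hWs x₀ (mem_of_mem_nhds hW)).2.1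
  have hφs : LipschitzOnWith c (φ s) W := hc s (right_mem_Icc.mpr hs₀)
  refine ⟨W ∩ φ s ⁻¹' W', inter_mem hW ((hφs.continuousOn.continuousAt hW).preimage_mem_nhds hW'),
    max c (c' * c), fun x hx => ?_, fun r hr => ?_⟩
  · have hφx := hWt _ hx.2
    exact ⟨(hWs x hx.1).1, add_nonneg hs₀ hφx.2.1,
      (hφ.lifespan_shift s t x (hWs x hx.1) hφx.2.1).mp hφx.2.2⟩
  · rcases le_total r s with hrs | hsr
    · exact ((hc r ⟨hr.1, hrs⟩).mono inter_subset_left).weaken (le_max_left _ _)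
    · have hrt : r - s ∈ Icc 0 t := ⟨sub_nonneg.mpr hsr, sub_le_iff_le_add'.mpr hr.2⟩
      have hcomp : LipschitzOnWith (c' * c) (φ (r - s) ∘ φ s) (W ∩ φ s ⁻¹' W') :=
        (hc' _ hrt).comp (hφs.mono inter_subset_left) fun x hx => hx.2
      have hsplit : EqOn (φ r) (φ (r - s) ∘ φ s) (W ∩ φ s ⁻¹' W') := fun x hx => by
        rw [Function.comp_apply, ← hφ.map_add s (r - s) x (hWs x hx.1)
          (mem_flowDomain_of_le hrt.1 hrt.2 (hWt _ hx.2)), add_sub_cancel]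
      have hr' : LipschitzOnWith (c' * c) (φ r) (W ∩ φ s ⁻¹' W') := fun x hx y hy => by
        rw [hsplit hx, hsplit hy]
        exact hcomp hx hy
      exact hr'.weaken (le_max_right _ _)

theorem isFlowLipschitzNear (hφ : IsOrbitSemiflow V tp φ)
    (hloc : ∀ x ∈ V, ∃ τ > 0, IsFlowLipschitzNear V tp φ τ x) {t₀ : ℝ} {x₀ : X}
    (h₀ : (t₀, x₀) ∈ flowDomain V tp) : IsFlowLipschitzNear V tp φ t₀ x₀ := by
  -- The step `τ` is uniform along the compact orbit, so finitely many steps reach `t₀`.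
  obtain ⟨τ, hτ, hK⟩ := exists_isFlowLipschitzNear_of_isCompact hloc
    (isCompact_Icc.image_of_continuousOn (hφ.continuousOn_orbit t₀ x₀ h₀))
    (image_subset_iff.mpr fun s hs => hφ.mapsTo s x₀ (mem_flowDomain_of_le hs.1 hs.2 h₀))
  have horbit : ∀ s ∈ Icc 0 t₀, IsFlowLipschitzNear V tp φ τ (φ s x₀) :=
    fun s hs => hK _ (mem_image_of_mem _ hs)
  have hx₀ : IsFlowLipschitzNear V tp φ τ x₀ :=
    hφ.map_zero x₀ h₀.1 ▸ horbit 0 (left_mem_Icc.mpr h₀.2.1)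
  have hsteps : ∀ (n : ℕ), ∀ t ∈ Icc 0 t₀, t ≤ n * τ → IsFlowLipschitzNear V tp φ t x₀ := by
    intro n
    induction n with
    | zero =>
      intro t ht hn
      rw [Nat.cast_zero, zero_mul] at hn
      exact hx₀.mono ht.1 (hn.trans hτ.le)
    | succ n ih =>
      intro t ht hn
      rcases le_total t τ with h | h
      · exact hx₀.mono ht.1 h
      · have hs : t - τ ∈ Icc 0 t₀ := ⟨sub_nonneg.mpr h, by linarith [ht.2]⟩
        have hsn : t - τ ≤ n * τ := by push_cast at hn; linarith
        simpa only [sub_add_cancel] using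
          hφ.isFlowLipschitzNear_add (ih _ hs hsn) (horbit _ hs)
  obtain ⟨n, hn⟩ := Archimedean.arch t₀ hτ
  exact hsteps n t₀ (right_mem_Icc.mpr h₀.2.1) (by simpa only [nsmul_eq_mul] using hn)

theorem exists_gt_isFlowLipschitzNear (hφ : IsOrbitSemiflow V tp φ)
    (hloc : ∀ x ∈ V, ∃ τ > 0, IsFlowLipschitzNear V tp φ τ x) {t₀ : ℝ} {x₀ : X}
    (h₀ : (t₀, x₀) ∈ flowDomain V tp) : ∃ t₁ > t₀, IsFlowLipschitzNear V tp φ t₁ x₀ := by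
  obtain ⟨t₁, ht₁, ht₁x⟩ := EReal.lt_iff_exists_real_btwn.mp h₀.2.2
  have hlt : t₀ < t₁ := EReal.coe_lt_coe_iff.mp ht₁
  exact ⟨t₁, hlt, hφ.isFlowLipschitzNear hloc ⟨h₀.1, h₀.2.1.trans hlt.le, ht₁x⟩⟩

theorem exists_isOpen_flowDomain_eq (hφ : IsOrbitSemiflow V tp φ)
    (hloc : ∀ x ∈ V, ∃ τ > 0, IsFlowLipschitzNear V tp φ τ x) :
    ∃ O : Set (ℝ × X), IsOpen O ∧ flowDomain V tp = O ∩ Ici 0 ×ˢ V := by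
  refine ⟨interior {p | p ∈ Ici (0 : ℝ) ×ˢ V → p ∈ flowDomain V tp}, isOpen_interior,
    Subset.antisymm ?_ fun p hp => interior_subset hp.1 hp.2⟩
  rintro ⟨t₀, x₀⟩ h₀
  obtain ⟨t₁, ht₁, W, hW, -, hWt, -⟩ := hφ.exists_gt_isFlowLipschitzNear hloc h₀
  refine ⟨mem_interior_iff_mem_nhds.mpr ?_, h₀.2.1, h₀.1⟩
  filter_upwards [prod_mem_nhds (Iio_mem_nhds ht₁) hW] with p hp hp'
  exact mem_flowDomain_of_le hp'.1 (mem_Iio.mp hp.1).le (hWt _ hp.2)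

theorem continuousOn_uncurry (hφ : IsOrbitSemiflow V tp φ)
    (hloc : ∀ x ∈ V, ∃ τ > 0, IsFlowLipschitzNear V tp φ τ x) :
    ContinuousOn (fun p : ℝ × X => φ p.1 p.2) (flowDomain V tp) := by
  rintro ⟨t₀, x₀⟩ h₀
  obtain ⟨t₁, ht₁, W, hW, c, hWt, hc⟩ := hφ.exists_gt_isFlowLipschitzNear hloc h₀
  have hcont : ContinuousOn (fun p : ℝ × X => φ p.1 p.2) (Icc 0 t₁ ×ˢ W) :=
    continuousOn_prod_of_continuousOn_lipschitzOnWith' _ c hc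
      fun x hx => hφ.continuousOn_orbit t₁ x (hWt x hx)
  refine (hcont _ ⟨⟨h₀.2.1, ht₁.le⟩, mem_of_mem_nhds hW⟩).mono_of_mem_nhdsWithin ?_
  filter_upwards [self_mem_nhdsWithin, mem_nhdsWithin_of_mem_nhds
    (prod_mem_nhds (Iio_mem_nhds ht₁) hW)] with p hp hp'
  exact ⟨⟨hp.2.1, (mem_Iio.mp hp'.1).le⟩, hp'.2⟩

end IsOrbitSemiflow

end Semiflow

section LipschitzSemiflow

variable {X : Type*} [NormedAddCommGroup X] {V : Set X} {tp : X → EReal} {φ : ℝ → X → X}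

namespace IsOrbitSemiflow

theorem exists_nhds_lipschitz (hφ : IsOrbitSemiflow V tp φ)
    (hloc : ∀ x ∈ V, ∃ τ > 0, IsFlowLipschitzNear V tp φ τ x) {t₀ : ℝ} {x₀ : X}
    (h₀ : (t₀, x₀) ∈ flowDomain V tp) :
    ∃ U ∈ 𝓝[Ici 0] t₀, ∃ W ∈ 𝓝[V] x₀, U ×ˢ W ⊆ flowDomain V tp ∧
      ∃ c > 0, ∀ t ∈ U, ∀ x ∈ W, ∀ y ∈ W, ‖φ t x - φ t y‖ ≤ c * ‖x - y‖ := by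
  obtain ⟨t₁, ht₁, W, hW, c, hWt, hc⟩ := hφ.exists_gt_isFlowLipschitzNear hloc h₀
  refine ⟨Icc 0 t₁, ?_, W, mem_nhdsWithin_of_mem_nhds hW,
    fun p hp => mem_flowDomain_of_le hp.1.1 hp.1.2 (hWt p.2 hp.2), c + 1, by positivity,
    fun t ht x hx y hy => ?_⟩
  · filter_upwards [self_mem_nhdsWithin, mem_nhdsWithin_of_mem_nhds (Iio_mem_nhds ht₁)]
      with t ht ht' using ⟨ht, ht'.le⟩
  · exact ((hc t ht).norm_sub_le hx hy).trans
      (mul_le_mul_of_nonneg_right (le_add_of_nonneg_right zero_le_one) (norm_nonneg _))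

theorem isLocallyLipschitzSemiflow (hφ : IsOrbitSemiflow V tp φ)
    (hloc : ∀ x ∈ V, ∃ τ > 0, IsFlowLipschitzNear V tp φ τ x) :
    IsLocallyLipschitzSemiflow V tp φ where
  lifespan_pos := hφ.lifespan_pos
  isOpen_domain := hφ.exists_isOpen_flowDomain_eq hloc
  mapsTo := hφ.mapsTo
  continuousOn := hφ.continuousOn_uncurry hloc
  map_zero := hφ.map_zero
  lifespan_shift := hφ.lifespan_shift
  map_add := hφ.map_add
  lipschitz _ _ h₀ := hφ.exists_nhds_lipschitz hloc h₀

end IsOrbitSemiflow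

end LipschitzSemiflow

section GlobalTheory

variable {E₀ E₁ : Type*} [NormedAddCommGroup E₀] [NormedSpace ℝ E₀]
  [NormedAddCommGroup E₁] [NormedSpace ℝ E₁] {j : E₁ →L[ℝ] E₀} {μ T : ℝ}
  {V : Set (InterpSpace j μ)} {A : InterpSpace j μ → E₁ →L[ℝ] E₀}
  {F₁ F₂ : InterpSpace j μ → E₀} {hμ : μ ∈ Ioo (0 : ℝ) 1} {x : InterpSpace j μ} {v w : ℝ → E₁}

/-- The standing assumptions on the quasilinear problem `u' + A(u) u = F₁(u) + F₂(u)`, bundled for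
the development of its semiflow. -/
structure IsAdmissible (j : E₁ →L[ℝ] E₀) (μ : ℝ) (V : Set (InterpSpace j μ))
    (A : InterpSpace j μ → E₁ →L[ℝ] E₀) (F₁ F₂ : InterpSpace j μ → E₀) : Prop where
  injective : Function.Injective j
  isOpen : IsOpen V
  lipschitz : LipschitzHypothesis j μ V A F₁
  structural : StructuralHypothesis j μ V F₂

/-- The lifespan of the maximal solution with initial value `x`. -/
def lifespan (hμ : μ ∈ Ioo (0 : ℝ) 1) (V : Set (InterpSpace j μ))
    (A : InterpSpace j μ → E₁ →L[ℝ] E₀) (F₁ F₂ : InterpSpace j μ → E₀)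
    (x : InterpSpace j μ) : EReal :=
  sSup ((fun T : ℝ => (T : EReal)) '' {T | 0 < T ∧ ∃ v, IsMildSolution hμ V A F₁ F₂ T x v})

open Classical in
/-- The maximal solution with initial value `x`, at time `t`; it has the junk value `x` outside the
interval of existence. -/
def flow (hμ : μ ∈ Ioo (0 : ℝ) 1) (V : Set (InterpSpace j μ))
    (A : InterpSpace j μ → E₁ →L[ℝ] E₀) (F₁ F₂ : InterpSpace j μ → E₀)
    (t : ℝ) (x : InterpSpace j μ) : InterpSpace j μ :=
  if h : 0 < t ∧ ∃ v, IsMildSolution hμ V A F₁ F₂ t x v then embed j hμ (h.2.choose t) else x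

theorem flow_zero (x : InterpSpace j μ) : flow hμ V A F₁ F₂ 0 x = x :=
  dif_neg fun h => lt_irrefl _ h.1

variable [CompleteSpace E₀]

theorem IsSolutionOn.exists_isMildSolution (hμ : μ ∈ Ioo (0 : ℝ) 1) (hT : 0 < T)
    {u : ℝ → InterpSpace j μ} (hu : IsSolutionOn j μ V A F₁ F₂ T x u) :
    ∃ v, IsMildSolution hμ V A F₁ F₂ T x v ∧ ∀ t ∈ Ioc 0 T, u t = embed j hμ (v t) := by
  have huv : ∀ t ∈ Ioc 0 T, u t = embed j hμ (toE₁ j (InterpSpace.incl (u t))) := fun t ht =>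
    InterpSpace.incl_injective <| by rw [incl_embed, apply_toE₁ (hu.memMaxReg.mem_range t ht)]
  have hfield : ∀ t ∈ Ioc 0 T, vectorField hμ A F₁ F₂ (toE₁ j (InterpSpace.incl (u t)))
      = derivWithin (fun s => InterpSpace.incl (u s)) (Ioc 0 T) t := fun t ht => by
    rw [vectorField, ← huv t ht, ← hu.eqn t ht, add_sub_cancel_right]
  refine ⟨fun t => toE₁ j (InterpSpace.incl (u t)), ⟨hu.memMaxReg.memBC,
    hu.memMaxReg.memBC1.memBC_deriv.congr hμ.2 hT hfield, fun t ht => ?_, fun t ht => ?_⟩, huv⟩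
  · rw [← huv t ht]
    exact hu.mem t (Ioc_subset_Icc_self ht)
  · rw [integral_congr_Ioc ht.1.le fun s hs => hfield s ⟨hs.1, hs.2.trans ht.2⟩, ← hu.init,
      ← hu.memMaxReg.eq_add_integral hμ.1 ht, apply_toE₁ (hu.memMaxReg.mem_range t ht)]

namespace IsMildSolution

theorem memMaxReg (hj : Function.Injective j) (hT : 0 < T)
    (hv : IsMildSolution hμ V A F₁ F₂ T x v) {u : ℝ → InterpSpace j μ} (hu0 : u 0 = x)
    (huv : ∀ t ∈ Ioc 0 T, u t = embed j hμ (v t)) :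
    MemMaxReg j μ T (fun t => InterpSpace.incl (u t)) ∧
      EqOn (derivWithin (fun s => InterpSpace.incl (u s)) (Ioc 0 T))
        (fun t => vectorField hμ A F₁ F₂ (v t)) (Ioc 0 T) :=
  memMaxReg_of_eq_add_integral hj hμ hT hv.memBC hv.memBC_vectorField
    (fun t ht => by rw [huv t ht, incl_embed])
    fun t ht => by rw [huv t ht, incl_embed, hv.eqn t ht, hu0]

theorem isSolutionOn (hj : Function.Injective j) (hT : 0 < T) (hx : x ∈ V)
    (hv : IsMildSolution hμ V A F₁ F₂ T x v) {u : ℝ → InterpSpace j μ} (hu0 : u 0 = x)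
    (huv : ∀ t ∈ Ioc 0 T, u t = embed j hμ (v t)) : IsSolutionOn j μ V A F₁ F₂ T x u := by
  obtain ⟨hmem, hderiv⟩ := hv.memMaxReg hj hT hu0 huv
  refine ⟨hu0, fun t ht => ?_, hmem, fun t ht => ?_⟩
  · rcases ht.1.eq_or_lt with rfl | ht₀
    · rwa [hu0]
    · rw [huv t ⟨ht₀, ht.2⟩]
      exact hv.mem t ⟨ht₀, ht.2⟩
  · rw [hderiv ht, huv t ht, incl_embed, toE₁_apply hj]
    exact sub_add_cancel _ _

end IsMildSolution

namespace IsAdmissible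

variable [CompleteSpace E₁]

theorem eqOn (hP : IsAdmissible j μ V A F₁ F₂) (hx : x ∈ V)
    (hv : IsMildSolution hμ V A F₁ F₂ T x v) (hw : IsMildSolution hμ V A F₁ F₂ T x w) :
    EqOn v w (Ioc 0 T) := by
  rcases le_or_gt T 0 with hT | hT
  · exact fun t ht => absurd (ht.1.trans_le ht.2) hT.not_gt
  obtain ⟨δ, hδ, hvw⟩ :=
    hv.exists_eqOn hP.injective hP.isOpen hP.lipschitz hP.structural hx hT hw
  have hsub : Icc δ T ⊆ Ioc 0 T := fun t ht => ⟨hδ.1.trans_le ht.1, ht.2⟩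
  have hclosed : IsClosed ({t | v t = w t} ∩ Icc δ T) := by
    rw [inter_comm]
    exact isClosed_Icc.isClosed_eq (hv.memBC.continuousOn.mono hsub)
      (hw.memBC.continuousOn.mono hsub)
  have hmain : Icc δ T ⊆ {t | v t = w t} := by
    refine hclosed.Icc_subset_of_forall_exists_gt (hvw (right_mem_Ioc.mpr hδ.1)) ?_
    rintro t ⟨hvwt : v t = w t, htT⟩ y hy
    have ht : t ∈ Ioo 0 T := ⟨hδ.1.trans_le htT.1, htT.2⟩
    obtain ⟨δ', hδ', hvw'⟩ := (hv.shift ht).exists_eqOn hP.injective hP.isOpen hP.lipschitz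
      hP.structural (hv.mem t (Ioo_subset_Ioc_self ht)) (sub_pos.mpr htT.2)
      (hvwt ▸ hw.shift ht)
    have hstep : 0 < min δ' (y - t) := lt_min hδ'.1 (sub_pos.mpr hy)
    refine ⟨t + min δ' (y - t), hvw' ⟨hstep, min_le_left _ _⟩, lt_add_of_pos_right t hstep, ?_⟩
    linarith [min_le_right δ' (y - t)]
  intro t ht
  rcases le_total t δ with h | h
  · exact hvw ⟨ht.1, h⟩
  · exact hmain ⟨h, ht.2⟩

theorem flow_eq (hP : IsAdmissible j μ V A F₁ F₂) (hx : x ∈ V)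
    (hv : IsMildSolution hμ V A F₁ F₂ T x v) {t : ℝ} (ht : t ∈ Ioc 0 T) :
    flow hμ V A F₁ F₂ t x = embed j hμ (v t) := by
  have hvt := hv.mono ht.2
  have hex : 0 < t ∧ ∃ v, IsMildSolution hμ V A F₁ F₂ t x v := ⟨ht.1, v, hvt⟩
  rw [flow, dif_pos hex, hP.eqOn hx hex.2.choose_spec hvt (right_mem_Ioc.mpr ht.1)]

theorem exists_isMildSolution_add (hP : IsAdmissible j μ V A F₁ F₂) {a b d : ℝ} (ha : 0 < a)
    (hab : a < b) (hbd : b ≤ a + d) (hv : IsMildSolution hμ V A F₁ F₂ b x v)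
    (hw : IsMildSolution hμ V A F₁ F₂ d (embed j hμ (v a)) w) :
    ∃ y, IsMildSolution hμ V A F₁ F₂ (a + d) x y :=
  ⟨_, hv.concat ha hab hbd hw (hP.eqOn (hv.mem a ⟨ha, hab.le⟩) (hw.mono (by linarith))
    (hv.shift ⟨ha, hab⟩))⟩

theorem exists_gt_isMildSolution (hP : IsAdmissible j μ V A F₁ F₂) (hT : 0 < T)
    (hv : IsMildSolution hμ V A F₁ F₂ T x v) :
    ∃ T' > T, ∃ w, IsMildSolution hμ V A F₁ F₂ T' x w := by
  obtain ⟨τ, hτ, ε, hε, -, -, -, S, hS, -⟩ := exists_local_solution (hμ := hμ) hP.injective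
    hP.isOpen hP.lipschitz hP.structural (hv.mem T (right_mem_Ioc.mpr hT))
  have hcont : Tendsto (fun t => embed j hμ (v t)) (𝓝[<] T) (𝓝 (embed j hμ (v T))) := by
    rw [← nhdsWithin_Ioo_eq_nhdsLT hT]
    exact ((embed j hμ).continuous.comp_continuousOn hv.memBC.continuousOn T
      (right_mem_Ioc.mpr hT)).mono Ioo_subset_Ioc_self
  obtain ⟨a, haε, haT⟩ := ((hcont.eventually (Metric.closedBall_mem_nhds _ hε)).and
    (Ioo_mem_nhdsLT (max_lt hT (sub_lt_self T hτ)))).exists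
  have ha₀ : 0 < a := (le_max_left _ _).trans_lt haT.1
  have haτ : T < a + τ := sub_lt_iff_lt_add.mp ((le_max_right _ _).trans_lt haT.1)
  exact ⟨a + τ, haτ, hP.exists_isMildSolution_add ha₀ haT.2 haτ.le hv (hS _ haε)⟩

theorem lt_lifespan_iff (hP : IsAdmissible j μ V A F₁ F₂) (hT : 0 < T) :
    (T : EReal) < lifespan hμ V A F₁ F₂ x ↔ ∃ v, IsMildSolution hμ V A F₁ F₂ T x v := by
  rw [lifespan, lt_sSup_iff]
  constructor
  · rintro ⟨_, ⟨T', ⟨-, v, hv⟩, rfl⟩, hTT'⟩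
    exact ⟨v, hv.mono (EReal.coe_lt_coe_iff.mp hTT').le⟩
  · rintro ⟨v, hv⟩
    obtain ⟨T', hT', w, hw⟩ := hP.exists_gt_isMildSolution hT hv
    exact ⟨_, ⟨T', ⟨hT.trans hT', w, hw⟩, rfl⟩, EReal.coe_lt_coe_iff.mpr hT'⟩

theorem lifespan_pos (hP : IsAdmissible j μ V A F₁ F₂) (hx : x ∈ V) :
    0 < lifespan hμ V A F₁ F₂ x := by
  obtain ⟨τ, hτ, ε, hε, -, -, -, S, hS, -⟩ := exists_local_solution (hμ := hμ) hP.injective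
    hP.isOpen hP.lipschitz hP.structural hx
  exact (EReal.coe_pos.mpr hτ).trans
    ((hP.lt_lifespan_iff hτ).mpr ⟨_, hS x (Metric.mem_closedBall_self hε.le)⟩)

theorem isMaximalSolutionMap (hP : IsAdmissible j μ V A F₁ F₂) :
    IsMaximalSolutionMap j μ V A F₁ F₂ (lifespan hμ V A F₁ F₂) (flow hμ V A F₁ F₂) := by
  refine fun x hx => ⟨hP.lifespan_pos hx, fun T hT hTx => ?_, fun T hT w hw => ?_⟩
  · obtain ⟨v, hv⟩ := (hP.lt_lifespan_iff hT).mp hTx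
    exact hv.isSolutionOn hP.injective hT hx (flow_zero x) fun t ht => hP.flow_eq hx hv ht
  · obtain ⟨v, hv, hwv⟩ := hw.exists_isMildSolution hμ hT
    refine ⟨(hP.lt_lifespan_iff hT).mpr ⟨v, hv⟩, fun t ht => ?_⟩
    rcases ht.1.eq_or_lt with rfl | ht₀
    · exact hw.init.trans (flow_zero x).symm
    · exact (hwv t ⟨ht₀, ht.2⟩).trans (hP.flow_eq hx hv ⟨ht₀, ht.2⟩).symm

theorem continuousOn_flow_left (hP : IsAdmissible j μ V A F₁ F₂) (hx : x ∈ V)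
    (hTx : (T : EReal) < lifespan hμ V A F₁ F₂ x) :
    ContinuousOn (fun t => flow hμ V A F₁ F₂ t x) (Icc 0 T) := by
  rcases le_or_gt T 0 with hT | hT
  · exact (subsingleton_Icc_of_ge hT).continuousOn _
  obtain ⟨v, hv⟩ := (hP.lt_lifespan_iff hT).mp hTx
  have hflow : EqOn (fun t => flow hμ V A F₁ F₂ t x) (fun t => embed j hμ (v t)) (Ioc 0 T) :=
    fun t ht => hP.flow_eq hx hv ht
  intro t ht
  rcases ht.1.eq_or_lt with rfl | ht₀
  · rw [← continuousWithinAt_sdiff_self, Icc_sdiff_left, ContinuousWithinAt, flow_zero,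
      nhdsWithin_Ioc_eq_nhdsGT hT]
    exact (hv.tendsto_embed hT).congr' (hflow.symm.eventuallyEq_of_mem (Ioc_mem_nhdsGT hT))
  · have hcont : ContinuousOn (fun t => flow hμ V A F₁ F₂ t x) (Ioc 0 T) :=
      ((embed j hμ).continuous.comp_continuousOn hv.memBC.continuousOn).congr hflow
    refine (hcont t ⟨ht₀, ht.2⟩).mono_of_mem_nhdsWithin ?_
    filter_upwards [self_mem_nhdsWithin, mem_nhdsWithin_of_mem_nhds (Ioi_mem_nhds ht₀)]
      with s hs hs' using ⟨hs', hs.2⟩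

theorem flow_mem (hP : IsAdmissible j μ V A F₁ F₂) {t : ℝ}
    (h : (t, x) ∈ flowDomain V (lifespan hμ V A F₁ F₂)) : flow hμ V A F₁ F₂ t x ∈ V := by
  obtain ⟨hx, ht, htx⟩ := h
  rcases ht.eq_or_lt with rfl | ht₀
  · rwa [flow_zero]
  · obtain ⟨v, hv⟩ := (hP.lt_lifespan_iff ht₀).mp htx
    rw [hP.flow_eq hx hv (right_mem_Ioc.mpr ht₀)]
    exact hv.mem t (right_mem_Ioc.mpr ht₀)

theorem lt_lifespan_flow_iff (hP : IsAdmissible j μ V A F₁ F₂) {s t : ℝ}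
    (hsx : (s, x) ∈ flowDomain V (lifespan hμ V A F₁ F₂)) (ht : 0 ≤ t) :
    (t : EReal) < lifespan hμ V A F₁ F₂ (flow hμ V A F₁ F₂ s x) ↔
      ((s + t : ℝ) : EReal) < lifespan hμ V A F₁ F₂ x := by
  obtain ⟨hx, hs, hslt⟩ := id hsx
  rcases hs.eq_or_lt with rfl | hs
  · rw [flow_zero, zero_add]
  rcases ht.eq_or_lt with rfl | ht
  · rw [add_zero]
    exact iff_of_true (hP.lifespan_pos (hP.flow_mem hsx)) hslt
  rw [hP.lt_lifespan_iff ht, hP.lt_lifespan_iff (add_pos hs ht)]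
  obtain ⟨v₀, hv₀⟩ := (hP.lt_lifespan_iff hs).mp hslt
  obtain ⟨b, hb, v, hv⟩ := hP.exists_gt_isMildSolution hs hv₀
  constructor
  · rintro ⟨w, hw⟩
    rw [hP.flow_eq hx hv ⟨hs, hb.le⟩] at hw
    rcases le_total (s + t) b with h | h
    · exact ⟨v, hv.mono h⟩
    · exact hP.exists_isMildSolution_add hs hb h hv hw
  · rintro ⟨w, hw⟩
    have hws := hw.shift ⟨hs, lt_add_of_pos_right s ht⟩
    rw [add_sub_cancel_left, ← hP.flow_eq hx hw ⟨hs, (lt_add_of_pos_right s ht).le⟩] at hws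
    exact ⟨_, hws⟩

theorem flow_add (hP : IsAdmissible j μ V A F₁ F₂) {s t : ℝ}
    (hsx : (s, x) ∈ flowDomain V (lifespan hμ V A F₁ F₂))
    (htx : (t, flow hμ V A F₁ F₂ s x) ∈ flowDomain V (lifespan hμ V A F₁ F₂)) :
    flow hμ V A F₁ F₂ (s + t) x = flow hμ V A F₁ F₂ t (flow hμ V A F₁ F₂ s x) := by
  have hst := (hP.lt_lifespan_flow_iff hsx htx.2.1).mp htx.2.2
  obtain ⟨hx, hs, -⟩ := hsx
  rcases hs.eq_or_lt with rfl | hs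
  · rw [flow_zero, zero_add]
  rcases htx.2.1.eq_or_lt with rfl | ht
  · rw [flow_zero, add_zero]
  obtain ⟨w, hw⟩ := (hP.lt_lifespan_iff (add_pos hs ht)).mp hst
  have hs' : s ∈ Ioo 0 (s + t) := ⟨hs, lt_add_of_pos_right s ht⟩
  have hws := hw.shift hs'
  rw [add_sub_cancel_left] at hws
  rw [hP.flow_eq hx hw (right_mem_Ioc.mpr (add_pos hs ht)),
    hP.flow_eq hx hw (Ioo_subset_Ioc_self hs'),
    hP.flow_eq (hw.mem s (Ioo_subset_Ioc_self hs')) hws (right_mem_Ioc.mpr ht)]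

theorem isOrbitSemiflow (hP : IsAdmissible j μ V A F₁ F₂) :
    IsOrbitSemiflow V (lifespan hμ V A F₁ F₂) (flow hμ V A F₁ F₂) where
  lifespan_pos _ hx := hP.lifespan_pos hx
  mapsTo _ _ h := hP.flow_mem h
  map_zero x _ := flow_zero x
  lifespan_shift _ _ _ h ht := hP.lt_lifespan_flow_iff h ht
  map_add _ _ _ hsx htx := hP.flow_add hsx htx
  continuousOn_orbit _ _ h := hP.continuousOn_flow_left h.1 h.2.2

theorem exists_local_flow (hP : IsAdmissible j μ V A F₁ F₂) {x₀ : InterpSpace j μ}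
    (hx₀ : x₀ ∈ V) :
    ∃ τ > (0 : ℝ), ∃ ε > (0 : ℝ), ∃ σ > (0 : ℝ), ∃ c > (0 : ℝ),
      (∀ x ∈ Metric.closedBall x₀ ε, x ∈ V ∧ (τ : EReal) < lifespan hμ V A F₁ F₂ x ∧
        ContinuousOn (fun t => flow hμ V A F₁ F₂ t x) (Icc 0 τ)) ∧
      ∀ x₁ ∈ Metric.closedBall x₀ ε, ∀ x₂ ∈ Metric.closedBall x₀ ε,
        (∀ t ∈ Ioc 0 τ, t ^ (1 - μ) *
          (‖derivWithin (fun s => InterpSpace.incl (flow hμ V A F₁ F₂ s x₁)) (Ioc 0 τ) t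
              - derivWithin (fun s => InterpSpace.incl (flow hμ V A F₁ F₂ s x₂)) (Ioc 0 τ) t‖
            + ‖toE₁ j (InterpSpace.incl (flow hμ V A F₁ F₂ t x₁))
              - toE₁ j (InterpSpace.incl (flow hμ V A F₁ F₂ t x₂))‖) ≤ σ * ‖x₁ - x₂‖) ∧
        ∀ t ∈ Icc 0 τ,
          ‖flow hμ V A F₁ F₂ t x₁ - flow hμ V A F₁ F₂ t x₂‖ ≤ c * ‖x₁ - x₂‖ := by
  obtain ⟨τ, hτ, ε, hε, K, hK, hball, S, hS, hSK⟩ := exists_local_solution (hμ := hμ) hP.injective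
    hP.isOpen hP.lipschitz hP.structural hx₀
  have hlt : ∀ x ∈ Metric.closedBall x₀ ε, (τ : EReal) < lifespan hμ V A F₁ F₂ x := fun x hx =>
    (hP.lt_lifespan_iff hτ).mpr ⟨_, hS x hx⟩
  have hflow : ∀ x ∈ Metric.closedBall x₀ ε, ∀ t ∈ Ioc 0 τ,
      flow hμ V A F₁ F₂ t x = embed j hμ (S x t) := fun x hx t ht =>
    hP.flow_eq (hball hx) (hS x hx) ht
  have hderiv : ∀ x ∈ Metric.closedBall x₀ ε, ∀ t ∈ Ioc 0 τ,
      derivWithin (fun s => InterpSpace.incl (flow hμ V A F₁ F₂ s x)) (Ioc 0 τ) t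
        = vectorField hμ A F₁ F₂ (S x t) := fun x hx t ht =>
    ((hS x hx).memMaxReg hP.injective hτ (flow_zero x) (hflow x hx)).2 ht
  refine ⟨τ, hτ, ε, hε, K, hK, K + 1, by positivity, fun x hx => ⟨hball hx, hlt x hx,
    hP.continuousOn_flow_left (hball hx) (hlt x hx)⟩, fun x₁ hx₁ x₂ hx₂ => ⟨fun t ht => ?_,
    fun t ht => ?_⟩⟩
  · have hSKt := hSK x₁ hx₁ x₂ hx₂ t ht
    rw [weightedNorm] at hSKt
    rw [hderiv x₁ hx₁ t ht, hderiv x₂ hx₂ t ht, hflow x₁ hx₁ t ht, hflow x₂ hx₂ t ht, incl_embed,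
      incl_embed, toE₁_apply hP.injective, toE₁_apply hP.injective, mul_add]
    linarith [norm_nonneg (embed j hμ (S x₁ t - S x₂ t))]
  · rcases ht.1.eq_or_lt with rfl | ht₀
    · rw [flow_zero, flow_zero]
      exact le_mul_of_one_le_left (norm_nonneg _) (le_add_of_nonneg_left hK.le)
    · have hSKt := hSK x₁ hx₁ x₂ hx₂ t ⟨ht₀, ht.2⟩
      rw [weightedNorm] at hSKt
      rw [hflow x₁ hx₁ t ⟨ht₀, ht.2⟩, hflow x₂ hx₂ t ⟨ht₀, ht.2⟩, ← map_sub]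
      have hE₁ : 0 ≤ t ^ (1 - μ) * ‖S x₁ t - S x₂ t‖ := by positivity
      have hE₀ : 0 ≤ t ^ (1 - μ)
        * ‖vectorField hμ A F₁ F₂ (S x₁ t) - vectorField hμ A F₁ F₂ (S x₂ t)‖ := by positivity
      linarith [norm_nonneg (x₁ - x₂)]

theorem exists_isFlowLipschitzNear (hP : IsAdmissible j μ V A F₁ F₂) (hx : x ∈ V) :
    ∃ τ > 0, IsFlowLipschitzNear V (lifespan hμ V A F₁ F₂) (flow hμ V A F₁ F₂) τ x := by
  obtain ⟨τ, hτ, ε, hε, _, -, c, hc, hball, hlip⟩ := hP.exists_local_flow (hμ := hμ) hx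
  refine ⟨τ, hτ, _, Metric.closedBall_mem_nhds x hε, ⟨c, hc.le⟩,
    fun y hy => ⟨(hball y hy).1, hτ.le, (hball y hy).2.1⟩,
    fun s hs => lipschitzOnWith_iff_norm_sub_le.mpr fun y hy z hz => (hlip y hy z hz).2 s hs⟩

end IsAdmissible

end GlobalTheory

end QuasilinearSemiflow

end

theorem corollary2p3_general {E₀ E₁ : Type*}
    [NormedAddCommGroup E₀] [NormedSpace ℝ E₀] [CompleteSpace E₀]
    [NormedAddCommGroup E₁] [NormedSpace ℝ E₁] [CompleteSpace E₁]
    (j : E₁ →L[ℝ] E₀) (hj : Function.Injective j)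
    (μ : ℝ) (hμ : μ ∈ Set.Ioo (0 : ℝ) 1)
    (V : Set (InterpSpace j μ)) (hV : IsOpen V)
    (A : InterpSpace j μ → E₁ →L[ℝ] E₀)
    (F₁ F₂ : InterpSpace j μ → E₀)
    (h₁ : LipschitzHypothesis j μ V A F₁)
    (h₂ : StructuralHypothesis j μ V F₂) :
    ∃ (tp : InterpSpace j μ → EReal)
      (u : ℝ → InterpSpace j μ → InterpSpace j μ),
      IsMaximalSolutionMap j μ V A F₁ F₂ tp u ∧
      (∀ x₀ ∈ V, ∃ τ > (0 : ℝ), ∃ ε > (0 : ℝ), ∃ σ > (0 : ℝ), ∃ c > (0 : ℝ),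
        (∀ x ∈ Metric.closedBall x₀ ε, x ∈ V ∧ (τ : EReal) < tp x ∧
          ContinuousOn (fun t => u t x) (Icc 0 τ)) ∧
        ∀ x₁ ∈ Metric.closedBall x₀ ε, ∀ x₂ ∈ Metric.closedBall x₀ ε,
          (∀ t ∈ Ioc 0 τ,
            t ^ (1 - μ) *
              (‖derivWithin (fun s => InterpSpace.incl (u s x₁))
                    (Ioc 0 τ) t
                  - derivWithin (fun s => InterpSpace.incl (u s x₂))
                    (Ioc 0 τ) t‖
                + ‖toE₁ j (InterpSpace.incl (u t x₁))
                  - toE₁ j (InterpSpace.incl (u t x₂))‖)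
              ≤ σ * ‖x₁ - x₂‖) ∧
          ∀ t ∈ Icc 0 τ, ‖u t x₁ - u t x₂‖ ≤ c * ‖x₁ - x₂‖) ∧
      IsLocallyLipschitzSemiflow V tp u := by
  have hP : IsAdmissible j μ V A F₁ F₂ := ⟨hj, hV, h₁, h₂⟩
  exact ⟨lifespan hμ V A F₁ F₂, flow hμ V A F₁ F₂, hP.isMaximalSolutionMap,
    fun _ hx₀ => hP.exists_local_flow hx₀,
    hP.isOrbitSemiflow.isLocallyLipschitzSemiflow fun _ hx => hP.exists_isFlowLipschitzNear hx⟩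

theorem corollary2p3 {E₀ E₁ : Type*}
    [NormedAddCommGroup E₀] [NormedSpace ℝ E₀] [CompleteSpace E₀]
    [NormedAddCommGroup E₁] [NormedSpace ℝ E₁] [CompleteSpace E₁]
    (j : E₁ →L[ℝ] E₀) (hj : Function.Injective j) (hdense : DenseRange j)
    (μ : ℝ) (hμ : μ ∈ Set.Ioo (0 : ℝ) 1)
    (V : Set (InterpSpace j μ)) (hV : IsOpen V)
    (A : InterpSpace j μ → E₁ →L[ℝ] E₀)
    (F₁ F₂ : InterpSpace j μ → E₀)
    (h₁ : LipschitzHypothesis j μ V A F₁)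
    (h₂ : StructuralHypothesis j μ V F₂) :
    ∃ (tp : InterpSpace j μ → EReal)
      (u : ℝ → InterpSpace j μ → InterpSpace j μ),
      IsMaximalSolutionMap j μ V A F₁ F₂ tp u ∧
      (∀ x₀ ∈ V, ∃ τ > (0 : ℝ), ∃ ε > (0 : ℝ), ∃ σ > (0 : ℝ), ∃ c > (0 : ℝ),
        (∀ x ∈ Metric.closedBall x₀ ε, x ∈ V ∧ (τ : EReal) < tp x ∧
          ContinuousOn (fun t => u t x) (Icc 0 τ)) ∧
        ∀ x₁ ∈ Metric.closedBall x₀ ε, ∀ x₂ ∈ Metric.closedBall x₀ ε,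
          (∀ t ∈ Ioc 0 τ,
            t ^ (1 - μ) *
              (‖derivWithin (fun s => InterpSpace.incl (u s x₁))
                    (Ioc 0 τ) t
                  - derivWithin (fun s => InterpSpace.incl (u s x₂))
                    (Ioc 0 τ) t‖
                + ‖toE₁ j (InterpSpace.incl (u t x₁))
                  - toE₁ j (InterpSpace.incl (u t x₂))‖)
              ≤ σ * ‖x₁ - x₂‖) ∧
          ∀ t ∈ Icc 0 τ, ‖u t x₁ - u t x₂‖ ≤ c * ‖x₁ - x₂‖) ∧
      IsLocallyLipschitzSemiflow V tp u :=
  corollary2p3_general j hj μ hμ V hV A F₁ F₂ h₁ h₂
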